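/- **Proposition.** Let $n,m\ge 0$, let $a=(a_1,\dots,a_n)\in\mathbb Z_{\ge0}^n$ and $b=(b_1,\dots,b_m)\in\mathbb Z_{\ge0}^m$ with $\sum_i a_i=\sum_k b_k$, and let $\lambda^{(n)}\in\mathbb C^n$. Put $S(b)=S^{b_1}\mathbb C^n\otimes\dots\otimes S^{b_m}\mathbb C^n$, let $S(b)[a]$ be its $\mathfrak{gl}_n$-weight subspace of weight $a$, and let $M$ be the Verma $\mathfrak{gl}_n$-module of highest weight $\lambda^{(n)}$ with highest weight vector $v_{\lambda^{(n)}}$. Let $(S(b)\otimes M)^{sing}[\lambda^{(n)}+a]$ be the space of vectors of weight $\lambda^{(n)}+a$ annihilated by all $e_{ij}$, $i<j$, and define the linear map $\theta:(S(b)\otimes M)^{sing}[\lambda^{(n)}+a]\to S(b)[a]$ by $v=\theta(v)\otimes v_{\lambda^{(n)}}+\sum_i w_i\otimes v_i$ with weight vectors $v_i\in M$ of weights different from $\lambda^{(n)}$. Assume that $\theta$ is bijective (this holds for generic $\lambda^{(n)}$). *The difference operator.* Let $\lambda^{(m)}=(\lambda_{n+1},\dots,\lambda_{n+m})$ be independent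 variables and $w_k=\lambda_{n+k}+b_k-k$, $k=1,\dots,m$. Write $e_{ij}^{(k)}$, $k=1,\dots,m+1$, for $e_{ij}$ acting on the $k$-th tensor factor of $S^{b_1}\mathbb C^n\otimes\dots\otimes S^{b_m}\mathbb C^n\otimes M$. Let $T(u)=(t_{ij}(u))_{i,j=1}^n$ be the ordered product of the $n\times n$ matrices $\bigl(\delta_{ij}+\frac{e^{(k)}_{ij}}{u-w_k}\bigr)_{ij}$, $k=1,\dots,m$, and $\bigl(\delta_{ij}+\frac{e^{(m+1)}_{ij}}{u}\bigr)_{ij}$, expanded in powers of $u^{-1}$; this is the action of the Yangian $Y(\mathfrak{gl}_n)$ on the tensor product of the evaluation modules $S^{b_k}\mathbb C^n(w_k)$ and $M(0)$. Let $(\tau f)(u)=f(u+1)$, $d=\tau-1$, and $$D=\sum_{\sigma\in S_n}(-1)^\sigma D_{\sigma(1),1}\cdots D_{\sigma(n),n},\qquad D_{ij}=\delta_{ij}\tau-t_{ij}(u-j+1).$$ Let $D_n=D_n(b,w;a,\lambda^{(n)})$ be the difference operator with coefficients in $\bigl(\mathrm{End}(S(b)[a])\otimes\mathbb C(\lambda^{(m)})\bigr)((u^{-1}))$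 obtained from $D$, written with its coefficients to the left of the powers of $\tau$, by replacing each coefficient $X$ by $\theta X\theta^{-1}$, and let $\overline{\mathcal B}_n\subset\mathrm{End}(S(b)[a])\otimes\mathbb C(\lambda^{(m)})$ be the $\mathbb C(\lambda^{(m)})$-subalgebra generated by the coefficients of $D_n$. *The trigonometric Gaudin operator.* Let $\xi=(\xi_1,\dots,\xi_m)$ be independent variables, $e_{ij}(u)=\sum_{k=1}^m\frac{e_{ij}^{(k)}}{u-\xi_k}+\frac{e_{ij}^{(m+1)}}{u}$ and $$\mathfrak D=\sum_{\sigma\in S_n}(-1)^\sigma\mathfrak D_{\sigma(1),1}\cdots\mathfrak D_{\sigma(n),n},\qquad \mathfrak D_{ij}=\delta_{ij}\partial_u-e_{ij}(u).$$ Let $\mathfrak D_n^{tG}=\mathfrak D_n^{tG}(b,\xi;a,\lambda^{(n)})$, with coefficients in $\bigl(\mathrm{End}(S(b)[a])\otimes\mathbb C(\xi)\bigr)((u^{-1}))$, be obtained from $\mathfrak D$, written with its coefficients to the left of the powers of $\partial_u$, by replacing each coefficient $X$ by $\theta X\theta^{-1}$. *Filtration.* Let $\pi:\mathbb C(\lambda^{(m)})\to\mathbb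 C(\xi)((r^{-1}))$ be the homomorphism $\lambda_{n+k}\mapsto r\xi_k$. For $p\in\mathbb C(\lambda^{(m)})$ write $\deg p\le q$ if no power $r^{l}$ with $l>q$ occurs in $\pi(p)$. For a complex vector space $V$ let $\mathcal F_q\subset V\otimes\mathbb C(\lambda^{(m)})$ be the span of all $v\otimes p$ with $\deg p\le q$; write $\deg f\le q$ for $f\in\mathcal F_q$, and let $gr_q(\sum_i v_i\otimes p_i)\in V\otimes\mathbb C(\xi)$ be $\sum_i v_i\otimes(\text{coefficient of }r^q\text{ in }\pi(p_i))$. Then there are elements $C_{ij}\in\overline{\mathcal B}_n$, $i=0,\dots,m$, $j=0,\dots,n$, such that $$u(u-1)\cdots(u-n+1)\prod_{k=1}^m(u-w_k)\,D_n=\sum_{i=0}^m\sum_{j=0}^n C_{ij}\,(u+m)^i\,(u-n+1)(u-n+2)\cdots(u-n+j)\,d^j ,\qquad(*)$$ and for all $C_{ij}\in\mathrm{End}(S(b)[a])\otimes\mathbb C(\lambda^{(m)})$ satisfying $(*)$ one has $\deg C_{ij}\le m-i$ for all $i,j$, and $$\sum_{i=0}^m\sum_{j=0}^n gr_{m-i}(C_{ij})\,u^{i+j}\partial_u^j=u^n\prod_{k=1}^m(u-\xi_k)\;\mathfrak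 D_n^{tG}(b,\xi;a,\lambda^{(n)}).$$ -/

import Mathlib

open scoped TensorProduct

namespace BetheGaudin

noncomputable section

/-! ### Series in `u⁻¹`

`LaurentSeries B` is used for `B((u⁻¹))`: the coefficient with index `k` is the coefficient of
`u⁻ᵏ`; `B` may be noncommutative and `u` is central. -/

section Series

/-- `B((u⁻¹))`. -/
abbrev USeries (B : Type*) [Ring B] : Type _ := LaurentSeries B

variable {B : Type*} [Ring B]

/-- The variable `u` itself. -/
def uVar : USeries B := HahnSeries.single (-1) 1

/-- The coefficient of `u⁻ᴺ` in `f(u + c)`, where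
`(u + c)⁻ᵏ = ∑_{j ≥ 0} (-k choose j) c^j u^(-k-j)` is expanded in powers of `u⁻¹`. -/
def shiftCoeff (c : ℤ) (f : USeries B) (N : ℤ) : B :=
  ∑ k ∈ Finset.Icc f.order N,
    (Ring.choose (-k) (N - k).toNat * c ^ (N - k).toNat) • f.coeff k

theorem shiftCoeff_eq (c : ℤ) (f : USeries B) (N L : ℤ)
    (hL : ∀ k < L, f.coeff k = 0) :
    shiftCoeff c f N = ∑ k ∈ Finset.Icc L N,
      (Ring.choose (-k) (N - k).toNat * c ^ (N - k).toNat) • f.coeff k := by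
  have key : ∀ L₁ L₂ : ℤ, L₁ ≤ L₂ → (∀ k < L₂, f.coeff k = 0) →
      ∑ k ∈ Finset.Icc L₂ N, (Ring.choose (-k) (N - k).toNat * c ^ (N - k).toNat) • f.coeff k =
      ∑ k ∈ Finset.Icc L₁ N,
        (Ring.choose (-k) (N - k).toNat * c ^ (N - k).toNat) • f.coeff k := by
    intro L₁ L₂ h h0
    refine Finset.sum_subset (Finset.Icc_subset_Icc_left h) ?_
    intro k hk hk'
    rw [h0 k, smul_zero]
    simp only [Finset.mem_Icc, not_and, not_le] at hk hk'
    by_contra hlt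
    exact absurd (hk' (not_lt.mp hlt)) (not_lt.mpr hk.2)
  have ho : ∀ k < f.order, f.coeff k = 0 := fun k hk => HahnSeries.coeff_eq_zero_of_lt_order hk
  rw [shiftCoeff, key (min L f.order) f.order (min_le_right _ _) ho,
    key (min L f.order) L (min_le_left _ _) hL]

/-- The substitution `f(u) ↦ f(u + c)`, as an additive map. -/
def shiftSeries (c : ℤ) : USeries B →+ USeries B where
  toFun f := HahnSeries.ofSuppBddBelow (shiftCoeff c f)
    ⟨f.order, fun N hN => by
      contrapose! hN
      rw [Function.notMem_support, shiftCoeff, Finset.Icc_eq_empty (not_le.mpr hN),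
        Finset.sum_empty]⟩
  map_zero' := by
    ext N
    change shiftCoeff c 0 N = 0
    simp [shiftCoeff]
  map_add' f g := by
    ext N
    have hf : ∀ k < min f.order g.order, f.coeff k = 0 := fun k hk =>
      HahnSeries.coeff_eq_zero_of_lt_order (lt_of_lt_of_le hk (min_le_left _ _))
    have hg : ∀ k < min f.order g.order, g.coeff k = 0 := fun k hk =>
      HahnSeries.coeff_eq_zero_of_lt_order (lt_of_lt_of_le hk (min_le_right _ _))
    have hfg : ∀ k < min f.order g.order, (f + g).coeff k = 0 := fun k hk => by
      rw [HahnSeries.coeff_add, hf k hk, hg k hk, add_zero]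
    change shiftCoeff c (f + g) N = shiftCoeff c f N + shiftCoeff c g N
    rw [shiftCoeff_eq c _ N _ hfg, shiftCoeff_eq c f N _ hf, shiftCoeff_eq c g N _ hg,
      ← Finset.sum_add_distrib]
    exact Finset.sum_congr rfl fun k _ => by rw [HahnSeries.coeff_add, smul_add]

/-- The derivative `d/du`, that is, `u⁻ᵏ ↦ -k u⁻ᵏ⁻¹`, as an additive map. -/
def derivSeries : USeries B →+ USeries B where
  toFun f := HahnSeries.ofSuppBddBelow (fun N => (-(N - 1)) • f.coeff (N - 1))
    ⟨f.order, fun N hN => by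
      contrapose! hN
      rw [Function.notMem_support, HahnSeries.coeff_eq_zero_of_lt_order (by omega), smul_zero]⟩
  map_zero' := by
    ext N
    simp
  map_add' f g := by
    ext N
    change (-(N - 1)) • (f.coeff (N - 1) + g.coeff (N - 1)) =
      (-(N - 1)) • f.coeff (N - 1) + (-(N - 1)) • g.coeff (N - 1)
    rw [smul_add]

/-! ### Difference and differential operators

An operator `∑ₖ fₖ(u) τᵏ` (or `∑ₖ fₖ(u) ∂ᵤᵏ`) is represented by the finitely supported sequence of
its left coefficients `fₖ`, listed by `k`. The algebra of operators acts on itself from the left: products are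
formed from the additive endomorphisms "multiply on the left by the series `g`",
"multiply on the left by `τ`" (`τ f = f(u+1) τ`) and "multiply on the left by `∂`"
(`∂ f = f ∂ + f'`), and an operator is recovered as the image of the identity operator. -/

/-- Left coefficients of a difference or differential operator over `B((u⁻¹))`. -/
abbrev OpCoeffs (B : Type*) [Ring B] : Type _ := ℕ →₀ USeries B

/-- The identity operator. -/
def opOne : OpCoeffs B := Finsupp.single 0 1

/-- The operator `P`, recovered from the left multiplication `F = (P · )` as `F(1)`. -/
def ofLeftMul (F : AddMonoid.End (OpCoeffs B)) : OpCoeffs B := F opOne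

/-- Left multiplication by a series. -/
def mulSeries (g : USeries B) : AddMonoid.End (OpCoeffs B) :=
  Finsupp.mapRange.addMonoidHom (AddMonoidHom.mulLeft g)

/-- Left multiplication by the shift operator `τ`, where `(τ f)(u) = f(u + 1)`:
`∑ fₖ τᵏ ↦ ∑ fₖ(u + 1) τᵏ⁺¹`. -/
def tauOp : AddMonoid.End (OpCoeffs B) :=
  Finsupp.liftAddHom fun k => (Finsupp.singleAddHom (k + 1)).comp (shiftSeries 1)

/-- Left multiplication by `d = τ - 1`. -/
def dOp : AddMonoid.End (OpCoeffs B) := tauOp - 1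

/-- Left multiplication by `∂ᵤ = d/du`: `∑ fₖ ∂ᵏ ↦ ∑ (fₖ ∂ᵏ⁺¹ + fₖ' ∂ᵏ)`. -/
def partialOp : AddMonoid.End (OpCoeffs B) :=
  Finsupp.liftAddHom fun k =>
    Finsupp.singleAddHom (k + 1) + (Finsupp.singleAddHom k).comp derivSeries

end Series

/-- The column determinant `∑_σ sgn(σ) M_{σ(1),1} M_{σ(2),2} ⋯ M_{σ(n),n}`. -/
def columnDet {R : Type*} [Ring R] {n : ℕ} (M : Matrix (Fin n) (Fin n) R) : R :=
  ∑ σ : Equiv.Perm (Fin n), (Equiv.Perm.sign σ : ℤ) • (List.ofFn fun j => M (σ j) j).prod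

/-! ### Representations of `𝔤𝔩ₙ` -/

/-- The Lie algebra `𝔤𝔩ₙ` over `ℂ`. -/
abbrev gl (n : ℕ) : Type := Matrix (Fin n) (Fin n) ℂ

instance (n : ℕ) : LieRing (gl n) := LieRing.ofAssociativeRing

/-- The universal enveloping algebra `U(𝔤𝔩ₙ)`. -/
abbrev Ugl (n : ℕ) : Type := UniversalEnvelopingAlgebra ℂ (gl n)

/-- The generator `eᵢⱼ` in `U(𝔤𝔩ₙ)`. -/
def eU {n : ℕ} (i j : Fin n) : Ugl n :=
  UniversalEnvelopingAlgebra.ι ℂ (Matrix.single i j (1 : ℂ) : gl n)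

/-- The left ideal of `U(𝔤𝔩ₙ)` generated by `eᵢⱼ`, `i < j`, and `eᵢᵢ - λᵢ`. -/
def vermaIdeal {n : ℕ} (lam : Fin n → ℂ) : Submodule (Ugl n) (Ugl n) :=
  Submodule.span (Ugl n)
    ({x | ∃ i j : Fin n, i < j ∧ x = eU i j} ∪
      {x | ∃ i : Fin n, x = eU i i - algebraMap ℂ (Ugl n) (lam i)})

/-- The Verma module `M_λ` of highest weight `λ`. -/
abbrev Verma {n : ℕ} (lam : Fin n → ℂ) : Type := Ugl n ⧸ vermaIdeal lam

/-- The highest weight vector `v_λ`. -/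
def vermaTop {n : ℕ} (lam : Fin n → ℂ) : Verma lam := Submodule.Quotient.mk 1

/-- The action of `eᵢⱼ` on `M_λ`. -/
def eVerma {n : ℕ} (lam : Fin n → ℂ) (i j : Fin n) : Module.End ℂ (Verma lam) :=
  Algebra.lsmul ℂ ℂ (Verma lam) (eU i j)

/-- The weight subspace `M_λ[μ]`. -/
def vermaWeight {n : ℕ} (lam mu : Fin n → ℂ) : Submodule ℂ (Verma lam) :=
  ⨅ i, LinearMap.ker (eVerma lam i i - algebraMap ℂ (Module.End ℂ (Verma lam)) (mu i))

/-! Auxiliary construction, used only to see that `v_λ ≠ 0` in `M_λ`: a representation of `𝔤𝔩ₙ`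
with a nonzero highest weight vector of weight `λ`, on the rational functions of the entries of an
`n × n` matrix `X`, where `E` acts as the vector field `X ↦ Eᵀ X` twisted by the logarithmic
derivative of a product of complex powers of the leading principal minors of `X`. -/

section Auxiliary

attribute [local instance 100] LieRing.ofAssociativeRing

variable {n : ℕ}

/-- Rational functions of the entries of an `n × n` matrix. -/
abbrev MatFun (n : ℕ) : Type := FractionRing (MvPolynomial (Fin n × Fin n) ℂ)

/-- The generic matrix. -/
def genMat (n : ℕ) : Matrix (Fin n) (Fin n) (MatFun n) :=
  Matrix.of fun i j => algebraMap (MvPolynomial (Fin n × Fin n) ℂ) (MatFun n)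
    (MvPolynomial.X (i, j))

/-- The first-order flow of the vector field on polynomials. -/
def polyFlow (E : gl n) :
    MvPolynomial (Fin n × Fin n) ℂ →ₐ[ℂ] TrivSqZeroExt (MatFun n) (MatFun n) :=
  MvPolynomial.aeval fun p => TrivSqZeroExt.inl (genMat n p.1 p.2) +
    TrivSqZeroExt.inr (∑ a, E a p.1 • genMat n a p.2)

theorem polyFlow_fst (E : gl n) (p : MvPolynomial (Fin n × Fin n) ℂ) :
    (polyFlow E p).fst = algebraMap _ (MatFun n) p := by
  have : (TrivSqZeroExt.fstHom ℂ (MatFun n) (MatFun n)).comp (polyFlow E) =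
      (Algebra.ofId (MvPolynomial (Fin n × Fin n) ℂ) (MatFun n)).restrictScalars ℂ := by
    apply MvPolynomial.algHom_ext
    intro p
    simp [polyFlow, genMat, Algebra.ofId_apply]
  exact DFunLike.congr_fun this p

/-- The first-order flow of the vector field on rational functions. -/
def ratFlow (E : gl n) : MatFun n →+* TrivSqZeroExt (MatFun n) (MatFun n) :=
  IsLocalization.lift (M := nonZeroDivisors (MvPolynomial (Fin n × Fin n) ℂ))
    (g := (polyFlow E : MvPolynomial (Fin n × Fin n) ℂ →+* _)) fun y => by
      rw [TrivSqZeroExt.isUnit_iff_isUnit_fst]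
      erw [polyFlow_fst]
      exact IsLocalization.map_units _ y

theorem ratFlow_algebraMap (E : gl n) (p : MvPolynomial (Fin n × Fin n) ℂ) :
    ratFlow E (algebraMap _ (MatFun n) p) = polyFlow E p := by
  rw [ratFlow, IsLocalization.lift_eq]
  rfl

theorem ratFlow_fst (E : gl n) (f : MatFun n) : (ratFlow E f).fst = f := by
  have : (TrivSqZeroExt.fstHom ℂ (MatFun n) (MatFun n) : _ →+* MatFun n).comp (ratFlow E) =
      RingHom.id _ := by
    apply IsLocalization.ringHom_ext (nonZeroDivisors (MvPolynomial (Fin n × Fin n) ℂ))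
    refine RingHom.ext fun p => ?_
    change (ratFlow E (algebraMap _ (MatFun n) p)).fst = algebraMap _ (MatFun n) p
    rw [ratFlow_algebraMap, polyFlow_fst]
  exact DFunLike.congr_fun this f

/-- The vector field of `E` as a derivation. -/
def vecField (E : gl n) : Derivation ℂ (MatFun n) (MatFun n) :=
  Derivation.mk'
    { toFun := fun f => (ratFlow E f).snd
      map_add' := fun f g => by simp
      map_smul' := fun c f => by
        have hc : ratFlow E (algebraMap ℂ (MatFun n) c) = TrivSqZeroExt.inl (algebraMap ℂ _ c) := by
          rw [IsScalarTower.algebraMap_apply ℂ (MvPolynomial (Fin n × Fin n) ℂ) (MatFun n),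
            ratFlow_algebraMap, AlgHom.commutes]
          rfl
        rw [Algebra.smul_def, map_mul, hc]
        simp [Algebra.smul_def] }
    (fun f g => by simp [ratFlow_fst, mul_comm])

theorem vecField_genMat (E : gl n) (i j : Fin n) :
    vecField E (genMat n i j) = ∑ a, E a i • genMat n a j := by
  change (ratFlow E (genMat n i j)).snd = _
  rw [genMat, Matrix.of_apply, ratFlow_algebraMap, polyFlow]
  simp [genMat]

theorem derivation_ext_genMat {D D' : Derivation ℂ (MatFun n) (MatFun n)}
    (h : ∀ i j, D (genMat n i j) = D' (genMat n i j)) : D = D' := by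
  have hp : ∀ p : MvPolynomial (Fin n × Fin n) ℂ,
      D (algebraMap _ (MatFun n) p) = D' (algebraMap _ (MatFun n) p) := by
    intro p
    have := MvPolynomial.derivation_ext (D₁ := D.compAlgebraMap (MvPolynomial (Fin n × Fin n) ℂ))
      (D₂ := D'.compAlgebraMap (MvPolynomial (Fin n × Fin n) ℂ)) (fun i => h i.1 i.2)
    exact congrArg (fun D => D p) this
  ext f
  obtain ⟨p, q, hq, rfl⟩ := IsFractionRing.div_surjective (A := MvPolynomial (Fin n × Fin n) ℂ) f
  rw [Derivation.leibniz_div, Derivation.leibniz_div, hp, hp]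

theorem vecField_add (E F : gl n) : vecField (E + F) = vecField E + vecField F :=
  derivation_ext_genMat fun i j => by
    simp [vecField_genMat, add_smul, Finset.sum_add_distrib]

theorem vecField_smul (c : ℂ) (E : gl n) : vecField (c • E) = c • vecField E :=
  derivation_ext_genMat fun i j => by
    simp [vecField_genMat, mul_smul, Finset.smul_sum]

theorem vecField_lie (E F : gl n) : vecField ⁅E, F⁆ = ⁅vecField E, vecField F⁆ :=
  derivation_ext_genMat fun i j => by
    have key : ∀ E F : gl n, vecField E (vecField F (genMat n i j)) =
        ∑ a, (E * F) a i • genMat n a j := by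
      intro E F
      simp only [vecField_genMat, map_sum, Derivation.map_smul, Matrix.mul_apply, Finset.smul_sum,
        Finset.sum_smul, smul_smul]
      rw [Finset.sum_comm]
      exact Finset.sum_congr rfl fun a _ => Finset.sum_congr rfl fun b _ => by rw [mul_comm]
    rw [Derivation.commutator_apply, key, key, vecField_genMat, ← Finset.sum_sub_distrib]
    exact Finset.sum_congr rfl fun a _ => by
      rw [← sub_smul]
      rfl

/-- The leading principal minor with rows and columns `0, …, k`. -/
def minor (k : Fin n) : MatFun n :=
  ((genMat n).submatrix (fun i : {i // i ≤ k} => i.1) (fun i : {i // i ≤ k} => i.1)).det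

theorem minor_ne_zero (k : Fin n) : minor k ≠ 0 := by
  have h : minor k = algebraMap (MvPolynomial (Fin n × Fin n) ℂ) (MatFun n)
      ((Matrix.of fun i j : Fin n => (MvPolynomial.X (i, j) :
        MvPolynomial (Fin n × Fin n) ℂ)).submatrix (fun i : {i // i ≤ k} => i.1)
          (fun i : {i // i ≤ k} => i.1)).det := by
    rw [RingHom.map_det]
    rfl
  rw [h]
  intro h0
  have h1 := IsFractionRing.injective (MvPolynomial (Fin n × Fin n) ℂ) (MatFun n)
    (h0.trans (map_zero _).symm)
  have h2 := congrArg (MvPolynomial.eval fun p : Fin n × Fin n => if p.1 = p.2 then (1 : ℂ) else 0) h1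
  rw [RingHom.map_det, map_zero] at h2
  have h3 : ((MvPolynomial.eval fun p : Fin n × Fin n => if p.1 = p.2 then (1 : ℂ) else 0).mapMatrix
      ((Matrix.of fun i j : Fin n => (MvPolynomial.X (i, j) :
        MvPolynomial (Fin n × Fin n) ℂ)).submatrix (fun i : {i // i ≤ k} => i.1)
          (fun i : {i // i ≤ k} => i.1))) = 1 := by
    ext i j
    simp [Matrix.one_apply, Subtype.ext_iff]
  rw [h3, Matrix.det_one] at h2
  exact one_ne_zero h2

theorem vecField_minor (i j : Fin n) (hij : i ≤ j) (k : Fin n) :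
    vecField (Matrix.single i j (1 : ℂ) : gl n) (minor k) =
      if i = j ∧ i ≤ k then minor k else 0 := by
  change (ratFlow _ (minor k)).snd = _
  set S := {i // i ≤ k}
  let ι : MatFun n →+* TrivSqZeroExt (MatFun n) (MatFun n) := TrivSqZeroExt.inlHom _ _
  let ε : TrivSqZeroExt (MatFun n) (MatFun n) := TrivSqZeroExt.inr 1
  let G : Matrix S S (TrivSqZeroExt (MatFun n) (MatFun n)) :=
    Matrix.of fun s t => (if s = t then 1 else 0) + (if j = s.1 ∧ i = t.1 then ε else 0)
  let X := (genMat n).submatrix (fun i : S => i.1) (fun i : S => i.1)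
  have hmap : (ratFlow (Matrix.single i j (1 : ℂ) : gl n)).mapMatrix X = G * ι.mapMatrix X := by
    ext1 s t
    have h0 : ∀ x : MatFun n, ratFlow (Matrix.single i j (1 : ℂ) : gl n) x =
        TrivSqZeroExt.inl x +
          TrivSqZeroExt.inr (vecField (Matrix.single i j (1 : ℂ) : gl n) x) := fun x => by
      conv_lhs => rw [← TrivSqZeroExt.inl_fst_add_inr_snd_eq (ratFlow _ x), ratFlow_fst]
      rfl
    rw [RingHom.mapMatrix_apply, Matrix.map_apply, h0, Matrix.mul_apply]
    simp only [X, Matrix.submatrix_apply, vecField_genMat, G, Matrix.of_apply, add_mul,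
      Finset.sum_add_distrib, RingHom.mapMatrix_apply, Matrix.map_apply]
    congr 1
    · simp [ι]
    · by_cases hjs : j = s.1
      · have hik : i ≤ k := hij.trans (hjs ▸ s.2)
        rw [Finset.sum_eq_single i, Finset.sum_eq_single (⟨i, hik⟩ : S)]
        · simp only [hjs, ι, ε]
          ext <;> simp
        · intro b _ hb
          have : i ≠ b.1 := fun h => hb (Subtype.ext h.symm)
          simp [this]
        · simp
        · intro b _ hb
          simp [hb.symm]
        · simp
      · simp [hjs]
  have hG : G.det = if i = j ∧ i ≤ k then 1 + ε else 1 := by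
    rw [Matrix.det_of_isLowerTriangular]
    · by_cases h : i = j ∧ i ≤ k
      · rw [if_pos h, Finset.prod_eq_single (⟨i, h.2⟩ : S)]
        · simp [G, h.1]
        · intro b _ hb
          have : i ≠ b.1 := fun h => hb (Subtype.ext h.symm)
          simp [G, this]
        · simp
      · rw [if_neg h]
        refine Finset.prod_eq_one fun b _ => ?_
        have : ¬ (j = b.1 ∧ i = b.1) := fun hb => h ⟨hb.2.trans hb.1.symm, hb.2 ▸ b.2⟩
        simp [G, this]
    · intro s t hst
      have hst' : s < t := hst
      have h1 : s ≠ t := hst'.ne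
      have h2 : ¬ (j = s.1 ∧ i = t.1) := by
        rintro ⟨rfl, rfl⟩
        exact absurd hij (not_le.mpr hst')
      simp [G, h1, h2]
  have hm : minor k = X.det := rfl
  rw [hm, RingHom.map_det, hmap, Matrix.det_mul, hG, ← RingHom.map_det]
  split_ifs
  · simp [ι, ε]
  · simp [ι]

/-- The twist. -/
def twist (c : Fin n → ℂ) (E : gl n) : MatFun n :=
  ∑ k, c k • (vecField E (minor k) / minor k)

theorem twist_cocycle (c : Fin n → ℂ) (E F : gl n) :
    twist c ⁅E, F⁆ = vecField E (twist c F) - vecField F (twist c E) := by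
  simp only [twist, map_sum, Derivation.map_smul, ← Finset.sum_sub_distrib, ← smul_sub]
  refine Finset.sum_congr rfl fun k _ => ?_
  congr 1
  have hk := minor_ne_zero k
  rw [Derivation.leibniz_div, Derivation.leibniz_div, vecField_lie, Derivation.commutator_apply]
  simp only [smul_eq_mul]
  field_simp
  ring

/-- The twisted representation. -/
def twistRep (c : Fin n → ℂ) : gl n →ₗ⁅ℂ⁆ Module.End ℂ (MatFun n) :=
  { toFun := fun E => (vecField E).toLinearMap + LinearMap.mulLeft ℂ (twist c E)
    map_add' := fun E F => by
      ext f
      simp [vecField_add, twist, add_div, Finset.sum_add_distrib, add_mul]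
      ring
    map_smul' := fun z E => by
      have h : twist c (z • E) = z • twist c E := by
        simp only [twist, vecField_smul, Derivation.smul_apply, smul_div_assoc, smul_comm _ z,
          ← Finset.smul_sum]
      ext f
      simp [vecField_smul, h]
    map_lie' := fun {E F} => by
      refine LinearMap.ext fun f => ?_
      have h : ∀ E F : gl n,
          ((vecField E).toLinearMap + LinearMap.mulLeft ℂ (twist c E))
            (((vecField F).toLinearMap + LinearMap.mulLeft ℂ (twist c F)) f) =
          vecField E (vecField F f) + twist c F * vecField E f + f * vecField E (twist c F) +
            twist c E * vecField F f + twist c E * (twist c F * f) := by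
        intro E F
        simp
        ring
      rw [LieRing.of_associative_ring_bracket (A := Module.End ℂ (MatFun n)), LinearMap.sub_apply,
        Module.End.mul_apply, Module.End.mul_apply, h, h]
      change vecField ⁅E, F⁆ f + twist c ⁅E, F⁆ * f = _
      rw [vecField_lie, twist_cocycle, Derivation.commutator_apply]
      ring }

theorem twistRep_one (c : Fin n → ℂ) (i j : Fin n) (hij : i ≤ j) :
    twistRep c (Matrix.single i j (1 : ℂ)) 1 =
      if i = j then algebraMap ℂ (MatFun n) (∑ k ∈ Finset.Ici i, c k) else 0 := by
  change vecField _ 1 + twist c _ * 1 = _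
  rw [Derivation.map_one_eq_zero, zero_add, mul_one, twist]
  simp only [vecField_minor i j hij]
  by_cases h : i = j
  · rw [if_pos h, map_sum, ← Finset.sum_subset (Finset.subset_univ (Finset.Ici i))]
    · refine Finset.sum_congr rfl fun k hk => ?_
      rw [if_pos ⟨h, Finset.mem_Ici.mp hk⟩, div_self (minor_ne_zero k), Algebra.smul_def, mul_one]
    · intro k _ hk
      rw [if_neg (fun h' => hk (Finset.mem_Ici.mpr h'.2)), zero_div, smul_zero]
  · simp [h]

theorem exists_twist (lam : Fin n → ℂ) :
    ∃ c : Fin n → ℂ, ∀ i, ∑ k ∈ Finset.Ici i, c k = lam i := by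
  let f : ℕ → ℂ := fun i => if h : i < n then lam ⟨i, h⟩ else 0
  refine ⟨fun k => f k - f (k + 1), fun i => ?_⟩
  have h : ∑ k ∈ Finset.Ici i, (f k - f (k + 1)) =
      ∑ k ∈ Finset.Ico (i : ℕ) n, (f k - f (k + 1)) := by
    refine (Finset.sum_map (Finset.Ici i) Fin.valEmbedding
      fun k => f k - f (k + 1)).symm.trans ?_
    congr 1
    ext x
    simp only [Finset.mem_map, Finset.mem_Ici, Fin.valEmbedding_apply, Finset.mem_Ico]
    constructor
    · rintro ⟨y, hy, rfl⟩
      exact ⟨hy, y.2⟩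
    · rintro ⟨h1, h2⟩
      exact ⟨⟨x, h2⟩, h1, rfl⟩
  rw [h, Finset.sum_Ico_eq_sum_range]
  have h' := Finset.sum_range_sub' (fun k => f (i + k)) (n - i)
  simp only [← add_assoc] at h'
  rw [h']
  simp [f, Nat.add_sub_cancel' i.2.le]

theorem vermaTop_ne_zero (lam : Fin n → ℂ) : vermaTop lam ≠ 0 := by
  obtain ⟨c, hc⟩ := exists_twist lam
  let φ : Ugl n →ₐ[ℂ] Module.End ℂ (MatFun n) := UniversalEnvelopingAlgebra.lift ℂ (twistRep c)
  have hφ : ∀ i j, φ (eU i j) = twistRep c (Matrix.single i j (1 : ℂ)) := fun i j =>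
    UniversalEnvelopingAlgebra.lift_ι_apply ℂ (twistRep c) _
  have key : ∀ x ∈ vermaIdeal lam, φ x 1 = 0 := by
    intro x hx
    induction hx using Submodule.span_induction with
    | mem x hx =>
      rcases hx with ⟨i, j, hij, rfl⟩ | ⟨i, rfl⟩
      · rw [hφ, twistRep_one c i j hij.le, if_neg hij.ne]
      · rw [map_sub, hφ, AlgHom.commutes, LinearMap.sub_apply, twistRep_one c i i le_rfl,
          if_pos rfl, hc, Module.algebraMap_end_apply, Algebra.algebraMap_eq_smul_one, sub_self]
    | zero => simp
    | add x y _ _ hx hy => rw [map_add, LinearMap.add_apply, hx, hy, add_zero]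
    | smul u x _ hx => rw [smul_eq_mul, map_mul, Module.End.mul_apply, hx, map_zero]
  intro h
  have h1 := key 1 ((Submodule.Quotient.mk_eq_zero _).mp h)
  simp at h1

theorem vermaTop_mem (lam : Fin n → ℂ) : vermaTop lam ∈ vermaWeight lam lam := by
  rw [vermaWeight, Submodule.mem_iInf]
  intro i
  rw [LinearMap.mem_ker, LinearMap.sub_apply, Module.algebraMap_end_apply]
  have h : (eU i i - algebraMap ℂ (Ugl n) (lam i)) ∈ vermaIdeal lam :=
    Submodule.subset_span (Or.inr ⟨i, rfl⟩)
  have h' := (Submodule.Quotient.mk_eq_zero _).mpr h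
  rw [← h', Submodule.Quotient.mk_sub, Algebra.algebraMap_eq_smul_one, Submodule.Quotient.mk_smul]
  congr 1
  change eU i i • (Submodule.Quotient.mk (1 : Ugl n) : Verma lam) = _
  rw [← Submodule.Quotient.mk_smul, smul_eq_mul, mul_one]

theorem vermaWeight_iSupIndep (lam : Fin n → ℂ) : iSupIndep (vermaWeight lam) := by
  have hcomm : ∀ i j : Fin n, Commute (eVerma lam i i) (eVerma lam j j) := by
    intro i j
    have h : Commute (eU i i : Ugl n) (eU j j) := by
      have h1 : ⁅(Matrix.single i i (1 : ℂ) : gl n), (Matrix.single j j (1 : ℂ) : gl n)⁆ = 0 := by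
        rw [LieRing.of_associative_ring_bracket]
        by_cases hij : i = j
        · subst hij; simp
        · rw [Matrix.single_mul_single_of_ne _ _ _ _ hij,
            Matrix.single_mul_single_of_ne _ _ _ _ (Ne.symm hij), sub_self]
      have h2 := LieHom.map_lie (UniversalEnvelopingAlgebra.ι ℂ (L := gl n))
        (Matrix.single i i (1 : ℂ)) (Matrix.single j j (1 : ℂ))
      rw [h1, map_zero, LieRing.of_associative_ring_bracket] at h2
      exact (sub_eq_zero.mp h2.symm)
    exact h.map (Algebra.lsmul ℂ ℂ (Verma lam))
  have h := Module.End.independent_iInf_maxGenEigenspace_of_forall_mapsTo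
    (fun i => eVerma lam i i) (fun i j φ =>
      Module.End.mapsTo_maxGenEigenspace_of_comm (hcomm j i) φ)
  refine h.mono fun mu => iInf_mono fun i x hx => ?_
  rw [Module.End.mem_maxGenEigenspace]
  exact ⟨1, by simpa [sub_eq_zero, Module.algebraMap_end_apply] using hx⟩

end Auxiliary

theorem exists_vermaCoeff {n : ℕ} (lam : Fin n → ℂ) :
    ∃ f : Verma lam →ₗ[ℂ] ℂ, f (vermaTop lam) = 1 ∧
      ∀ mu, mu ≠ lam → ∀ x ∈ vermaWeight lam mu, f x = 0 := by
  have hnot : vermaTop lam ∉ ⨆ (mu) (_ : mu ≠ lam), vermaWeight lam mu := fun h =>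
    vermaTop_ne_zero lam
      ((Submodule.disjoint_def.mp (vermaWeight_iSupIndep lam lam)) _ (vermaTop_mem lam) h)
  obtain ⟨f, hf, hle⟩ := Submodule.exists_le_ker_of_notMem hnot
  refine ⟨(f (vermaTop lam))⁻¹ • f, by simp [hf], fun mu hmu x hx => ?_⟩
  have : x ∈ LinearMap.ker f := hle (Submodule.mem_iSup_of_mem mu (Submodule.mem_iSup_of_mem hmu hx))
  simp [LinearMap.mem_ker.mp this]

/-- The coefficient of `v_λ`: the linear functional on `M_λ` that is `1` on `v_λ` and vanishes on
all weight vectors of weights distinct from `λ`. (It is unique, since `M_λ` is spanned by `v_λ`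
and these weight vectors.) -/
def vermaCoeff {n : ℕ} (lam : Fin n → ℂ) : Verma lam →ₗ[ℂ] ℂ :=
  (exists_vermaCoeff lam).choose

/-- `(S ℂⁿ)^{⊗ m}`, realised as the polynomials in the variables `x_{ik}`, `1 ≤ i ≤ n`,
`1 ≤ k ≤ m`: the monomial `∏ x_{ik}^{d_{ik}}` is
`∏ᵢ eᵢ^{d_{i1}} ⊗ ⋯ ⊗ ∏ᵢ eᵢ^{d_{im}}`. -/
abbrev SymTensor (n m : ℕ) : Type := MvPolynomial (Fin n × Fin m) ℂ

/-- The action of `eᵢⱼ` on the `k`-th tensor factor of `(S ℂⁿ)^{⊗ m}`: `x_{ik} ∂/∂x_{jk}`. -/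
def eSym {n m : ℕ} (i j : Fin n) (k : Fin m) : Module.End ℂ (SymTensor n m) :=
  LinearMap.mulLeft ℂ (MvPolynomial.X (i, k)) ∘ₗ (MvPolynomial.pderiv (j, k)).toLinearMap

/-- `S^{(n)}(b) = S^{b₁} ℂⁿ ⊗ ⋯ ⊗ S^{bₘ} ℂⁿ`: degree `b_k` in the `k`-th column of variables. -/
def symPower (n : ℕ) {m : ℕ} (b : Fin m → ℕ) : Submodule ℂ (SymTensor n m) :=
  MvPolynomial.weightedHomogeneousSubmodule ℂ
    (fun p : Fin n × Fin m => (Pi.single p.2 1 : Fin m → ℕ)) b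

/-- The bidegree of `x_{ik}`: its `𝔤𝔩ₙ`-weight and its multidegree in the tensor factors. -/
def bidegree (n m : ℕ) (p : Fin n × Fin m) : (Fin n → ℕ) × (Fin m → ℕ) :=
  (Pi.single p.1 1, Pi.single p.2 1)

/-- The weight subspace `S^{(n)}(b)[a]`. -/
def symWeight {n m : ℕ} (b : Fin m → ℕ) (a : Fin n → ℕ) : Submodule ℂ (SymTensor n m) :=
  MvPolynomial.weightedHomogeneousSubmodule ℂ (bidegree n m) (a, b)

/-- The projection of `(S ℂⁿ)^{⊗ m}` onto `S^{(n)}(b)[a]`. -/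
def symProj {n m : ℕ} (b : Fin m → ℕ) (a : Fin n → ℕ) : SymTensor n m →ₗ[ℂ] symWeight b a :=
  (MvPolynomial.weightedHomogeneousComponent (bidegree n m) (a, b)).codRestrict _
    fun p => MvPolynomial.weightedHomogeneousComponent_mem _ p _

/-- `(S ℂⁿ)^{⊗ m} ⊗ M_λ`. -/
abbrev SymVerma (m : ℕ) {n : ℕ} (lam : Fin n → ℂ) : Type := SymTensor n m ⊗[ℂ] Verma lam

/-- `eᵢⱼ` acting on the `k`-th symmetric power in `(S ℂⁿ)^{⊗ m} ⊗ M_λ`. -/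
def eFactor {n m : ℕ} (lam : Fin n → ℂ) (i j : Fin n) (k : Fin m) :
    Module.End ℂ (SymVerma m lam) :=
  LinearMap.rTensor (Verma lam) (eSym i j k)

/-- `eᵢⱼ` acting on the Verma factor in `(S ℂⁿ)^{⊗ m} ⊗ M_λ`. -/
def eLast (m : ℕ) {n : ℕ} (lam : Fin n → ℂ) (i j : Fin n) : Module.End ℂ (SymVerma m lam) :=
  LinearMap.lTensor (SymTensor n m) (eVerma lam i j)

/-- The diagonal action of `eᵢⱼ` on `(S ℂⁿ)^{⊗ m} ⊗ M_λ`. -/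
def eTotal (m : ℕ) {n : ℕ} (lam : Fin n → ℂ) (i j : Fin n) : Module.End ℂ (SymVerma m lam) :=
  (∑ k, eFactor lam i j k) + eLast m lam i j

/-- `(S^{(n)}(b) ⊗ M_λ)^{sing}[λ + a]`: the singular vectors of weight `λ + a`. -/
def singSpace {n m : ℕ} (b : Fin m → ℕ) (a : Fin n → ℕ) (lam : Fin n → ℂ) :
    Submodule ℂ (SymVerma m lam) :=
  LinearMap.range (LinearMap.rTensor (Verma lam) (symPower n b).subtype) ⊓
    (⨅ (i : Fin n) (j : Fin n) (_ : i < j), LinearMap.ker (eTotal m lam i j)) ⊓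
    ⨅ i : Fin n, LinearMap.ker
      (eTotal m lam i i - algebraMap ℂ (Module.End ℂ (SymVerma m lam)) (lam i + a i))

/-- The map `(S ℂⁿ)^{⊗ m} ⊗ M_λ → S^{(n)}(b)[a]` taking the coefficient of `v_λ`. -/
def thetaFull {n m : ℕ} (b : Fin m → ℕ) (a : Fin n → ℕ) (lam : Fin n → ℂ) :
    SymVerma m lam →ₗ[ℂ] symWeight b a :=
  symProj b a ∘ₗ (TensorProduct.rid ℂ (SymTensor n m)).toLinearMap ∘ₗ
    LinearMap.lTensor (SymTensor n m) (vermaCoeff lam)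

/-- The map `θ : (S^{(n)}(b) ⊗ M_λ)^{sing}[λ + a] → S^{(n)}(b)[a]`,
`v = θ(v) ⊗ v_λ + ∑ wᵢ ⊗ vᵢ` with weight vectors `vᵢ` of weights distinct from `λ`. (On this space
the coefficient of `v_λ` has weight `a`, so the projection onto `S^{(n)}(b)[a]` changes nothing.) -/
def theta {n m : ℕ} (b : Fin m → ℕ) (a : Fin n → ℕ) (lam : Fin n → ℂ) :
    singSpace b a lam →ₗ[ℂ] symWeight b a :=
  thetaFull b a lam ∘ₗ (singSpace b a lam).subtype

/-- `X ↦ θ ∘ X ∘ θ⁻¹`, for the operators `X` on `(S ℂⁿ)^{⊗ m} ⊗ M_λ`. -/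
def thetaConj {n m : ℕ} {b : Fin m → ℕ} {a : Fin n → ℕ} {lam : Fin n → ℂ}
    (h : Function.Bijective (theta b a lam)) :
    Module.End ℂ (SymVerma m lam) →ₗ[ℂ] Module.End ℂ (symWeight b a) :=
  LinearMap.lcomp ℂ _
      ((singSpace b a lam).subtype ∘ₗ (LinearEquiv.ofBijective _ h).symm.toLinearMap) ∘ₗ
    LinearMap.llcomp ℂ (SymVerma m lam) (SymVerma m lam) (symWeight b a) (thetaFull b a lam)

/-! ### Rational functions in `m` variables, the filtration and its leading terms -/

/-- The field of rational functions in `m` variables over `ℂ`; it serves as `ℂ(λ^{(m)})`, with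
variables `λ_{n+1}, …, λ_{n+m}`, and as `ℂ(ξ)`, with variables `ξ₁, …, ξₘ`. -/
def RatFun (m : ℕ) : Type := FractionRing (MvPolynomial (Fin m) ℂ)

instance (m : ℕ) : Field (RatFun m) :=
  inferInstanceAs (Field (FractionRing (MvPolynomial (Fin m) ℂ)))

instance (m : ℕ) : Algebra (MvPolynomial (Fin m) ℂ) (RatFun m) :=
  inferInstanceAs (Algebra (MvPolynomial (Fin m) ℂ) (FractionRing (MvPolynomial (Fin m) ℂ)))

instance (m : ℕ) : IsFractionRing (MvPolynomial (Fin m) ℂ) (RatFun m) :=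
  inferInstanceAs (IsFractionRing (MvPolynomial (Fin m) ℂ)
    (FractionRing (MvPolynomial (Fin m) ℂ)))

instance (m : ℕ) : Algebra ℂ (RatFun m) :=
  ((algebraMap (MvPolynomial (Fin m) ℂ) (RatFun m)).comp MvPolynomial.C).toAlgebra

instance (m : ℕ) : IsScalarTower ℂ (MvPolynomial (Fin m) ℂ) (RatFun m) :=
  IsScalarTower.of_algebraMap_eq fun _ => rfl

/-- The `k`-th variable. -/
def ratVar {m : ℕ} (k : Fin m) : RatFun m :=
  algebraMap (MvPolynomial (Fin m) ℂ) (RatFun m) (MvPolynomial.X k)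

/-- The substitution `λ_{n+k} ↦ r ξ_k` on polynomials, with values in `ℂ(ξ)((r⁻¹))`: the
coefficient with index `N` is the coefficient of `r⁻ᴺ`. -/
def scalePoly (m : ℕ) : MvPolynomial (Fin m) ℂ →+* LaurentSeries (RatFun m) :=
  MvPolynomial.eval₂Hom (HahnSeries.C.comp (algebraMap ℂ (RatFun m)))
    fun k => HahnSeries.single (-1) (ratVar k)

theorem scalePoly_coeff {m : ℕ} (p : MvPolynomial (Fin m) ℂ) (q : ℕ) :
    (scalePoly m p).coeff (-(q : ℤ)) =
      algebraMap (MvPolynomial (Fin m) ℂ) (RatFun m) (MvPolynomial.homogeneousComponent q p) := by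
  induction p using MvPolynomial.induction_on' with
  | add p₁ p₂ h₁ h₂ => rw [map_add, HahnSeries.coeff_add, h₁, h₂, map_add, map_add]
  | monomial d c =>
    have hprod : (d.prod fun k e => (HahnSeries.single (-1 : ℤ) (ratVar k)) ^ e) =
        HahnSeries.single (-(d.degree : ℤ)) (d.prod fun k e => (ratVar (m := m) k) ^ e) := by
      induction d using Finsupp.induction_linear with
      | zero => simp
      | add d₁ d₂ h₁ h₂ =>
        rw [Finsupp.prod_add_index' (by simp) (by intros; rw [pow_add]), h₁, h₂,
          Finsupp.prod_add_index' (by simp) (by intros; rw [pow_add]), HahnSeries.single_mul_single]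
        congr 1
        simp
        ring_nf
      | single k e => simp [Finsupp.degree_single]
    rw [scalePoly, MvPolynomial.coe_eval₂Hom, MvPolynomial.eval₂_monomial, hprod,
      RingHom.comp_apply, HahnSeries.C_apply, HahnSeries.single_mul_single, zero_add,
      HahnSeries.coeff_single, MvPolynomial.homogeneousComponent_of_mem
        (MvPolynomial.isHomogeneous_monomial c rfl)]
    by_cases h : q = d.degree
    · subst h
      rw [if_pos rfl, if_pos rfl, MvPolynomial.monomial_eq, map_mul]
      congr 1
      rw [map_finsuppProd]
      simp [ratVar]
    · rw [if_neg (by omega), if_neg h, map_zero]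

theorem scalePoly_injective (m : ℕ) : Function.Injective (scalePoly m) := by
  rw [injective_iff_map_eq_zero]
  intro p hp
  rw [← MvPolynomial.sum_homogeneousComponent p]
  refine Finset.sum_eq_zero fun q _ => ?_
  apply IsFractionRing.injective (MvPolynomial (Fin m) ℂ) (RatFun m)
  rw [← scalePoly_coeff, hp, HahnSeries.coeff_zero, map_zero]

/-- The homomorphism `π : ℂ(λ^{(m)}) → ℂ(ξ)((r⁻¹))`, `λ_{n+k} ↦ r ξ_k`. -/
def scaleHom (m : ℕ) : RatFun m →+* LaurentSeries (RatFun m) :=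
  IsFractionRing.lift (scalePoly_injective m)

theorem scaleHom_const (m : ℕ) (c : ℂ) :
    scaleHom m (algebraMap ℂ (RatFun m) c) = HahnSeries.C (algebraMap ℂ (RatFun m) c) := by
  rw [IsScalarTower.algebraMap_apply ℂ (MvPolynomial (Fin m) ℂ) (RatFun m), scaleHom,
    IsFractionRing.lift_algebraMap, scalePoly, MvPolynomial.algebraMap_eq]
  simp only [MvPolynomial.coe_eval₂Hom, MvPolynomial.eval₂_C, RingHom.comp_apply]
  rfl

/-- `deg p ≤ q`: no power of `r` above `r^q` occurs in `π(p)`. -/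
def DegLE {m : ℕ} (p : RatFun m) (q : ℤ) : Prop := ∀ N < -q, (scaleHom m p).coeff N = 0

/-- The coefficient of `r^q` in `π(p)`. -/
def scaleCoeff (m : ℕ) (q : ℤ) : RatFun m →ₗ[ℂ] RatFun m where
  toFun p := (scaleHom m p).coeff (-q)
  map_add' p p' := by rw [map_add, HahnSeries.coeff_add]
  map_smul' c p := by
    rw [Algebra.smul_def, map_mul, scaleHom_const, HahnSeries.C_mul_eq_smul,
      HahnSeries.coeff_smul, smul_eq_mul, RingHom.id_apply, Algebra.smul_def]

section Filtration

variable {m : ℕ} {W : Type*} [AddCommGroup W] [Module ℂ W]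

/-- The filtration component `F_q = span {p ⊗ v | deg p ≤ q}`. -/
def filtration (q : ℤ) : Submodule ℂ (RatFun m ⊗[ℂ] W) :=
  Submodule.span ℂ {x | ∃ (p : RatFun m) (v : W), DegLE p q ∧ x = p ⊗ₜ[ℂ] v}

/-- The map `gr_q`, sending `∑ pᵢ ⊗ vᵢ ∈ F_q` to its leading part
`∑ (coefficient of r^q in π(pᵢ)) ⊗ vᵢ`. -/
def grade (q : ℤ) : RatFun m ⊗[ℂ] W →ₗ[ℂ] RatFun m ⊗[ℂ] W :=
  LinearMap.rTensor W (scaleCoeff m q)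

end Filtration

/-! ### The two Bethe operators -/

section Bethe

variable {m : ℕ} {W : Type*} [AddCommGroup W] [Module ℂ W]

/-- Operators on `W` with coefficients in rational functions. -/
abbrev RatEnd (m : ℕ) (W : Type*) [AddCommGroup W] [Module ℂ W] : Type _ :=
  RatFun m ⊗[ℂ] Module.End ℂ W

/-- A scalar series regarded as a series of operators. -/
def scalarSeries (W : Type*) [AddCommGroup W] [Module ℂ W] (f : USeries (RatFun m)) :
    USeries (RatEnd m W) :=
  HahnSeries.map f (Algebra.TensorProduct.includeLeftRingHom : RatFun m →+* RatEnd m W)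

/-- `X / (u - c) = ∑_{r ≥ 0} cʳ X u⁻ʳ⁻¹`. -/
def poleSeries (X : Module.End ℂ W) (c : RatFun m) : USeries (RatEnd m W) :=
  HahnSeries.single 1 1 *
    HahnSeries.ofPowerSeries ℤ (RatEnd m W) (PowerSeries.mk fun r => (c ^ r) ⊗ₜ[ℂ] X)

/-- The evaluation parameters `w_k = λ_{n+k} + b_k - k`, `k = 1, …, m`. -/
def wParam {m : ℕ} (b : Fin m → ℕ) (k : Fin m) : RatFun m :=
  ratVar k + (b k : RatFun m) - ((k : ℕ) + 1 : RatFun m)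

/-- The matrix `T(u) = (tᵢⱼ(u))` acting on the tensor product of evaluation `Y(𝔤𝔩ₙ)`-modules
`S^{b₁} ℂⁿ(w₁) ⊗ ⋯ ⊗ S^{bₘ} ℂⁿ(wₘ) ⊗ M_λ(0)`: by the coproduct `tᵢⱼ(u) ↦ ∑ₐ tᵢₐ(u) ⊗ tₐⱼ(u)` it
is the ordered product of the matrices `δᵢⱼ + eᵢⱼ^{(k)} / (u - w_k)`, `k = 1, …, m`, and
`δᵢⱼ + eᵢⱼ^{(m+1)} / u`. -/
def monodromy {n m : ℕ} (b : Fin m → ℕ) (lam : Fin n → ℂ) :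
    Matrix (Fin n) (Fin n) (USeries (RatEnd m (SymVerma m lam))) :=
  (List.ofFn fun k : Fin m =>
    1 + Matrix.of fun i j => poleSeries (eFactor lam i j k) (wParam b k)).prod *
  (1 + Matrix.of fun i j => poleSeries (eLast m lam i j) 0)

/-- The image of the difference operator
`Dₙ = ∑_σ sgn(σ) D_{σ(1),1} ⋯ D_{σ(n),n}`, `Dᵢⱼ = δᵢⱼ τ - tᵢⱼ(u - j + 1)`, in the difference
operators on `(S ℂⁿ)^{⊗ m} ⊗ M_λ`. -/
def betheDifference {n m : ℕ} (b : Fin m → ℕ) (lam : Fin n → ℂ) :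
    OpCoeffs (RatEnd m (SymVerma m lam)) :=
  ofLeftMul (columnDet (Matrix.of fun i j =>
    (if i = j then tauOp (B := RatEnd m (SymVerma m lam)) else 0) -
      mulSeries (shiftSeries (-(j : ℤ)) (monodromy b lam i j))))

/-- The image of the differential operator
`∑_σ sgn(σ) 𝔇_{σ(1),1} ⋯ 𝔇_{σ(n),n}`, `𝔇ᵢⱼ = δᵢⱼ ∂ᵤ - eᵢⱼ(u)`, in the differential operators on
the tensor product of evaluation `U(𝔤𝔩ₙ[t])`-modules
`S^{b₁} ℂⁿ(ξ₁) ⊗ ⋯ ⊗ S^{bₘ} ℂⁿ(ξₘ) ⊗ M_λ(0)`, on which `eᵢⱼ(u)` acts as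
`∑ₖ eᵢⱼ^{(k)} / (u - ξₖ) + eᵢⱼ^{(m+1)} / u`. -/
def gaudinDifferential (m : ℕ) {n : ℕ} (lam : Fin n → ℂ) :
    OpCoeffs (RatEnd m (SymVerma m lam)) :=
  ofLeftMul (columnDet (Matrix.of fun i j =>
    (if i = j then partialOp (B := RatEnd m (SymVerma m lam)) else 0) -
      mulSeries ((∑ k : Fin m, poleSeries (eFactor lam i j k) (ratVar k)) +
        poleSeries (eLast m lam i j) 0)))

variable {n : ℕ} {b : Fin m → ℕ} {a : Fin n → ℕ} {lam : Fin n → ℂ}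

/-- `X ↦ θ ∘ X ∘ θ⁻¹` applied to every coefficient of a difference or differential operator. -/
def thetaOp (h : Function.Bijective (theta b a lam)) (P : OpCoeffs (RatEnd m (SymVerma m lam))) :
    OpCoeffs (RatEnd m (symWeight b a)) :=
  P.mapRange (fun f => f.map (LinearMap.lTensor (RatFun m) (thetaConj h)))
    (by ext; simp)

/-- The difference operator `Dₙ(b, w; a, λ^{(n)})` on `S^{(n)}(b)[a]`, over `ℂ(λ^{(m)})`. -/
def betheOp (h : Function.Bijective (theta b a lam)) : OpCoeffs (RatEnd m (symWeight b a)) :=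
  thetaOp h (betheDifference b lam)

/-- The generating differential operator `𝔇ₙ^{tG}(b, ξ; a, λ^{(n)})` of the trigonometric Gaudin
model on `S^{(n)}(b)[a]`, over `ℂ(ξ)`. -/
def gaudinOp (h : Function.Bijective (theta b a lam)) : OpCoeffs (RatEnd m (symWeight b a)) :=
  thetaOp h (gaudinDifferential m lam)

/-- The Bethe algebra: the `ℂ(λ^{(m)})`-subalgebra of `End(S^{(n)}(b)[a]) ⊗ ℂ(λ^{(m)})` generated
by the coefficients of `Dₙ(b, w; a, λ^{(n)})`. -/
def betheAlgebra (h : Function.Bijective (theta b a lam)) :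
    Subalgebra (RatFun m) (RatEnd m (symWeight b a)) :=
  Algebra.adjoin (RatFun m) {x | ∃ (k : ℕ) (N : ℤ), x = (betheOp h k).coeff N}

/-- The relation
`u(u-1)⋯(u-n+1) ∏ₖ (u - w_k) Dₙ = ∑ᵢⱼ Cᵢⱼ (u + m)ⁱ (u-n+1)(u-n+2)⋯(u-n+j) dʲ`. -/
def IsBetheExpansion (h : Function.Bijective (theta b a lam))
    (C : Fin (m + 1) → Fin (n + 1) → RatEnd m (symWeight b a)) : Prop :=
  mulSeries (scalarSeries _ ((∏ t ∈ Finset.range n, (uVar - (t : USeries (RatFun m)))) *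
      ∏ k, (uVar - HahnSeries.C (wParam b k)))) (betheOp h) =
    ∑ i : Fin (m + 1), ∑ j : Fin (n + 1), mulSeries (HahnSeries.C (C i j) *
      scalarSeries _ ((uVar + (m : USeries (RatFun m))) ^ (i : ℕ) *
        ∏ t ∈ Finset.range (j : ℕ), (uVar - (n : USeries (RatFun m)) + 1 + (t : USeries (RatFun m)))))
      (ofLeftMul (dOp ^ (j : ℕ)))

end Bethe

end

end BetheGaudin

namespace BetheGaudin

noncomputable section

/-! ### Series in `u⁻¹`: products, coefficientwise maps and shifts -/

section SeriesLemmas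

variable {B B' : Type*} [Ring B] [Ring B']

/-! Everything rests on two facts about the difference operator: what its part of highest degree is,
and where its coefficients have poles.

Leading part. Let `u` and the `λ_{n+k}` have degree 1 and `d` degree -1. A shift of `u` changes a
series only in lower degree, and `f(u+1) - f(u)` has leading part `f'` (`SymRel.shift_sub`); so left
multiplication by `d` has leading part left multiplication by `∂` (`OpRel.dOp`). The matrix `T(u) -
1` has degree -1, and its leading part is the sum of the pole terms of the factors, since cross
terms have degree at most -2 (`symRel_monodromy`). As `δτ - t = δd - (t - δ)`, each entry of the
column determinant lowers the degree by one with leading part the corresponding Gaudin entry. Hence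
the difference operator has degree at most `-n` with leading part the Gaudin operator
(`opRel_bethe`). Conjugation by `θ` acts linearly on the operator factor of each coefficient and
preserves this.

Poles. The shifts in the columns suggest poles at `w_k, w_k + 1, …, w_k + n - 1`. Only a simple pole
at each `w_k` survives, and the coefficient of `τ^k` has besides these at most simple poles at `0,
…, n - k - 1` (`bethe_poles`). The reason is that `e_ij` acts on a symmetric power as `x_i ∂_j`.
Write the column determinant as a product of Grassmann combinations of its columns, acting on an
exterior algebra, and put `X = ∑ ψ_i x_i`, `Δ = ∑ ∂_j ι_j` for each factor. The operator `𝓛(u) = ∏_k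
(1 + X_k Δ_k / (u - w_k))` satisfies: column of `T(u - t)` times `𝓛(u - t - 1)` equals `𝓛(u - t)`
times the column of the Verma factor alone (`grassmann_intertwine`, `EvalData.col_mon`), while `τ`
carries `𝓛(u - t - 1)` to `𝓛(u - t)`. Since `Δ` kills the vacuum, `𝓛(u - n)` may be inserted at the
right end at no cost. Moved through all the columns, it leaves a single `𝓛(u)` on the left.

Conclusion (`expansion_and_leading`). Comparing coefficients of `d^j` turns the required identity
into `h_j = ∑_i C_ij (u + m)^i` for each `j`, where `h_j` is the coefficient on the left divided by
`(u-n+1)⋯(u-n+j)`. The pole statement makes `h_j` a polynomial in `u`, and the degree count gives it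
degree at most `m`, both in `u` and in total. So the `C_ij` exist, are forced, have degree at most
`m - i`, and their leading parts are the coefficients of the leading part of `h_j`, since replacing
`u + m` by `u` changes only lower degrees. -/

/-- The coefficients of `u⁻ᵏ` with `k < L` vanish. -/
def OrdGE (f : USeries B) (L : ℤ) : Prop := ∀ k < L, f.coeff k = 0

theorem ordGE_order (f : USeries B) : OrdGE f f.order :=
  fun _ hk => HahnSeries.coeff_eq_zero_of_lt_order hk

theorem OrdGE.mono {f : USeries B} {L L' : ℤ} (h : OrdGE f L) (hL : L' ≤ L) : OrdGE f L' :=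
  fun k hk => h k (hk.trans_le hL)

theorem OrdGE.add {f g : USeries B} {L : ℤ} (hf : OrdGE f L) (hg : OrdGE g L) :
    OrdGE (f + g) L := fun k hk => by rw [HahnSeries.coeff_add, hf k hk, hg k hk, add_zero]

theorem OrdGE.sub {f g : USeries B} {L : ℤ} (hf : OrdGE f L) (hg : OrdGE g L) :
    OrdGE (f - g) L := fun k hk => by rw [HahnSeries.coeff_sub, hf k hk, hg k hk, sub_zero]

/-- The index set depends only on lower bounds for the orders, not on the supports, so it stays the
same when both series are mapped coefficientwise, even if coefficients die. -/
theorem coeff_mul_Icc {f g : USeries B} {L L' : ℤ} (hf : OrdGE f L) (hg : OrdGE g L') (N : ℤ) :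
    (f * g).coeff N = ∑ k ∈ Finset.Icc L (N - L'), f.coeff k * g.coeff (N - k) := by
  rw [HahnSeries.coeff_mul]
  refine Finset.sum_of_injOn Prod.fst ?_ ?_ ?_ ?_
  · rintro ⟨a, b⟩ h ⟨c, d⟩ h' rfl
    simp only [Finset.mem_coe, Finset.mem_antidiagonal] at h h'
    have := h.2.2.trans h'.2.2.symm
    simpa using this
  · rintro ⟨a, b⟩ h
    simp only [Finset.mem_coe, Finset.mem_antidiagonal, HahnSeries.mem_support] at h
    have h1 : L ≤ a := not_lt.mp fun h' => h.1 (hf a h')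
    have h2 : L' ≤ b := not_lt.mp fun h' => h.2.1 (hg b h')
    simp only [Finset.coe_Icc, Set.mem_Icc]
    exact ⟨h1, by have := h.2.2; omega⟩
  · intro k _ hk
    by_contra h
    apply hk
    refine ⟨(k, N - k), ?_, rfl⟩
    simp only [Finset.mem_coe, Finset.mem_antidiagonal, HahnSeries.mem_support]
    exact ⟨left_ne_zero_of_mul h, right_ne_zero_of_mul h, by omega⟩
  · rintro ⟨a, b⟩ h
    simp only [Finset.mem_antidiagonal] at h
    rw [show b = N - a by have := h.2.2; omega]

theorem OrdGE.mul {f g : USeries B} {L L' : ℤ} (hf : OrdGE f L) (hg : OrdGE g L') :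
    OrdGE (f * g) (L + L') := fun N hN => by
  rw [coeff_mul_Icc hf hg, Finset.Icc_eq_empty (by omega), Finset.sum_empty]

/-- Series all of whose coefficients lie in a given subring. -/
def coeffSubring (S : Subring B) : Subring (USeries B) where
  carrier := {f | ∀ N, f.coeff N ∈ S}
  mul_mem' := fun {f g} hf hg N => by
    rw [coeff_mul_Icc (ordGE_order f) (ordGE_order g)]
    exact S.sum_mem fun k _ => S.mul_mem (hf _) (hg _)
  one_mem' N := by
    rw [HahnSeries.coeff_one]
    split_ifs
    exacts [S.one_mem, S.zero_mem]
  add_mem' := fun hf hg N => by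
    rw [HahnSeries.coeff_add]; exact S.add_mem (hf N) (hg N)
  zero_mem' N := by rw [HahnSeries.coeff_zero]; exact S.zero_mem
  neg_mem' := fun hf N => by rw [HahnSeries.coeff_neg]; exact S.neg_mem (hf N)

/-- The polynomials in `u`. -/
def polySubring (B : Type*) [Ring B] : Subring (USeries B) where
  carrier := {f | ∀ N > 0, f.coeff N = 0}
  mul_mem' := fun {f g} hf hg N hN => by
    rw [coeff_mul_Icc (ordGE_order f) (ordGE_order g)]
    refine Finset.sum_eq_zero fun k _ => ?_
    rcases lt_or_ge 0 k with h | h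
    · rw [hf k h, zero_mul]
    · rw [hg (N - k) (by omega), mul_zero]
  one_mem' N hN := by rw [HahnSeries.coeff_one, if_neg hN.ne']
  add_mem' := fun hf hg N hN => by rw [HahnSeries.coeff_add, hf N hN, hg N hN, add_zero]
  zero_mem' N _ := HahnSeries.coeff_zero
  neg_mem' := fun hf N hN => by rw [HahnSeries.coeff_neg, hf N hN, neg_zero]

theorem C_mem_poly (x : B) : HahnSeries.C x ∈ polySubring B := fun N hN => by
  rw [HahnSeries.C_apply, HahnSeries.coeff_single_of_ne hN.ne']

theorem uVar_mem_poly : uVar ∈ polySubring B := fun N hN => by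
  rw [uVar, HahnSeries.coeff_single_of_ne (by omega)]

/-- Coefficientwise application of an additive map. -/
def mapSeries (φ : B →+ B') : USeries B →+ USeries B' where
  toFun f := f.map φ
  map_zero' := by ext; simp
  map_add' f g := by ext; simp

@[simp] theorem mapSeries_coeff (φ : B →+ B') (f : USeries B) (N : ℤ) :
    (mapSeries φ f).coeff N = φ (f.coeff N) := rfl

theorem OrdGE.mapSeries {f : USeries B} {L : ℤ} (hf : OrdGE f L) (φ : B →+ B') :
    OrdGE (mapSeries φ f) L := fun k hk => by rw [mapSeries_coeff, hf k hk, map_zero]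

/-- If `φ (x * y) = ρ x * φ y`, then the same holds for series. -/
theorem mapSeries_mul_of {B'' : Type*} [Ring B''] {φ : B →+ B'} {ρ : B'' →+ B} {ρ' : B'' →+ B'}
    (h : ∀ x y, φ (ρ x * y) = ρ' x * φ y) (f : USeries B'') (g : USeries B) :
    mapSeries φ (mapSeries ρ f * g) = mapSeries ρ' f * mapSeries φ g := by
  ext N
  rw [mapSeries_coeff, coeff_mul_Icc ((ordGE_order f).mapSeries ρ) (ordGE_order g),
    coeff_mul_Icc ((ordGE_order f).mapSeries ρ') ((ordGE_order g).mapSeries φ), map_sum]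
  exact Finset.sum_congr rfl fun k _ => by simp [h]

/-- Coefficientwise application of a ring homomorphism. -/
def mapSeriesHom (φ : B →+* B') : USeries B →+* USeries B' :=
  { mapSeries (φ : B →+ B') with
    map_one' := by
      ext N
      change φ (HahnSeries.coeff 1 N) = _
      rw [HahnSeries.coeff_one, HahnSeries.coeff_one]
      split_ifs
      exacts [map_one φ, map_zero φ]
    map_mul' := fun f g => by
      ext N
      change φ ((f * g).coeff N) = (mapSeries (φ : B →+ B') f * mapSeries (φ : B →+ B') g).coeff N
      rw [coeff_mul_Icc (ordGE_order f) (ordGE_order g),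
        coeff_mul_Icc ((ordGE_order f).mapSeries _) ((ordGE_order g).mapSeries _), map_sum]
      exact Finset.sum_congr rfl fun k _ => by simp }

@[simp] theorem mapSeriesHom_coeff (φ : B →+* B') (f : USeries B) (N : ℤ) :
    (mapSeriesHom φ f).coeff N = φ (f.coeff N) := rfl

@[simp] theorem mapSeriesHom_C (φ : B →+* B') (x : B) :
    mapSeriesHom φ (HahnSeries.C x) = HahnSeries.C (φ x) := by
  ext N
  rw [mapSeriesHom_coeff, HahnSeries.C_apply, HahnSeries.C_apply, HahnSeries.coeff_single,
    HahnSeries.coeff_single]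
  split_ifs
  exacts [rfl, map_zero φ]

@[simp] theorem mapSeriesHom_uVar (φ : B →+* B') : mapSeriesHom φ uVar = uVar := by
  ext N
  rw [mapSeriesHom_coeff, uVar, uVar, HahnSeries.coeff_single, HahnSeries.coeff_single]
  split_ifs
  exacts [map_one φ, map_zero φ]

theorem mapSeriesHom_mem_poly (φ : B →+* B') {f : USeries B} (hf : f ∈ polySubring B) :
    mapSeriesHom φ f ∈ polySubring B' := fun N hN => by
  rw [mapSeriesHom_coeff, hf N hN, map_zero]

/-! ### The substitution `u ↦ u + c` -/

theorem shiftSeries_coeff (c : ℤ) {f : USeries B} {L : ℤ} (hf : OrdGE f L) (N : ℤ) :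
    (shiftSeries c f).coeff N = ∑ k ∈ Finset.Icc L N,
      (Ring.choose (-k) (N - k).toNat * c ^ (N - k).toNat) • f.coeff k :=
  shiftCoeff_eq c f N L hf

theorem OrdGE.shift {f : USeries B} {L : ℤ} (hf : OrdGE f L) (c : ℤ) :
    OrdGE (shiftSeries c f) L := fun N hN => by
  rw [shiftSeries_coeff c hf, Finset.Icc_eq_empty (not_le.mpr hN), Finset.sum_empty]

theorem ordGE_single (k : ℤ) (x : B) : OrdGE (HahnSeries.single k x) k := fun N hN => by
  rw [HahnSeries.coeff_single_of_ne hN.ne]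

theorem shiftSeries_single_coeff (c k : ℤ) (x : B) (N : ℤ) :
    (shiftSeries c (HahnSeries.single k x)).coeff N =
      if k ≤ N then (Ring.choose (-k) (N - k).toNat * c ^ (N - k).toNat) • x else 0 := by
  rw [shiftSeries_coeff c (ordGE_single k x)]
  split_ifs with h
  · rw [Finset.sum_eq_single k]
    · rw [HahnSeries.coeff_single_same]
    · intro b _ hb
      rw [HahnSeries.coeff_single_of_ne hb, smul_zero]
    · intro h'
      exact absurd (Finset.mem_Icc.mpr ⟨le_rfl, h⟩) h'
  · rw [Finset.Icc_eq_empty h, Finset.sum_empty]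

theorem exists_truncate (f : USeries B) (M : ℤ) :
    ∃ g : USeries B, OrdGE g M ∧
      f = (∑ k ∈ Finset.Ico f.order M, HahnSeries.single k (f.coeff k)) + g := by
  refine ⟨f - ∑ k ∈ Finset.Ico f.order M, HahnSeries.single k (f.coeff k), fun N hN => ?_, by abel⟩
  rw [HahnSeries.coeff_sub, HahnSeries.coeff_sum]
  by_cases h : f.order ≤ N
  · rw [Finset.sum_eq_single N, HahnSeries.coeff_single_same, sub_self]
    · intro b _ hb
      rw [HahnSeries.coeff_single_of_ne hb.symm]
    · intro h'
      exact absurd (Finset.mem_Ico.mpr ⟨h, hN⟩) h'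
  · rw [ordGE_order f N (not_le.mp h), Finset.sum_eq_zero, sub_zero]
    intro k hk
    rw [HahnSeries.coeff_single_of_ne]
    have := (Finset.mem_Ico.mp hk).1
    omega

/-- A biadditive map that is continuous in the `u⁻¹`-adic sense vanishes if it vanishes on
monomials. -/
theorem biadditive_eq_zero {Φ : USeries B →+ USeries B →+ USeries B'}
    (hΦ : ∀ f g L L', OrdGE f L → OrdGE g L' → OrdGE (Φ f g) (L + L'))
    (hs : ∀ k x l y, Φ (HahnSeries.single k x) (HahnSeries.single l y) = 0) (f g : USeries B) :
    Φ f g = 0 := by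
  ext N
  -- The cuts make every product with a tail start beyond `u⁻ᴺ`; the maximum with `g.order` ensures
  -- this for the product of the two tails as well.
  obtain ⟨g', hg', hg⟩ := exists_truncate g (max g.order (N + 1 - f.order))
  obtain ⟨f', hf', hf⟩ := exists_truncate f (N + 1 - g.order)
  have h1 : (Φ f g').coeff N = 0 := hΦ f g' _ _ (ordGE_order f) hg' N (by omega)
  have h2 : (Φ f' g).coeff N = 0 := hΦ f' g _ _ hf' (ordGE_order g) N (by omega)
  have h4 : (Φ f' g').coeff N = 0 := hΦ f' g' _ _ hf' hg' N (by omega)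
  set f₀ := ∑ k ∈ Finset.Ico f.order (N + 1 - g.order), HahnSeries.single k (f.coeff k)
  set g₀ := ∑ k ∈ Finset.Ico g.order (max g.order (N + 1 - f.order)),
    HahnSeries.single k (g.coeff k)
  have h3 : Φ f₀ g₀ = 0 := by
    simp only [f₀, g₀, map_sum, AddMonoidHom.finsetSum_apply]
    exact Finset.sum_eq_zero fun _ _ => Finset.sum_eq_zero fun _ _ => hs _ _ _ _
  -- Inclusion-exclusion: the product of the tails is counted in both mixed terms.
  have h5 : Φ f g = Φ f₀ g₀ + Φ f g' + Φ f' g - Φ f' g' := by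
    conv_lhs => rw [hf, hg]
    have e1 : Φ f g' = Φ f₀ g' + Φ f' g' := by
      conv_lhs => rw [hf]
      rw [map_add, AddMonoidHom.add_apply]
    have e2 : Φ f' g = Φ f' g₀ + Φ f' g' := by
      conv_lhs => rw [hg]
      rw [map_add]
    rw [e1, e2]
    simp only [map_add, AddMonoidHom.add_apply]
    abel
  rw [h5, HahnSeries.coeff_sub, HahnSeries.coeff_add, HahnSeries.coeff_add, h1, h2, h4, h3]
  simp

/-- Both sides are biadditive and `u⁻¹`-adically continuous, so monomials suffice. For them the
claim is the Vandermonde convolution for binomial coefficients with upper indices `-k` and `-l`. -/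
theorem shiftSeries_mul (c : ℤ) (f g : USeries B) :
    shiftSeries c (f * g) = shiftSeries c f * shiftSeries c g := by
  let Φ : USeries B →+ USeries B →+ USeries B :=
    (AddMonoidHom.compHom (shiftSeries c)).comp AddMonoidHom.mul -
      (AddMonoidHom.mul.compl₂ (shiftSeries c)).comp (shiftSeries c)
  have hΦ : ∀ f g, Φ f g = shiftSeries c (f * g) - shiftSeries c f * shiftSeries c g :=
    fun f g => rfl
  rw [← sub_eq_zero, ← hΦ]
  refine biadditive_eq_zero (fun f g L L' hf hg => ?_) (fun k x l y => ?_) f g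
  · rw [hΦ]
    exact ((hf.mul hg).shift c).sub ((hf.shift c).mul (hg.shift c))
  · rw [hΦ, sub_eq_zero]
    ext N
    rw [HahnSeries.single_mul_single, shiftSeries_single_coeff,
      coeff_mul_Icc ((ordGE_single k x).shift c) ((ordGE_single l y).shift c)]
    split_ifs with h
    · have h1 : ∀ K ∈ Finset.Icc k (N - l),
          (shiftSeries c (HahnSeries.single k x)).coeff K *
            (shiftSeries c (HahnSeries.single l y)).coeff (N - K) =
          (Ring.choose (-k) (K - k).toNat * Ring.choose (-l) (N - l - K).toNat *
            c ^ (N - k - l).toNat) • (x * y) := by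
        intro K hK
        rw [Finset.mem_Icc] at hK
        rw [shiftSeries_single_coeff, shiftSeries_single_coeff, if_pos hK.1, if_pos (by omega),
          smul_mul_smul_comm]
        congr 1
        rw [show (N - k - l).toNat = (K - k).toNat + (N - l - K).toNat by omega, pow_add,
          show N - K - l = N - l - K by omega]
        ring
      rw [Finset.sum_congr rfl h1, ← Finset.sum_smul, ← Finset.sum_mul]
      congr 2
      · rw [neg_add, Ring.add_choose_eq _ (Commute.all _ _)]
        symm
        -- Vandermonde sums over pairs of lower indices; the exponent `K` of the first factor
        -- corresponds to the pair `(K - k, N - l - K)`.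
        refine Finset.sum_of_injOn (fun K => ((K - k).toNat, (N - l - K).toNat)) ?_ ?_ ?_ ?_
        · intro K hK K' hK' hKK
          simp only [Finset.coe_Icc, Set.mem_Icc, Prod.mk.injEq] at hK hK' hKK
          omega
        · intro K hK
          simp only [Finset.coe_Icc, Set.mem_Icc, Finset.mem_coe,
            Finset.HasAntidiagonal.mem_antidiagonal] at hK ⊢
          omega
        · rintro ⟨i, j⟩ hij hn
          exfalso
          apply hn
          simp only [Finset.HasAntidiagonal.mem_antidiagonal] at hij
          refine ⟨k + i, ?_, ?_⟩
          · simp only [Finset.coe_Icc, Set.mem_Icc]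
            omega
          · simp only [Prod.mk.injEq]
            omega
        · intro K _
          rfl
      · congr 1
        omega
    · rw [Finset.Icc_eq_empty (by omega), Finset.sum_empty]

theorem shiftSeries_C (c : ℤ) (x : B) : shiftSeries c (HahnSeries.C x) = HahnSeries.C x := by
  ext N
  rw [HahnSeries.C_apply, shiftSeries_single_coeff, HahnSeries.coeff_single]
  rcases lt_trichotomy N 0 with h | rfl | h
  · rw [if_neg (by omega), if_neg h.ne]
  · simp
  · rw [if_pos h.le, if_neg h.ne', neg_zero, Ring.choose_zero_pos, zero_mul, zero_smul]
    omega

theorem shiftSeries_uVar (c : ℤ) :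
    shiftSeries c (uVar : USeries B) = uVar + (c : USeries B) := by
  ext N
  have hc : (c : USeries B) = HahnSeries.single 0 (c : B) := by
    rw [← HahnSeries.C_apply, map_intCast]
  rw [uVar, shiftSeries_single_coeff, HahnSeries.coeff_add, hc, HahnSeries.coeff_single,
    HahnSeries.coeff_single]
  rcases lt_trichotomy N (-1) with h | rfl | h
  · rw [if_neg (by omega), if_neg (by omega), if_neg (by omega), add_zero]
  · simp
  · rw [if_pos h.le, if_neg h.ne', zero_add, neg_neg]
    by_cases h0 : N = 0
    · subst h0
      simp
    · rw [if_neg h0, show (1 : ℤ) = ((1 : ℕ) : ℤ) by rfl, Ring.choose_natCast,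
        Nat.choose_eq_zero_of_lt (by omega)]
      simp

/-- The substitution `f(u) ↦ f(u + c)` as a ring homomorphism. -/
def shiftHom (c : ℤ) : USeries B →+* USeries B :=
  { shiftSeries c with
    map_one' := by
      change shiftSeries c 1 = 1
      rw [← map_one HahnSeries.C, shiftSeries_C]
    map_mul' := shiftSeries_mul c }

theorem shiftHom_apply (c : ℤ) (f : USeries B) : shiftHom c f = shiftSeries c f := rfl

theorem shiftHom_C (c : ℤ) (x : B) : shiftHom c (HahnSeries.C x) = HahnSeries.C x :=
  shiftSeries_C c x

theorem shiftHom_uVar (c : ℤ) : shiftHom c (uVar : USeries B) = uVar + (c : USeries B) :=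
  shiftSeries_uVar c

theorem mapSeries_shift (φ : B →+ B') (c : ℤ) (f : USeries B) :
    mapSeries φ (shiftSeries c f) = shiftSeries c (mapSeries φ f) := by
  ext N
  rw [mapSeries_coeff, shiftSeries_coeff c (ordGE_order f),
    shiftSeries_coeff c ((ordGE_order f).mapSeries φ), map_sum]
  exact Finset.sum_congr rfl fun k _ => by rw [map_zsmul, mapSeries_coeff]

theorem shift_mem_coeffSubring {S : Subring B} {f : USeries B} (hf : f ∈ coeffSubring S)
    (c : ℤ) : shiftSeries c f ∈ coeffSubring S := fun N => by
  rw [shiftSeries_coeff c (ordGE_order f)]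
  exact S.sum_mem fun k _ => S.zsmul_mem (hf k) _

theorem shift_mem_poly {f : USeries B} (hf : f ∈ polySubring B) (c : ℤ) :
    shiftSeries c f ∈ polySubring B := fun N hN => by
  rw [shiftSeries_coeff c (ordGE_order f)]
  refine Finset.sum_eq_zero fun k _ => ?_
  rcases lt_or_ge 0 k with h | h
  · rw [hf k h, smul_zero]
  -- Here `-k ≥ 0`, and the lower index `N - k` exceeds it because `N > 0`, so the binomial
  -- coefficient vanishes.
  · rw [show -k = (((-k).toNat : ℕ) : ℤ) by omega, Ring.choose_natCast,
      Nat.choose_eq_zero_of_lt (by omega)]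
    simp

theorem uVar_pow (i : ℕ) : (uVar : USeries B) ^ i = HahnSeries.single (-(i : ℤ)) 1 := by
  rw [uVar, HahnSeries.single_pow, one_pow]
  simp

theorem commute_of_coeff {f g : USeries B} (h : ∀ k l, Commute (f.coeff k) (g.coeff l)) :
    Commute f g := by
  change f * g = g * f
  ext N
  rw [coeff_mul_Icc (ordGE_order f) (ordGE_order g), coeff_mul_Icc (ordGE_order g) (ordGE_order f)]
  refine Finset.sum_nbij' (fun k => N - k) (fun k => N - k) ?_ ?_ ?_ ?_ ?_
  all_goals intro k hk; rw [Finset.mem_Icc] at hk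
  · rw [Finset.mem_Icc]; omega
  · rw [Finset.mem_Icc]; omega
  · omega
  · omega
  · rw [show N - (N - k) = k by omega]; exact h _ _

theorem eq_sum_of_mem_poly {f : USeries B} (hf : f ∈ polySubring B) {m : ℕ}
    (hm : OrdGE f (-m)) :
    f = ∑ i : Fin (m + 1), HahnSeries.C (f.coeff (-((i : ℕ) : ℤ))) * uVar ^ (i : ℕ) := by
  have h : ∀ i : Fin (m + 1), HahnSeries.C (f.coeff (-((i : ℕ) : ℤ))) * uVar ^ (i : ℕ) =
      HahnSeries.single (-((i : ℕ) : ℤ)) (f.coeff (-((i : ℕ) : ℤ))) := fun i => by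
    rw [uVar_pow, HahnSeries.C_apply, HahnSeries.single_mul_single, zero_add, mul_one]
  simp only [h]
  ext N
  rw [HahnSeries.coeff_sum]
  by_cases hN : N ≤ 0 ∧ -(m : ℤ) ≤ N
  · rw [Finset.sum_eq_single (⟨(-N).toNat, by omega⟩ : Fin (m + 1))]
    · rw [show -(((⟨(-N).toNat, by omega⟩ : Fin (m + 1)) : ℕ) : ℤ) = N by simp; omega,
        HahnSeries.coeff_single_same]
    · intro i _ hi
      rw [HahnSeries.coeff_single_of_ne]
      rintro rfl
      apply hi
      ext
      simp
    · simp
  · rw [Finset.sum_eq_zero]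
    · rcases lt_or_ge 0 N with h0 | h0
      · exact hf N h0
      · exact hm N (by omega)
    · intro i _
      rw [HahnSeries.coeff_single_of_ne]
      have := i.2
      omega

theorem coeff_sum_C_mul_uVar_pow {m : ℕ} (c : Fin (m + 1) → B) (i : Fin (m + 1)) :
    (∑ i : Fin (m + 1), HahnSeries.C (c i) * uVar ^ (i : ℕ) : USeries B).coeff
      (-((i : ℕ) : ℤ)) = c i := by
  have h : ∀ i : Fin (m + 1), (HahnSeries.C (c i) * uVar ^ (i : ℕ) : USeries B) =
      HahnSeries.single (-((i : ℕ) : ℤ)) (c i) := fun i => by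
    rw [uVar_pow, HahnSeries.C_apply, HahnSeries.single_mul_single, zero_add, mul_one]
  simp only [h]
  rw [HahnSeries.coeff_sum, Finset.sum_eq_single i, HahnSeries.coeff_single_same]
  · intro j _ hj
    rw [HahnSeries.coeff_single_of_ne]
    intro h'
    apply hj
    ext
    omega
  · simp

end SeriesLemmas

end

end BetheGaudin

namespace BetheGaudin

noncomputable section

/-! ### Leading terms -/

section Leading

variable {m : ℕ} {W : Type*} [AddCommGroup W] [Module ℂ W]

theorem DegLE.mono {p : RatFun m} {q q' : ℤ} (h : DegLE p q) (hq : q ≤ q') : DegLE p q' :=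
  fun N hN => h N (by omega)

theorem DegLE.mul {p p' : RatFun m} {q q' : ℤ} (h : DegLE p q) (h' : DegLE p' q') :
    DegLE (p * p') (q + q') := by
  intro N hN
  rw [map_mul]
  exact OrdGE.mul (L := -q) (L' := -q') h h' N (by omega)

theorem scaleCoeff_apply (q : ℤ) (p : RatFun m) :
    scaleCoeff m q p = (scaleHom m p).coeff (-q) := rfl

theorem scaleCoeff_mul {p p' : RatFun m} {q q' : ℤ} (h : DegLE p q) (h' : DegLE p' q') :
    scaleCoeff m (q + q') (p * p') = scaleCoeff m q p * scaleCoeff m q' p' := by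
  rw [scaleCoeff_apply, map_mul, coeff_mul_Icc (L := -q) (L' := -q') h h',
    show -(q + q') - -q' = -q by ring, Finset.Icc_self, Finset.sum_singleton,
    show -(q + q') - -q = -q' by ring]
  rfl

theorem degLE_const (c : ℂ) : DegLE (algebraMap ℂ (RatFun m) c) 0 := fun N hN => by
  rw [scaleHom_const, HahnSeries.C_apply, HahnSeries.coeff_single_of_ne (by omega)]

theorem scaleHom_ratVar (k : Fin m) :
    scaleHom m (ratVar k) = HahnSeries.single (-1) (ratVar k) := by
  rw [scaleHom, ratVar, IsFractionRing.lift_algebraMap, scalePoly, MvPolynomial.coe_eval₂Hom,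
    MvPolynomial.eval₂_X]
  rfl

theorem degLE_ratVar (k : Fin m) : DegLE (ratVar k) 1 := fun N hN => by
  rw [scaleHom_ratVar, HahnSeries.coeff_single_of_ne (by omega)]

theorem DegLE.add {p p' : RatFun m} {q : ℤ} (h : DegLE p q) (h' : DegLE p' q) :
    DegLE (p + p') q := by
  intro N hN
  rw [map_add, HahnSeries.coeff_add, h N hN, h' N hN, add_zero]

theorem scaleCoeff_eq_zero {p : RatFun m} {q q' : ℤ} (h : DegLE p q) (hq : q < q') :
    scaleCoeff m q' p = 0 := h _ (by omega)

theorem filtration_mono {q q' : ℤ} (h : q ≤ q') :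
    filtration (m := m) (W := W) q ≤ filtration q' := by
  refine Submodule.span_mono ?_
  rintro x ⟨p, v, hp, rfl⟩
  exact ⟨p, v, hp.mono h, rfl⟩

theorem tmul_mem_filtration {p : RatFun m} {q : ℤ} (h : DegLE p q) (v : W) :
    p ⊗ₜ[ℂ] v ∈ filtration (m := m) (W := W) q := Submodule.subset_span ⟨p, v, h, rfl⟩

theorem grade_tmul (q : ℤ) (p : RatFun m) (v : W) :
    grade q (p ⊗ₜ[ℂ] v) = scaleCoeff m q p ⊗ₜ[ℂ] v := LinearMap.rTensor_tmul _ _ _ _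

theorem grade_eq_zero {q q' : ℤ} {x : RatFun m ⊗[ℂ] W} (hx : x ∈ filtration (m := m) (W := W) q)
    (h : q < q') : grade q' x = 0 := by
  induction hx using Submodule.span_induction with
  | mem x hx =>
    obtain ⟨p, v, hp, rfl⟩ := hx
    rw [grade_tmul, scaleCoeff_eq_zero hp h, TensorProduct.zero_tmul]
  | zero => rw [map_zero]
  | add x y _ _ hx hy => rw [map_add, hx, hy, add_zero]
  | smul c x _ hx => rw [map_smul, hx, smul_zero]

/-- `x ∈ F_q` has leading part `y`. -/
def GrRel (q : ℤ) (x y : RatFun m ⊗[ℂ] W) : Prop :=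
  x ∈ filtration (m := m) (W := W) q ∧ grade q x = y

theorem GrRel.add {q : ℤ} {x y x' y' : RatFun m ⊗[ℂ] W} (h : GrRel q x y) (h' : GrRel q x' y') :
    GrRel q (x + x') (y + y') :=
  ⟨add_mem h.1 h'.1, by rw [map_add, h.2, h'.2]⟩

theorem GrRel.neg {q : ℤ} {x y : RatFun m ⊗[ℂ] W} (h : GrRel q x y) : GrRel q (-x) (-y) :=
  ⟨neg_mem h.1, by rw [map_neg, h.2]⟩

theorem GrRel.zero (q : ℤ) : GrRel q (0 : RatFun m ⊗[ℂ] W) 0 := ⟨zero_mem _, map_zero _⟩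

theorem GrRel.sum {ι : Type*} {q : ℤ} {s : Finset ι} {x y : ι → RatFun m ⊗[ℂ] W}
    (h : ∀ i ∈ s, GrRel q (x i) (y i)) : GrRel q (∑ i ∈ s, x i) (∑ i ∈ s, y i) :=
  ⟨sum_mem fun i hi => (h i hi).1, by
    rw [map_sum]; exact Finset.sum_congr rfl fun i hi => (h i hi).2⟩

theorem GrRel.weaken {q q' : ℤ} {x y : RatFun m ⊗[ℂ] W} (h : GrRel q x y) (hq : q < q') :
    GrRel q' x 0 := ⟨filtration_mono hq.le h.1, grade_eq_zero h.1 hq⟩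

/-- Top coefficients of Laurent series in `r⁻¹` multiply; bilinearity extends this from pure tensors
to the span. -/
theorem grade_mul {q q' : ℤ} {x y : RatEnd m W}
    (hx : x ∈ filtration (m := m) (W := Module.End ℂ W) q)
    (hy : y ∈ filtration (m := m) (W := Module.End ℂ W) q') :
    GrRel (q + q') (x * y) (grade q x * grade q' y) := by
  induction hx using Submodule.span_induction with
  | mem x hx =>
    obtain ⟨p, v, hp, rfl⟩ := hx
    induction hy using Submodule.span_induction with
    | mem y hy =>
      obtain ⟨p', v', hp', rfl⟩ := hy
      rw [Algebra.TensorProduct.tmul_mul_tmul]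
      refine ⟨tmul_mem_filtration (hp.mul hp') _, ?_⟩
      rw [grade_tmul, grade_tmul, grade_tmul, scaleCoeff_mul hp hp',
        Algebra.TensorProduct.tmul_mul_tmul]
    | zero => rw [map_zero, mul_zero, mul_zero]; exact GrRel.zero _
    | add x y _ _ hx hy => rw [map_add, mul_add, mul_add]; exact hx.add hy
    | smul c x _ hx =>
      rw [map_smul, mul_smul_comm, mul_smul_comm]
      exact ⟨Submodule.smul_mem _ _ hx.1, by rw [map_smul, hx.2]⟩
  | zero => rw [map_zero, zero_mul, zero_mul]; exact GrRel.zero _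
  | add x y _ _ hx hy => rw [map_add, add_mul, add_mul]; exact hx.add hy
  | smul c x _ hx =>
    rw [map_smul, smul_mul_assoc, smul_mul_assoc]
    exact ⟨Submodule.smul_mem _ _ hx.1, by rw [map_smul, hx.2]⟩

theorem GrRel.mul {q q' : ℤ} {x y x' y' : RatEnd m W} (h : GrRel q x y) (h' : GrRel q' x' y') :
    GrRel (q + q') (x * x') (y * y') := by
  rw [← h.2, ← h'.2]
  exact grade_mul h.1 h'.1

/-! ### Leading parts of series with respect to total degree -/

/-- With `u` and the variables `λ_{n+k}` of degree `1`, the series `f` has degree at most `q`, both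
in total and in `u` alone, and its part of total degree `q` is `g`. -/
def SymRel (q : ℤ) (f g : USeries (RatEnd m W)) : Prop :=
  OrdGE f (-q) ∧ ∀ N, GrRel (N + q) (f.coeff N) (g.coeff N)

theorem SymRel.ordGE {q : ℤ} {f g : USeries (RatEnd m W)} (h : SymRel q f g) : OrdGE f (-q) := h.1

theorem SymRel.ordGE_right {q : ℤ} {f g : USeries (RatEnd m W)} (h : SymRel q f g) :
    OrdGE g (-q) := fun N hN => by rw [← (h.2 N).2, h.1 N hN, map_zero]

/-- The leading part is computed from `f` by `grade`; this is what forces the Gaudin coefficients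
beyond order `n` to vanish. -/
theorem SymRel.unique {q : ℤ} {f g g' : USeries (RatEnd m W)} (h : SymRel q f g)
    (h' : SymRel q f g') : g = g' := by
  ext N
  rw [← (h.2 N).2, ← (h'.2 N).2]

theorem SymRel.add {q : ℤ} {f g f' g' : USeries (RatEnd m W)} (h : SymRel q f g)
    (h' : SymRel q f' g') : SymRel q (f + f') (g + g') :=
  ⟨h.1.add h'.1, fun N => by
    rw [HahnSeries.coeff_add, HahnSeries.coeff_add]; exact (h.2 N).add (h'.2 N)⟩

theorem SymRel.neg {q : ℤ} {f g : USeries (RatEnd m W)} (h : SymRel q f g) :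
    SymRel q (-f) (-g) :=
  ⟨fun N hN => by rw [HahnSeries.coeff_neg, h.1 N hN, neg_zero], fun N => by
    rw [HahnSeries.coeff_neg, HahnSeries.coeff_neg]; exact (h.2 N).neg⟩

theorem SymRel.zero (q : ℤ) : SymRel q (0 : USeries (RatEnd m W)) 0 :=
  ⟨fun _ _ => HahnSeries.coeff_zero, fun N => by rw [HahnSeries.coeff_zero]; exact GrRel.zero _⟩

theorem SymRel.sum {ι : Type*} {q : ℤ} {s : Finset ι} {f g : ι → USeries (RatEnd m W)}
    (h : ∀ i ∈ s, SymRel q (f i) (g i)) : SymRel q (∑ i ∈ s, f i) (∑ i ∈ s, g i) := by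
  classical
  induction s using Finset.induction_on with
  | empty => exact SymRel.zero q
  | insert a s ha ih =>
    rw [Finset.sum_insert ha, Finset.sum_insert ha]
    exact (h a (Finset.mem_insert_self a s)).add
      (ih fun i hi => h i (Finset.mem_insert_of_mem hi))

theorem SymRel.weaken {q q' : ℤ} {f g : USeries (RatEnd m W)} (h : SymRel q f g) (hq : q < q') :
    SymRel q' f 0 :=
  ⟨h.1.mono (by omega), fun N => by
    rw [HahnSeries.coeff_zero]; exact (h.2 N).weaken (by omega)⟩

/-- In the convolution, `u⁻ᵏ` and `u⁻⁽ᴺ⁻ᵏ⁾` carry degrees `k + q` and `N - k + q'`, whose sum `N +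
(q + q')` does not depend on `k`. -/
theorem SymRel.mul {q q' : ℤ} {f g f' g' : USeries (RatEnd m W)} (h : SymRel q f g)
    (h' : SymRel q' f' g') : SymRel (q + q') (f * f') (g * g') := by
  refine ⟨(h.1.mul h'.1).mono (by omega), fun N => ?_⟩
  rw [coeff_mul_Icc h.1 h'.1, coeff_mul_Icc h.ordGE_right h'.ordGE_right]
  refine GrRel.sum fun k _ => ?_
  have := (h.2 k).mul (h'.2 (N - k))
  rwa [show k + q + (N - k + q') = N + (q + q') by ring] at this

theorem derivSeries_coeff {B : Type*} [Ring B] (f : USeries B) (N : ℤ) :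
    (derivSeries f).coeff N = (-(N - 1)) • f.coeff (N - 1) := rfl

/-- Taylor expansion: each further derivative in `u` costs one degree, so only the first-order term
`c f'` reaches degree `q - 1`. -/
theorem SymRel.shift_sub {q : ℤ} {f g : USeries (RatEnd m W)} (h : SymRel q f g) (c : ℤ) :
    SymRel (q - 1) (shiftSeries c f - f) (c • derivSeries g) := by
  have hc : ∀ N, (shiftSeries c f - f).coeff N = ∑ k ∈ Finset.Icc (-q) (N - 1),
      (Ring.choose (-k) (N - k).toNat * c ^ (N - k).toNat) • f.coeff k := by
    intro N
    rw [HahnSeries.coeff_sub, shiftSeries_coeff c h.1]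
    rcases lt_or_ge N (-q) with hN | hN
    · rw [h.1 N hN, Finset.Icc_eq_empty (by omega), Finset.Icc_eq_empty (by omega)]
      simp
    · have : Finset.Icc (-q) N = insert N (Finset.Icc (-q) (N - 1)) := by
        ext k
        simp only [Finset.mem_Icc, Finset.mem_insert]
        omega
      rw [this, Finset.sum_insert (by simp)]
      simp
  refine ⟨fun N hN => ?_, fun N => ?_⟩
  · rw [hc, Finset.Icc_eq_empty (by omega), Finset.sum_empty]
  · rw [hc]
    refine ⟨sum_mem fun k hk => zsmul_mem (filtration_mono ?_ (h.2 k).1) _, ?_⟩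
    · have := (Finset.mem_Icc.mp hk).2
      omega
    -- Terms with `k < N - 1` have too small a degree to contribute. The term `k = N - 1` carries
    -- `Ring.choose (-(N - 1)) 1 * c`, which is the factor in the derivative.
    · rw [map_sum, HahnSeries.coeff_smul, derivSeries_coeff, Finset.sum_eq_single (N - 1)]
      · rw [map_zsmul, show N + (q - 1) = N - 1 + q by ring, (h.2 (N - 1)).2,
          show (N - (N - 1)).toNat = 1 by omega, Ring.choose_one_right, pow_one, smul_smul,
          mul_comm]
      · intro k hk hk'
        have := (Finset.mem_Icc.mp hk).2
        rw [map_zsmul, grade_eq_zero (h.2 k).1 (by omega), smul_zero]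
      · intro h'
        rw [map_zsmul, h.1 (N - 1), map_zero, smul_zero]
        simp only [Finset.mem_Icc] at h'
        omega

theorem SymRel.shift {q : ℤ} {f g : USeries (RatEnd m W)} (h : SymRel q f g) (c : ℤ) :
    SymRel q (shiftSeries c f) g := by
  have := ((h.shift_sub c).weaken (sub_one_lt q)).add h
  rwa [sub_add_cancel, zero_add] at this

/-- `grade` acts on the scalar tensor factor and `φ` on the operator factor, so the two commute; `φ`
need not be multiplicative. -/
theorem SymRel.mapSeries {W' : Type*} [AddCommGroup W'] [Module ℂ W'] {q : ℤ}
    {f g : USeries (RatEnd m W)} (h : SymRel q f g) (φ : Module.End ℂ W →ₗ[ℂ] Module.End ℂ W') :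
    SymRel q (mapSeries (LinearMap.lTensor (RatFun m) φ).toAddMonoidHom f)
      (mapSeries (LinearMap.lTensor (RatFun m) φ).toAddMonoidHom g) := by
  refine ⟨h.1.mapSeries _, fun N => ⟨?_, ?_⟩⟩
  · have h1 := (h.2 N).1
    rw [mapSeries_coeff]
    generalize f.coeff N = x at h1
    induction h1 using Submodule.span_induction with
    | mem x hx =>
      obtain ⟨p, v, hp, rfl⟩ := hx
      exact tmul_mem_filtration hp _
    | zero => rw [map_zero]; exact zero_mem _
    | add x y _ _ hx hy => rw [map_add]; exact add_mem hx hy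
    | smul c x _ hx =>
      change LinearMap.lTensor (RatFun m) φ _ ∈ _
      rw [map_smul]; exact Submodule.smul_mem _ _ hx
  · rw [mapSeries_coeff, mapSeries_coeff, ← (h.2 N).2]
    change (LinearMap.rTensor _ (scaleCoeff m (N + q)) ∘ₗ LinearMap.lTensor (RatFun m) φ) _ =
      (LinearMap.lTensor (RatFun m) φ ∘ₗ LinearMap.rTensor _ (scaleCoeff m (N + q))) _
    rw [LinearMap.rTensor_comp_lTensor, LinearMap.lTensor_comp_rTensor]

/-! ### Pole terms `1 / (u - c)` and scalar series -/

theorem poleSeries_coeff (X : Module.End ℂ W) (c : RatFun m) (N : ℤ) :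
    (poleSeries X c).coeff N = if 1 ≤ N then (c ^ (N - 1).toNat) ⊗ₜ[ℂ] X else 0 := by
  rw [poleSeries]
  have h := HahnSeries.coeff_single_mul_add (r := (1 : RatEnd m W))
    (x := HahnSeries.ofPowerSeries ℤ (RatEnd m W) (PowerSeries.mk fun r => (c ^ r) ⊗ₜ[ℂ] X))
    (a := N - 1) (b := 1)
  rw [sub_add_cancel, one_mul] at h
  rw [h]
  split_ifs with hN
  · obtain ⟨k, hk⟩ : ∃ k : ℕ, N - 1 = k := ⟨(N - 1).toNat, by omega⟩
    rw [hk, HahnSeries.ofPowerSeries_apply_coeff, PowerSeries.coeff_mk, Int.toNat_natCast]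
  · rw [HahnSeries.ofPowerSeries_apply]
    refine HahnSeries.embDomain_of_notMem_range ?_
    rintro ⟨k, hk⟩
    simp at hk
    omega

/-- These powers are the coefficients of the geometric series. The case `r = 0` also provides the
degree and leading part of the constant 1. -/
theorem scaleCoeff_one {p p' : RatFun m} (h : DegLE p 1) (hp : scaleCoeff m 1 p = p') (r : ℕ) :
    DegLE (p ^ r) r ∧ scaleCoeff m r (p ^ r) = p' ^ r := by
  induction r with
  | zero =>
    refine ⟨?_, ?_⟩
    · simpa using degLE_const (m := m) 1
    · rw [pow_zero, pow_zero, scaleCoeff_apply, map_one]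
      simp
  | succ r ih =>
    refine ⟨by rw [pow_succ]; push_cast; exact ih.1.mul h, ?_⟩
    rw [pow_succ, pow_succ]
    push_cast
    rw [scaleCoeff_mul ih.1 h, ih.2, hp]

/-- The coefficient of `u⁻ᴺ` is `c^(N-1)`, of degree `N - 1`, so `X / (u - c)` is of total degree -1
and only the leading part of `c` matters. -/
theorem symRel_poleSeries (X : Module.End ℂ W) {c c' : RatFun m} (h : DegLE c 1)
    (hc : scaleCoeff m 1 c = c') : SymRel (-1) (poleSeries X c) (poleSeries X c') := by
  refine ⟨fun N hN => ?_, fun N => ?_⟩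
  · rw [poleSeries_coeff, if_neg (by omega)]
  · rw [poleSeries_coeff, poleSeries_coeff]
    split_ifs with hN
    · have h1 := scaleCoeff_one h hc (N - 1).toNat
      rw [show (((N - 1).toNat : ℕ) : ℤ) = N + -1 by omega] at h1
      exact ⟨tmul_mem_filtration h1.1 X, by rw [grade_tmul, h1.2]⟩
    · exact GrRel.zero _

theorem degLE_add_const (p : RatFun m) (h : DegLE p 1) (c : ℂ) :
    DegLE (p + algebraMap ℂ _ c) 1 ∧
      scaleCoeff m 1 (p + algebraMap ℂ _ c) = scaleCoeff m 1 p :=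
  ⟨h.add ((degLE_const c).mono (by norm_num)), by
    rw [map_add, scaleCoeff_eq_zero (degLE_const c) (by norm_num), add_zero]⟩

theorem wParam_eq (b : Fin m → ℕ) (k : Fin m) :
    wParam b k = ratVar k + algebraMap ℂ _ ((b k : ℂ) - ((k : ℕ) + 1 : ℂ)) := by
  rw [wParam]
  simp
  ring

theorem degLE_wParam (b : Fin m → ℕ) (k : Fin m) : DegLE (wParam b k) 1 := by
  rw [wParam_eq]
  exact (degLE_add_const _ (degLE_ratVar k) _).1

theorem scaleCoeff_ratVar (k : Fin m) : scaleCoeff m 1 (ratVar k) = ratVar k := by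
  rw [scaleCoeff_apply, scaleHom_ratVar, HahnSeries.coeff_single_same]

theorem scaleCoeff_wParam (b : Fin m → ℕ) (k : Fin m) :
    scaleCoeff m 1 (wParam b k) = ratVar k := by
  rw [wParam_eq, (degLE_add_const _ (degLE_ratVar k) _).2, scaleCoeff_ratVar]

/-- Scalar series as a ring homomorphism. -/
def scalarHom (m : ℕ) (W : Type*) [AddCommGroup W] [Module ℂ W] :
    USeries (RatFun m) →+* USeries (RatEnd m W) :=
  mapSeriesHom (Algebra.TensorProduct.includeLeftRingHom : RatFun m →+* RatEnd m W)

theorem scalarHom_coeff (f : USeries (RatFun m)) (N : ℤ) :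
    (scalarHom m W f).coeff N = f.coeff N ⊗ₜ[ℂ] 1 := rfl

theorem commute_scalarHom (f : USeries (RatFun m)) (g : USeries (RatEnd m W)) :
    Commute (scalarHom m W f) g := by
  refine commute_of_coeff fun k l => ?_
  rw [scalarHom_coeff]
  generalize g.coeff l = x
  induction x using TensorProduct.induction_on with
  | zero => exact Commute.zero_right _
  | tmul p X =>
    change _ * _ = _ * _
    rw [Algebra.TensorProduct.tmul_mul_tmul, Algebra.TensorProduct.tmul_mul_tmul, mul_comm p,
      one_mul, mul_one]
  | add x y hx hy => exact hx.add_right hy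

theorem uVar_sub_C_ne_zero {K : Type*} [Ring K] [Nontrivial K] (c : K) :
    (uVar - HahnSeries.C c : USeries K) ≠ 0 := by
  intro h
  have := congrArg (fun f => HahnSeries.coeff f (-1)) h
  simp [uVar, HahnSeries.C_apply, HahnSeries.coeff_single_of_ne] at this

theorem symRel_uVar_sub_C {c c' : RatFun m} (h : DegLE c 1) (hc : scaleCoeff m 1 c = c') :
    SymRel 1 (scalarHom m W (uVar - HahnSeries.C c)) (scalarHom m W (uVar - HahnSeries.C c')) := by
  refine ⟨fun N hN => ?_, fun N => ?_⟩
  · rw [scalarHom_coeff, uVar, HahnSeries.C_apply, HahnSeries.coeff_sub,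
      HahnSeries.coeff_single_of_ne (by omega), HahnSeries.coeff_single_of_ne (by omega),
      sub_zero, TensorProduct.zero_tmul]
  · rw [scalarHom_coeff, scalarHom_coeff, uVar, HahnSeries.C_apply, HahnSeries.C_apply,
      HahnSeries.coeff_sub, HahnSeries.coeff_sub, HahnSeries.coeff_single, HahnSeries.coeff_single,
      HahnSeries.coeff_single]
    by_cases h1 : N = -1
    · subst h1
      have h0 := scaleCoeff_one h hc 0
      simp only [pow_zero, Nat.cast_zero] at h0
      simp only [if_true, sub_zero, show (-1 : ℤ) ≠ 0 by norm_num, if_false]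
      exact ⟨tmul_mem_filtration h0.1 _, by
        rw [grade_tmul, show (-1 + 1 : ℤ) = 0 by norm_num, h0.2]⟩
    · rw [if_neg h1, zero_sub, zero_sub]
      by_cases h2 : N = 0
      · subst h2
        rw [if_pos rfl, if_pos rfl, TensorProduct.neg_tmul, TensorProduct.neg_tmul]
        exact GrRel.neg ⟨tmul_mem_filtration h _, by rw [grade_tmul]; simp [hc]⟩
      · rw [if_neg h2, if_neg h2, neg_zero, TensorProduct.zero_tmul]
        exact GrRel.zero _

/-- The geometric series telescopes; only the coefficient of `u⁰` survives. -/
theorem poleSeries_mul_sub (X : Module.End ℂ W) (c : RatFun m) :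
    scalarHom m W (uVar - HahnSeries.C c) * poleSeries X c = HahnSeries.C (1 ⊗ₜ[ℂ] X) := by
  rw [map_sub, sub_mul, scalarHom, mapSeriesHom_uVar, mapSeriesHom_C]
  ext N
  rw [HahnSeries.coeff_sub, HahnSeries.C_apply, HahnSeries.C_apply, HahnSeries.coeff_single]
  have h1 := HahnSeries.coeff_single_mul_add (r := (1 : RatEnd m W)) (x := poleSeries X c)
    (a := N + 1) (b := -1)
  rw [add_neg_cancel_right, one_mul] at h1
  have h2 := HahnSeries.coeff_single_mul_add
    (r := (Algebra.TensorProduct.includeLeftRingHom c : RatEnd m W)) (x := poleSeries X c)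
    (a := N) (b := 0)
  rw [add_zero] at h2
  rw [uVar, h1, h2, poleSeries_coeff, poleSeries_coeff,
    Algebra.TensorProduct.includeLeftRingHom_apply]
  rcases lt_trichotomy N 0 with h | rfl | h
  · rw [if_neg (by omega), if_neg (by omega), if_neg h.ne, mul_zero, sub_zero]
  · simp
  · rw [if_pos (by omega), if_pos (by omega), if_neg h.ne', Algebra.TensorProduct.tmul_mul_tmul,
      one_mul, ← pow_succ', show (N - 1).toNat + 1 = (N + 1 - 1).toNat by omega, sub_self]

/-- Expressing the pole through an inverse in the field of scalar series makes cancellation of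
denominators available. -/
theorem poleSeries_eq (X : Module.End ℂ W) (c : RatFun m) :
    poleSeries X c = HahnSeries.C (1 ⊗ₜ[ℂ] X) * scalarHom m W (uVar - HahnSeries.C c)⁻¹ := by
  have h : scalarHom m W (uVar - HahnSeries.C c) * scalarHom m W (uVar - HahnSeries.C c)⁻¹ = 1 := by
    rw [← map_mul, mul_inv_cancel₀ (uVar_sub_C_ne_zero c), map_one]
  rw [← poleSeries_mul_sub X c, (commute_scalarHom _ _).eq]
  exact (mul_one _).symm.trans ((congrArg (poleSeries X c * ·) h.symm).trans (mul_assoc _ _ _).symm)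

theorem symRel_inv_uVar_sub_C {c c' : RatFun m} (h : DegLE c 1) (hc : scaleCoeff m 1 c = c') :
    SymRel (-1) (scalarHom m W (uVar - HahnSeries.C c)⁻¹)
      (scalarHom m W (uVar - HahnSeries.C c')⁻¹) := by
  -- The inverse of `u - c` is the pole series with identity operator.
  have := symRel_poleSeries (1 : Module.End ℂ W) h hc
  rwa [poleSeries_eq, poleSeries_eq, ← Algebra.TensorProduct.one_def, map_one, one_mul,
    one_mul] at this

end Leading

end

end BetheGaudin

namespace BetheGaudin

noncomputable section

/-! ### Difference operators in powers of `d` -/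

section Operators

variable {B : Type*} [Ring B]

theorem end_mul_apply {X : Type*} [AddCommGroup X] (f g : AddMonoid.End X) (x : X) :
    (f * g) x = f (g x) := rfl

theorem end_sub_apply {X : Type*} [AddCommGroup X] (f g : AddMonoid.End X) (x : X) :
    (f - g) x = f x - g x := rfl

theorem end_zsmul_apply {X : Type*} [AddCommGroup X] (z : ℤ) (f : AddMonoid.End X) (x : X) :
    (z • f) x = z • f x := rfl

theorem end_sum_apply {X ι : Type*} [AddCommGroup X] (s : Finset ι) (f : ι → AddMonoid.End X)
    (x : X) : (∑ i ∈ s, f i) x = ∑ i ∈ s, f i x :=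
  map_sum (AddMonoidHom.eval x : AddMonoid.End X →+ X) f s

@[simp] theorem mulSeries_apply (g : USeries B) (x : OpCoeffs B) (k : ℕ) :
    mulSeries g x k = g * x k := rfl

@[simp] theorem mulSeries_single (g : USeries B) (k : ℕ) (f : USeries B) :
    mulSeries g (Finsupp.single k f) = Finsupp.single k (g * f) :=
  Finsupp.mapRange_single (hf := mul_zero g)

theorem mulSeries_mul (f g : USeries B) : mulSeries (f * g) = mulSeries f * mulSeries g := by
  ext x k
  simp [mul_assoc]

theorem mulSeries_one : mulSeries (1 : USeries B) = 1 := by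
  ext x k
  simp

theorem mulSeries_sub (f g : USeries B) : mulSeries (f - g) = mulSeries f - mulSeries g := by
  refine AddMonoidHom.ext fun x => Finsupp.ext fun k => ?_
  exact sub_mul f g (x k)

theorem mulSeries_sum {ι : Type*} (s : Finset ι) (f : ι → USeries B) :
    mulSeries (∑ i ∈ s, f i) = ∑ i ∈ s, mulSeries (f i) := by
  have h : ∀ x : OpCoeffs B, mulSeries (∑ i ∈ s, f i) x = (∑ i ∈ s, mulSeries (f i)) x := by
    intro x
    ext1 k
    rw [end_sum_apply, Finsupp.finsetSum_apply, mulSeries_apply, Finset.sum_mul]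
    rfl
  exact AddMonoidHom.ext h

@[simp] theorem tauOp_single (k : ℕ) (f : USeries B) :
    tauOp (Finsupp.single k f) = Finsupp.single (k + 1) (shiftSeries 1 f) :=
  Finsupp.liftAddHom_apply_single _ _ _

theorem tauOp_apply_zero (x : OpCoeffs B) : tauOp x 0 = 0 := by
  induction x using Finsupp.induction_linear with
  | zero => simp
  | add x y hx hy => rw [map_add, Finsupp.add_apply, hx, hy, add_zero]
  | single k f => simp

theorem tauOp_apply_succ (x : OpCoeffs B) (k : ℕ) : tauOp x (k + 1) = shiftSeries 1 (x k) := by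
  induction x using Finsupp.induction_linear with
  | zero => simp
  | add x y hx hy => rw [map_add tauOp, Finsupp.add_apply, hx, hy, Finsupp.add_apply, map_add]
  | single j f =>
    rw [tauOp_single, Finsupp.single_apply, Finsupp.single_apply]
    by_cases h : j = k
    · simp [h]
    · rw [if_neg (by omega), if_neg h, map_zero]

theorem tauOp_mulSeries (f : USeries B) (x : OpCoeffs B) :
    tauOp (mulSeries f x) = mulSeries (shiftSeries 1 f) (tauOp x) := by
  ext1 k
  cases k with
  | zero => rw [tauOp_apply_zero, mulSeries_apply, tauOp_apply_zero, mul_zero]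
  | succ k => rw [tauOp_apply_succ, mulSeries_apply, mulSeries_apply, tauOp_apply_succ,
      shiftSeries_mul]

theorem dOp_apply (x : OpCoeffs B) : dOp x = tauOp x - x := rfl

/-- `∑ gⱼ dʲ`. -/
def dBasis : OpCoeffs B →+ OpCoeffs B :=
  Finsupp.liftAddHom fun j =>
    { toFun := fun g => mulSeries g ((dOp ^ j) opOne)
      map_zero' := by ext; simp
      map_add' := fun g g' => by
        refine Finsupp.ext fun k => ?_
        exact add_mul g g' _ }

@[simp] theorem dBasis_single (j : ℕ) (g : USeries B) :
    dBasis (Finsupp.single j g) = mulSeries g ((dOp ^ j) opOne) :=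
  Finsupp.liftAddHom_apply_single _ _ _

theorem mulSeries_dBasis (f : USeries B) (x : OpCoeffs B) :
    mulSeries f (dBasis x) = dBasis (mulSeries f x) := by
  induction x using Finsupp.induction_linear with
  | zero => simp
  | add x y hx hy => simp only [map_add, hx, hy]
  | single j g => rw [mulSeries_single, dBasis_single, dBasis_single, mulSeries_mul]; rfl

/-- Left multiplication by `d` in terms of the coefficients of the powers of `d`. -/
def dStep : AddMonoid.End (OpCoeffs B) :=
  Finsupp.liftAddHom fun k => (Finsupp.singleAddHom (k + 1)).comp (shiftSeries 1) +
    (Finsupp.singleAddHom k).comp (shiftSeries 1 - AddMonoidHom.id _)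

@[simp] theorem dStep_single (k : ℕ) (f : USeries B) :
    dStep (Finsupp.single k f) = Finsupp.single (k + 1) (shiftSeries 1 f) +
      Finsupp.single k (shiftSeries 1 f - f) :=
  Finsupp.liftAddHom_apply_single _ _ _

theorem dStep_apply_zero (x : OpCoeffs B) : dStep x 0 = shiftSeries 1 (x 0) - x 0 := by
  induction x using Finsupp.induction_linear with
  | zero => simp
  | add x y hx hy =>
    rw [map_add, Finsupp.add_apply, hx, hy, Finsupp.add_apply, map_add]; abel
  | single k f =>
    by_cases h : k = 0 <;> simp [h]

theorem dStep_apply_succ (x : OpCoeffs B) (k : ℕ) :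
    dStep x (k + 1) = shiftSeries 1 (x k) + (shiftSeries 1 (x (k + 1)) - x (k + 1)) := by
  induction x using Finsupp.induction_linear with
  | zero => simp
  | add x y hx hy =>
    simp only [map_add, Finsupp.add_apply, hx, hy]; abel
  | single j f =>
    rw [dStep_single, Finsupp.add_apply]
    simp only [Finsupp.single_apply, Nat.add_right_cancel_iff]
    split_ifs <;> simp

/-- This is the commutation rule `d f(u) = f(u+1) d + (f(u+1) - f(u))`. -/
theorem dOp_dBasis (x : OpCoeffs B) : dOp (dBasis x) = dBasis (dStep x) := by
  induction x using Finsupp.induction_linear with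
  | zero => simp
  | add x y hx hy => simp only [map_add, hx, hy]
  | single j g =>
    rw [dStep_single, map_add, dBasis_single, dBasis_single, dBasis_single, dOp_apply,
      tauOp_mulSeries, pow_succ', mulSeries_sub, end_mul_apply, dOp_apply, map_sub,
      end_sub_apply]
    abel

/-- The coefficients with respect to the powers of `d`. -/
def dCoeffs : OpCoeffs B →+ OpCoeffs B :=
  Finsupp.liftAddHom fun k => ∑ j ∈ Finset.range (k + 1), k.choose j • Finsupp.singleAddHom j

/-- The binomial expansion `τ^k = (1 + d)^k`. -/
theorem dCoeffs_single_apply (k j : ℕ) (f : USeries B) :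
    dCoeffs (Finsupp.single k f) j = k.choose j • f := by
  rw [dCoeffs, Finsupp.liftAddHom_apply_single, AddMonoidHom.finsetSum_apply,
    Finsupp.finsetSum_apply]
  simp only [AddMonoidHom.nsmul_apply, Finsupp.singleAddHom_apply, Finsupp.smul_apply,
    Finsupp.single_apply]
  by_cases h : j ≤ k
  · rw [Finset.sum_eq_single j]
    · simp
    · intro b _ hb
      simp [hb]
    · intro h'
      simp only [Finset.mem_range] at h'
      omega
  · rw [Nat.choose_eq_zero_of_lt (by omega), zero_smul]
    refine Finset.sum_eq_zero fun b hb => ?_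
    rw [if_neg, smul_zero]
    have := Finset.mem_range.mp hb
    omega

theorem dCoeffs_apply (x : OpCoeffs B) (j : ℕ) {n : ℕ} (h : ∀ k > n, x k = 0) :
    dCoeffs x j = ∑ k ∈ Finset.range (n + 1), k.choose j • x k := by
  have hx : x = ∑ k ∈ Finset.range (n + 1), Finsupp.single k (x k) := by
    ext1 l
    rw [Finsupp.finsetSum_apply]
    simp only [Finsupp.single_apply, Finset.sum_ite_eq', Finset.mem_range]
    split_ifs with hl
    · rfl
    · exact h l (by omega)
  conv_lhs => rw [hx]
  rw [map_sum, Finsupp.finsetSum_apply]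
  exact Finset.sum_congr rfl fun k _ => dCoeffs_single_apply k j _

/-- For a single power of `τ` this is Pascal's rule. -/
theorem dCoeffs_dOp (x : OpCoeffs B) : dCoeffs (dOp x) = dStep (dCoeffs x) := by
  rw [dOp_apply, map_sub, sub_eq_iff_eq_add]
  induction x using Finsupp.induction_linear with
  | zero => simp
  | add x y hx hy => simp only [map_add, hx, hy]; abel
  | single k f =>
    ext1 j
    rw [tauOp_single, dCoeffs_single_apply, Finsupp.add_apply]
    cases j with
    | zero => rw [dStep_apply_zero, dCoeffs_single_apply, map_nsmul]; simp
    | succ j =>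
      rw [dStep_apply_succ, dCoeffs_single_apply, dCoeffs_single_apply, map_nsmul, map_nsmul,
        Nat.choose_succ_succ, add_smul]
      abel

theorem mulSeries_dCoeffs (f : USeries B) (x : OpCoeffs B) :
    dCoeffs (mulSeries f x) = mulSeries f (dCoeffs x) := by
  induction x using Finsupp.induction_linear with
  | zero => simp
  | add x y hx hy => simp only [map_add, hx, hy]
  | single k g =>
    ext1 j
    rw [mulSeries_single, dCoeffs_single_apply, mulSeries_apply, dCoeffs_single_apply,
      mul_smul_comm]

theorem dCoeffs_dOp_pow (j : ℕ) :
    dCoeffs ((dOp ^ j) (opOne : OpCoeffs B)) = Finsupp.single j 1 := by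
  have h1 : shiftSeries 1 (1 : USeries B) = 1 := map_one (shiftHom 1)
  induction j with
  | zero =>
    ext1 j
    rw [pow_zero, AddMonoid.End.one_apply, opOne, dCoeffs_single_apply, Finsupp.single_apply]
    cases j <;> simp
  | succ j ih => rw [pow_succ', end_mul_apply, dCoeffs_dOp, ih, dStep_single, h1]; simp

theorem dCoeffs_dBasis (x : OpCoeffs B) : dCoeffs (dBasis x) = x := by
  induction x using Finsupp.induction_linear with
  | zero => simp
  | add x y hx hy => rw [map_add, map_add, hx, hy]
  | single j g => rw [dBasis_single, mulSeries_dCoeffs, dCoeffs_dOp_pow, mulSeries_single, mul_one]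

/-! ### Powers of `∂` -/

@[simp] theorem partialOp_single (k : ℕ) (f : USeries B) :
    partialOp (Finsupp.single k f) =
      Finsupp.single (k + 1) f + Finsupp.single k (derivSeries f) :=
  Finsupp.liftAddHom_apply_single _ _ _

theorem partialOp_apply_zero (x : OpCoeffs B) : partialOp x 0 = derivSeries (x 0) := by
  induction x using Finsupp.induction_linear with
  | zero => simp
  | add x y hx hy => rw [map_add, Finsupp.add_apply, hx, hy, Finsupp.add_apply, map_add]
  | single k f =>
    by_cases h : k = 0 <;> simp [h]

theorem partialOp_apply_succ (x : OpCoeffs B) (k : ℕ) :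
    partialOp x (k + 1) = x k + derivSeries (x (k + 1)) := by
  induction x using Finsupp.induction_linear with
  | zero => simp
  | add x y hx hy => simp only [map_add, Finsupp.add_apply, hx, hy]; abel
  | single j f =>
    rw [partialOp_single, Finsupp.add_apply]
    simp only [Finsupp.single_apply, Nat.add_right_cancel_iff]
    split_ifs <;> simp

theorem derivSeries_one : derivSeries (1 : USeries B) = 0 := by
  ext N
  rw [derivSeries_coeff, HahnSeries.coeff_one, HahnSeries.coeff_zero]
  split_ifs with h
  · rw [h]; simp
  · rw [smul_zero]

theorem partialOp_pow (j : ℕ) :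
    (partialOp ^ j) (opOne : OpCoeffs B) = Finsupp.single j 1 := by
  induction j with
  | zero => rfl
  | succ j ih => rw [pow_succ', end_mul_apply, ih, partialOp_single, derivSeries_one]; simp

end Operators

/-! ### The leading part of the difference operator -/

section OperatorSymbols

variable {m : ℕ} {W : Type*} [AddCommGroup W] [Module ℂ W]

/-- The difference operator `P` has degree at most `q`, where `d` has degree `-1`, and its leading
part, with `d` replaced by `∂`, is `Q`. -/
def OpRel (q : ℤ) (P Q : OpCoeffs (RatEnd m W)) : Prop :=
  ∃ g, P = dBasis g ∧ ∀ j : ℕ, SymRel (q + j) (g j) (Q j)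

theorem SymRel.one : SymRel 0 (1 : USeries (RatEnd m W)) 1 := by
  refine ⟨fun N hN => ?_, fun N => ?_⟩
  · rw [HahnSeries.coeff_one, if_neg (by omega)]
  · rw [HahnSeries.coeff_one]
    split_ifs with h
    · subst h
      rw [Algebra.TensorProduct.one_def]
      have := scaleCoeff_one (degLE_const (m := m) 0 |>.mono (by norm_num : (0 : ℤ) ≤ 1)) rfl 0
      simp only [pow_zero, Nat.cast_zero] at this
      exact ⟨tmul_mem_filtration this.1 _, by rw [grade_tmul, add_zero, this.2]⟩
    · exact GrRel.zero _

theorem opRel_opOne : OpRel 0 (opOne : OpCoeffs (RatEnd m W)) opOne := by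
  refine ⟨opOne, ?_, fun j => ?_⟩
  · rw [opOne, dBasis_single, mulSeries_one]; rfl
  · rw [opOne, Finsupp.single_apply]
    split_ifs with h
    · subst h; exact SymRel.one
    · exact SymRel.zero _

theorem OpRel.add {q : ℤ} {P Q P' Q' : OpCoeffs (RatEnd m W)} (h : OpRel q P Q)
    (h' : OpRel q P' Q') : OpRel q (P + P') (Q + Q') := by
  obtain ⟨g, rfl, hg⟩ := h
  obtain ⟨g', rfl, hg'⟩ := h'
  exact ⟨g + g', (map_add _ _ _).symm, fun j => (hg j).add (hg' j)⟩

theorem OpRel.neg {q : ℤ} {P Q : OpCoeffs (RatEnd m W)} (h : OpRel q P Q) :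
    OpRel q (-P) (-Q) := by
  obtain ⟨g, rfl, hg⟩ := h
  exact ⟨-g, (map_neg _ _).symm, fun j => (hg j).neg⟩

theorem OpRel.zero (q : ℤ) : OpRel q (0 : OpCoeffs (RatEnd m W)) 0 :=
  ⟨0, (map_zero _).symm, fun _ => SymRel.zero _⟩

theorem OpRel.sum {ι : Type*} {q : ℤ} {s : Finset ι} {f g : ι → OpCoeffs (RatEnd m W)}
    (h : ∀ i ∈ s, OpRel q (f i) (g i)) : OpRel q (∑ i ∈ s, f i) (∑ i ∈ s, g i) := by
  classical
  induction s using Finset.induction_on with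
  | empty => exact OpRel.zero q
  | insert a s ha ih =>
    rw [Finset.sum_insert ha, Finset.sum_insert ha]
    exact (h a (Finset.mem_insert_self a s)).add
      (ih fun i hi => h i (Finset.mem_insert_of_mem hi))

theorem OpRel.mulSeries {q q' : ℤ} {f e : USeries (RatEnd m W)} {P Q : OpCoeffs (RatEnd m W)}
    (h : OpRel q P Q) (hf : SymRel q' f e) :
    OpRel (q' + q) (mulSeries f P) (mulSeries e Q) := by
  obtain ⟨g, rfl, hg⟩ := h
  refine ⟨BetheGaudin.mulSeries f g, mulSeries_dBasis f g, fun j => ?_⟩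
  have := hf.mul (hg j)
  rwa [← add_assoc] at this

/-- In `d f = f(u+1) d + (f(u+1) - f)` the leading parts of the two terms are `f ∂` and `f'`, the
two terms of the Leibniz rule, and both lie in degree one less than that of `f`. -/
theorem OpRel.dOp {q : ℤ} {P Q : OpCoeffs (RatEnd m W)} (h : OpRel q P Q) :
    OpRel (q - 1) (dOp P) (partialOp Q) := by
  obtain ⟨g, rfl, hg⟩ := h
  refine ⟨dStep g, dOp_dBasis g, fun j => ?_⟩
  have h1 : ∀ j : ℕ, SymRel (q - 1 + j) (shiftSeries 1 (g j) - g j) (derivSeries (Q j)) := by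
    intro j
    have := (hg j).shift_sub 1
    rwa [one_smul, show q + j - 1 = q - 1 + j by ring] at this
  cases j with
  | zero => rw [dStep_apply_zero, partialOp_apply_zero]; exact h1 0
  | succ j =>
    rw [dStep_apply_succ, partialOp_apply_succ]
    refine SymRel.add ?_ (h1 _)
    have := (hg j).shift 1
    rwa [show q + j = q - 1 + (j + 1 : ℕ) by push_cast; ring] at this

/-- Applied to `x`, the product acts by its last factor first, so the invariant `p` travels from
index `l` down to `0`. -/
theorem prod_ofFn_induction {M X : Type*} [Monoid M] [MulAction M X] (l : ℕ) (g : Fin l → M)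
    (p : ℕ → X → Prop) (hp : ∀ (i : Fin l) x, p (i + 1) x → p i (g i • x)) (x : X) (hx : p l x) :
    p 0 ((List.ofFn g).prod • x) := by
  induction l generalizing p with
  | zero => simpa using hx
  | succ l ih =>
    rw [List.ofFn_succ, List.prod_cons, mul_smul]
    exact hp 0 _ (ih (fun i => g i.succ) (fun t => p (t + 1)) (fun i x h => hp i.succ x h) hx)

/-- Each of the `n` factors in a summand lowers the degree by one, and leading parts compose; the
entries need not commute. -/
theorem opRel_columnDet {n : ℕ}
    {M N : Matrix (Fin n) (Fin n) (AddMonoid.End (OpCoeffs (RatEnd m W)))}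
    (h : ∀ i j q P Q, OpRel q P Q → OpRel (q - 1) (M i j P) (N i j Q)) :
    OpRel (-n) (ofLeftMul (columnDet M)) (ofLeftMul (columnDet N)) := by
  have hz : ∀ (z : ℤˣ) (q : ℤ) (P Q : OpCoeffs (RatEnd m W)), OpRel q P Q →
      OpRel q ((z : ℤ) • P) ((z : ℤ) • Q) := by
    intro z q P Q h
    rcases Int.units_eq_one_or z with rfl | rfl
    · simpa using h
    · simpa using h.neg
  rw [ofLeftMul, ofLeftMul, columnDet, columnDet, end_sum_apply, end_sum_apply]
  refine OpRel.sum fun σ _ => hz _ _ _ _ ?_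
  have h1 : ∀ (l : ℕ) (f g : Fin l → AddMonoid.End (OpCoeffs (RatEnd m W))),
      (∀ j q P Q, OpRel q P Q → OpRel (q - 1) (f j P) (g j Q)) →
      OpRel (-l) ((List.ofFn f).prod opOne) ((List.ofFn g).prod opOne) := by
    intro l
    induction l with
    | zero => intro f g _; simpa using opRel_opOne
    | succ l ih =>
      intro f g hfg
      rw [List.ofFn_succ, List.ofFn_succ, List.prod_cons, List.prod_cons]
      have := hfg 0 _ _ _ (ih (fun i => f i.succ) (fun i => g i.succ) fun j => hfg j.succ)
      rwa [show -(l : ℤ) - 1 = -((l + 1 : ℕ) : ℤ) by push_cast; ring] at this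
  exact h1 n _ _ fun j q P Q hPQ => h _ _ q P Q hPQ

/-- In `AA' - 1 = (A - 1)(A' - 1) + (A - 1) + (A' - 1)` the quadratic term has degree at most -2, so
products of matrices close to 1 have additive leading parts. -/
theorem symRel_matrix_mul {n : ℕ} {A a A' a' : Matrix (Fin n) (Fin n) (USeries (RatEnd m W))}
    (h : ∀ i j, SymRel (-1) ((A - 1) i j) (a i j))
    (h' : ∀ i j, SymRel (-1) ((A' - 1) i j) (a' i j)) (i j : Fin n) :
    SymRel (-1) ((A * A' - 1) i j) ((a + a') i j) := by
  have e : A * A' - 1 = (A - 1) * (A' - 1) + ((A - 1) + (A' - 1)) := by noncomm_ring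
  have h1 : SymRel (-1) (((A - 1) * (A' - 1)) i j) 0 := by
    rw [Matrix.mul_apply]
    have := (SymRel.sum fun k (_ : k ∈ Finset.univ) => (h i k).mul (h' k j)).weaken
      (q' := -1) (by norm_num)
    exact this
  have := h1.add ((h i j).add (h' i j))
  rw [zero_add] at this
  rw [e]
  exact this

/-- The ordered product degenerates to a sum, and the constants `b_k - k` in the evaluation
parameters drop out, leaving the poles at `ξ_k`. -/
theorem symRel_monodromy {n : ℕ} (b : Fin m → ℕ) (lam : Fin n → ℂ) (i j : Fin n) :
    SymRel (-1) ((monodromy b lam - 1) i j)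
      ((∑ k : Fin m, poleSeries (eFactor lam i j k) (ratVar k)) +
        poleSeries (eLast m lam i j) 0) := by
  have hprod : ∀ (l : ℕ) (A a : Fin l → Matrix (Fin n) (Fin n)
      (USeries (RatEnd m (SymVerma m lam)))),
      (∀ k i j, SymRel (-1) ((A k - 1) i j) (a k i j)) →
      ∀ i j, SymRel (-1) (((List.ofFn A).prod - 1) i j) ((∑ k, a k) i j) := by
    intro l
    induction l with
    | zero =>
      intro A a _ i j
      simpa using SymRel.zero (m := m) (W := SymVerma m lam) (-1)
    | succ l ih =>
      intro A a h i j
      rw [List.ofFn_succ, List.prod_cons, Fin.sum_univ_succ]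
      exact symRel_matrix_mul (h 0) (ih _ _ fun k => h k.succ) i j
  have h1 := hprod m (fun k => 1 + Matrix.of fun i j => poleSeries (eFactor lam i j k) (wParam b k))
    (fun k => Matrix.of fun i j => poleSeries (eFactor lam i j k) (ratVar k)) (fun k i j => by
      rw [add_sub_cancel_left]
      exact symRel_poleSeries _ (degLE_wParam b k) (scaleCoeff_wParam b k))
  have h2 : ∀ i j, SymRel (-1) (((1 + Matrix.of fun i j => poleSeries (eLast m lam i j) 0) - 1 :
      Matrix (Fin n) (Fin n) (USeries (RatEnd m (SymVerma m lam)))) i j)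
      ((Matrix.of fun i j => poleSeries (eLast m lam i j) (0 : RatFun m) :
      Matrix (Fin n) (Fin n) (USeries (RatEnd m (SymVerma m lam)))) i j) := fun i j => by
    rw [add_sub_cancel_left]
    exact symRel_poleSeries _ (fun N _ => by rw [map_zero, HahnSeries.coeff_zero])
      (map_zero _)
  have := symRel_matrix_mul h1 h2 i j
  rw [Matrix.add_apply, Matrix.sum_apply] at this
  exact this

theorem opRel_bethe {n : ℕ} (b : Fin m → ℕ) (lam : Fin n → ℂ) :
    OpRel (-n) (betheDifference b lam) (gaudinDifferential m lam) := by
  refine opRel_columnDet fun i j q P Q hPQ => ?_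
  have hT := (symRel_monodromy b lam i j).shift (-(j : ℤ))
  have h2 := hPQ.mulSeries hT
  rw [show -1 + q = q - 1 by ring] at h2
  simp only [Matrix.of_apply]
  have hs : shiftSeries (-(j : ℤ)) ((monodromy b lam - 1) i j) =
      shiftSeries (-(j : ℤ)) (monodromy b lam i j) - if i = j then 1 else 0 := by
    rw [Matrix.sub_apply, Matrix.one_apply, map_sub]
    congr 1
    split_ifs
    exacts [map_one (shiftHom _), map_zero _]
  rw [hs] at h2
  by_cases hij : i = j
  · rw [if_pos hij, mulSeries_sub, mulSeries_one] at h2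
    rw [if_pos hij, if_pos hij]
    rw [end_sub_apply, end_sub_apply, sub_eq_add_neg (partialOp Q)]
    have := hPQ.dOp.add h2.neg
    rw [end_sub_apply, dOp_apply, neg_sub] at this
    -- On the diagonal, `τ - t = d - (t - 1)`, where both terms lower the degree by one.
    have e : tauOp P - P + (P - mulSeries (shiftSeries (-(j : ℤ)) (monodromy b lam i j)) P) =
      tauOp P - mulSeries (shiftSeries (-(j : ℤ)) (monodromy b lam i j)) P := by abel
    rw [← e]
    exact this
  · rw [if_neg hij, sub_zero] at h2
    rw [if_neg hij, if_neg hij, end_sub_apply, end_sub_apply]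
    have := (OpRel.zero (q - 1)).add h2.neg
    rw [← sub_eq_add_neg, ← sub_eq_add_neg] at this
    exact this

end OperatorSymbols

end

end BetheGaudin

namespace BetheGaudin

noncomputable section

/-! ### Expansions in powers of `d` and `u + m` -/

section Expansion

/-- Since `τ = d + 1`, the property passes from `x` to `τ x`, hence holds for every `τ^k`; left
multiplication by series does the rest. -/
theorem dBasis_dCoeffs {B : Type*} [Ring B] (x : OpCoeffs B) : dBasis (dCoeffs x) = x := by
  have htau : ∀ x : OpCoeffs B, dBasis (dCoeffs x) = x → dBasis (dCoeffs (tauOp x)) = tauOp x := by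
    intro x hx
    have e : tauOp x = dOp x + x := by rw [dOp_apply]; abel
    rw [e, map_add, map_add, dCoeffs_dOp, ← dOp_dBasis, hx]
  have hpow : ∀ k, dBasis (dCoeffs (Finsupp.single k (1 : USeries B))) = Finsupp.single k 1 := by
    intro k
    induction k with
    | zero =>
      have := dCoeffs_dOp_pow (B := B) 0
      rw [pow_zero] at this
      change dBasis (dCoeffs opOne) = opOne
      change dCoeffs opOne = _ at this
      rw [this, dBasis_single, mulSeries_one]
      rfl
    | succ k ih =>
      have := htau _ ih
      rwa [tauOp_single, show shiftSeries 1 (1 : USeries B) = 1 from map_one (shiftHom 1)] at this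
  induction x using Finsupp.induction_linear with
  | zero => simp
  | add x y hx hy => rw [map_add, map_add, hx, hy]
  | single k f =>
    have e : Finsupp.single k f = mulSeries f (Finsupp.single k 1) := by
      rw [mulSeries_single, mul_one]
    rw [e, mulSeries_dCoeffs, ← mulSeries_dBasis, hpow]

variable {m : ℕ} {W : Type*} [AddCommGroup W] [Module ℂ W]

theorem opRel_iff {q : ℤ} {P Q : OpCoeffs (RatEnd m W)} :
    OpRel q P Q ↔ ∀ j : ℕ, SymRel (q + j) (dCoeffs P j) (Q j) := by
  constructor
  · rintro ⟨g, rfl, hg⟩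
    rwa [dCoeffs_dBasis]
  · intro h
    exact ⟨dCoeffs P, (dBasis_dCoeffs P).symm, h⟩

/-- The change from powers of `τ` to powers of `d` has integer coefficients, so it commutes with
additive maps applied to the coefficients. -/
theorem OpRel.mapRange {W' : Type*} [AddCommGroup W'] [Module ℂ W'] {q : ℤ}
    {P Q : OpCoeffs (RatEnd m W)} (h : OpRel q P Q)
    (φ : Module.End ℂ W →ₗ[ℂ] Module.End ℂ W')
    {P' Q' : OpCoeffs (RatEnd m W')}
    (hP : ∀ k, P' k = mapSeries (LinearMap.lTensor (RatFun m) φ).toAddMonoidHom (P k))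
    (hQ : ∀ k, Q' k = mapSeries (LinearMap.lTensor (RatFun m) φ).toAddMonoidHom (Q k)) :
    OpRel q P' Q' := by
  rw [opRel_iff] at h ⊢
  intro j
  have := (h j).mapSeries φ
  rw [hQ]
  convert this using 1
  obtain ⟨n, hn⟩ : ∃ n : ℕ, ∀ k > n, P k = 0 := by
    refine ⟨P.support.sup id, fun k hk => ?_⟩
    by_contra hne
    exact absurd (Finset.le_sup (f := id) (Finsupp.mem_support_iff.mpr hne)) (not_le.mpr hk)
  rw [dCoeffs_apply P j hn, dCoeffs_apply P' j (n := n) (fun k hk => by rw [hP, hn k hk, map_zero]),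
    map_sum]
  exact Finset.sum_congr rfl fun k _ => by rw [map_nsmul, hP]

theorem SymRel.scalar_prod {ι : Type*} {q : ℤ} (s : Finset ι) {f g : ι → USeries (RatFun m)}
    (h : ∀ i ∈ s, SymRel q (scalarHom m W (f i)) (scalarHom m W (g i))) :
    SymRel (s.card * q) (scalarHom m W (∏ i ∈ s, f i)) (scalarHom m W (∏ i ∈ s, g i)) := by
  classical
  induction s using Finset.induction_on with
  | empty =>
    have := SymRel.one (m := m) (W := W)
    simpa using this
  | insert a s ha ih =>
    rw [Finset.prod_insert ha, Finset.prod_insert ha, map_mul, map_mul, Finset.card_insert_of_notMem ha]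
    have := (h a (Finset.mem_insert_self a s)).mul
      (ih fun i hi => h i (Finset.mem_insert_of_mem hi))
    rwa [show q + s.card * q = ((s.card + 1 : ℕ) : ℤ) * q by push_cast; ring] at this

theorem degLE_one_const (c : ℂ) : DegLE (algebraMap ℂ (RatFun m) c) 1 :=
  (degLE_const c).mono (by norm_num)

theorem scaleCoeff_one_const (c : ℂ) : scaleCoeff m 1 (algebraMap ℂ (RatFun m) c) = 0 :=
  scaleCoeff_eq_zero (degLE_const c) (by norm_num)

/-- `(u - n + 1)(u - n + 2) ⋯ (u - n + j)`. -/
def risingDen (m n j : ℕ) : USeries (RatFun m) :=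
  ∏ t ∈ Finset.range j, (uVar - (n : USeries (RatFun m)) + 1 + (t : USeries (RatFun m)))

theorem risingDen_eq (m n j : ℕ) : risingDen m n j =
    ∏ t ∈ Finset.range j, (uVar - HahnSeries.C (algebraMap ℂ (RatFun m) ((n : ℂ) - 1 - t))) := by
  refine Finset.prod_congr rfl fun t _ => ?_
  simp only [map_sub, map_natCast, map_one]
  ring

theorem risingDen_ne_zero (m n j : ℕ) : risingDen m n j ≠ 0 := by
  rw [risingDen_eq]
  exact Finset.prod_ne_zero_iff.mpr fun t _ => uVar_sub_C_ne_zero _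

theorem prod_range_sub_eq (m : ℕ) {n k : ℕ} (hk : k ≤ n) :
    ∏ t ∈ Finset.range n, (uVar - (t : USeries (RatFun m))) =
      (∏ t ∈ Finset.range (n - k), (uVar - (t : USeries (RatFun m)))) * risingDen m n k := by
  obtain ⟨a, rfl⟩ := Nat.exists_eq_add_of_le' hk
  -- The last `k` factors of `u(u-1)⋯(u-n+1)`, in reverse order, are `u-n+1, …, u-n+k`.
  rw [Nat.add_sub_cancel, Finset.prod_range_add, risingDen,
    ← Finset.prod_range_reflect fun t => uVar - ((a + t : ℕ) : USeries (RatFun m))]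
  congr 1
  refine Finset.prod_congr rfl fun t ht => ?_
  have := Finset.mem_range.mp ht
  rw [show a + (k - 1 - t) = a + k - 1 - t by omega, Nat.cast_sub (by omega),
    Nat.cast_sub (by omega)]
  push_cast
  ring

theorem scalarHom_mem_poly {f : USeries (RatFun m)} (hf : f ∈ polySubring (RatFun m)) :
    scalarHom m W f ∈ polySubring (RatEnd m W) := mapSeriesHom_mem_poly _ hf

theorem scalarHom_mem_coeffSubring (S : Subalgebra (RatFun m) (RatEnd m W))
    (f : USeries (RatFun m)) : scalarHom m W f ∈ coeffSubring S.toSubring := fun N => by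
  rw [scalarHom_coeff]
  exact S.algebraMap_mem (f.coeff N)

-- The algebra common to all operators with the right leading part and the right poles: the relation
-- separates into one polynomial identity in `u` for each power of `d`, whose coefficients are
-- unique, lie in `S`, and inherit degree and leading part.
set_option maxHeartbeats 1000000 in
theorem expansion_and_leading {n : ℕ} (w : Fin m → RatFun m) (hw : ∀ k, DegLE (w k) 1)
    (hw' : ∀ k, scaleCoeff m 1 (w k) = ratVar k)
    {P Q : OpCoeffs (RatEnd m W)} (hPQ : OpRel (-n) P Q)
    (hpoly : ∀ k ≤ n, scalarHom m W ((∏ t ∈ Finset.range (n - k),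
      (uVar - (t : USeries (RatFun m)))) * ∏ k, (uVar - HahnSeries.C (w k))) * P k ∈
        polySubring (RatEnd m W))
    (hvan : ∀ k > n, P k = 0)
    (S : Subalgebra (RatFun m) (RatEnd m W)) (hS : ∀ k N, (P k).coeff N ∈ S)
    {Exp : (Fin (m + 1) → Fin (n + 1) → RatEnd m W) → Prop}
    (hExp : ∀ (C : Fin (m + 1) → Fin (n + 1) → RatEnd m W), Exp C ↔ mulSeries (scalarHom m W ((∏ t ∈ Finset.range n,
      (uVar - (t : USeries (RatFun m)))) * ∏ k, (uVar - HahnSeries.C (w k)))) P =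
    ∑ i : Fin (m + 1), ∑ j : Fin (n + 1), mulSeries (HahnSeries.C (C i j) *
      scalarHom m W ((uVar + (m : USeries (RatFun m))) ^ (i : ℕ) * risingDen m n j))
      ((dOp ^ (j : ℕ)) opOne)) :
    (∃ (C : Fin (m + 1) → Fin (n + 1) → RatEnd m W), Exp C ∧ ∀ i j, C i j ∈ S) ∧
    ∀ C : Fin (m + 1) → Fin (n + 1) → RatEnd m W, Exp C →
      (∀ (i : Fin (m + 1)) (j : Fin (n + 1)), C i j ∈
        filtration (m := m) (W := Module.End ℂ W) ((m : ℤ) - (i : ℕ))) ∧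
      ∑ i : Fin (m + 1), ∑ j : Fin (n + 1), mulSeries
          (HahnSeries.C (grade ((m : ℤ) - (i : ℕ)) (C i j)) * (uVar : USeries (RatEnd m W)) ^ ((i : ℕ) + (j : ℕ)))
          ((partialOp ^ (j : ℕ)) opOne) =
        mulSeries (scalarHom m W (uVar ^ n * ∏ k, (uVar - HahnSeries.C (ratVar k)))) Q := by
  set Z := scalarHom m W with hZ
  set V : USeries (RatFun m) := ∏ k, (uVar - HahnSeries.C (w k)) with hV
  set V' : USeries (RatFun m) := ∏ k, (uVar - HahnSeries.C (ratVar k)) with hV'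
  set F : USeries (RatFun m) := (∏ t ∈ Finset.range n, (uVar - (t : USeries (RatFun m)))) * V
    with hF
  set G := dCoeffs P with hG
  -- The coefficient of `d^j` on the left side of the relation, divided by `(u-n+1)⋯(u-n+j)`. The
  -- relation says that `h j` expands in powers of `u + m` with coefficients `C i j`.
  let h : ℕ → USeries (RatEnd m W) := fun j => Z (F * (risingDen m n j)⁻¹) * G j
  have hh : ∀ j, Z (risingDen m n j) * h j = Z F * G j := fun j => by
    rw [← mul_assoc, ← map_mul]
    congr 2
    field_simp [risingDen_ne_zero m n j]
  have hcancel : ∀ j (x y : USeries (RatEnd m W)),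
      Z (risingDen m n j) * x = Z (risingDen m n j) * y → x = y := by
    intro j x y hxy
    have := congrArg (fun z => Z (risingDen m n j)⁻¹ * z) hxy
    simp only [← mul_assoc, ← map_mul, inv_mul_cancel₀ (risingDen_ne_zero m n j)] at this
    simpa using this
  -- the relation in terms of the coefficients of the powers of `d`
  have hExp' : ∀ (C : Fin (m + 1) → Fin (n + 1) → RatEnd m W), Exp C ↔ ∀ j : Fin (n + 1), h j = ∑ i : Fin (m + 1),
      HahnSeries.C (C i j) * (uVar + (m : USeries (RatEnd m W))) ^ (i : ℕ) := by
    intro C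
    have hZu : ∀ i : ℕ, Z ((uVar + (m : USeries (RatFun m))) ^ i) =
        (uVar + (m : USeries (RatEnd m W))) ^ i := fun i => by
      rw [map_pow, map_add, map_natCast, hZ, scalarHom, mapSeriesHom_uVar]
    have hR : ∀ l : Fin (n + 1), dCoeffs (∑ i : Fin (m + 1), ∑ j : Fin (n + 1),
        mulSeries (HahnSeries.C (C i j) *
          Z ((uVar + (m : USeries (RatFun m))) ^ (i : ℕ) * risingDen m n j))
          ((dOp ^ (j : ℕ)) opOne)) l = Z (risingDen m n l) * ∑ i : Fin (m + 1),
      HahnSeries.C (C i l) * (uVar + (m : USeries (RatEnd m W))) ^ (i : ℕ) := by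
      intro l
      simp only [map_sum, Finsupp.finsetSum_apply, mulSeries_dCoeffs, dCoeffs_dOp_pow,
        mulSeries_single, mul_one, Finsupp.single_apply, Fin.val_inj]
      rw [Finset.mul_sum]
      refine Finset.sum_congr rfl fun i _ => ?_
      rw [Finset.sum_ite_eq' Finset.univ l, if_pos (Finset.mem_univ l), ← hZu, map_mul]
      rw [((commute_scalarHom _ _).eq : Z (risingDen m n l) * _ = _), mul_assoc]
    have hR0 : ∀ l > n, dCoeffs (∑ i : Fin (m + 1), ∑ j : Fin (n + 1),
        mulSeries (HahnSeries.C (C i j) *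
          Z ((uVar + (m : USeries (RatFun m))) ^ (i : ℕ) * risingDen m n j))
          ((dOp ^ (j : ℕ)) (opOne : OpCoeffs (RatEnd m W)))) l = 0 := by
      intro l hl
      simp only [map_sum, Finsupp.finsetSum_apply, mulSeries_dCoeffs, dCoeffs_dOp_pow,
        mulSeries_single, mul_one, Finsupp.single_apply]
      refine Finset.sum_eq_zero fun i _ => Finset.sum_eq_zero fun j _ => if_neg ?_
      have := j.2
      omega
    rw [hExp]
    constructor
    · intro e j
      apply hcancel j
      rw [hh, ← hR, ← e, mulSeries_dCoeffs, mulSeries_apply]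
    -- Operators with equal coefficients in powers of `d` are equal.
    · intro e
      refine Function.LeftInverse.injective (g := dBasis) dBasis_dCoeffs ?_
      ext1 l
      by_cases hl : l ≤ n
      · have := hR ⟨l, by omega⟩
        simp only at this
        rw [this, ← e ⟨l, by omega⟩, hh, mulSeries_dCoeffs, mulSeries_apply]
      · rw [hR0 l (by omega), mulSeries_dCoeffs, mulSeries_apply, dCoeffs_apply P l hvan,
          Finset.sum_eq_zero, mul_zero]
        intro k hk
        rw [Nat.choose_eq_zero_of_lt (by have := Finset.mem_range.mp hk; omega), zero_smul]
  -- polynomiality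
  have hVpoly : ∀ (s : Finset ℕ), ∏ t ∈ s, (uVar - HahnSeries.C (algebraMap ℂ (RatFun m)
      ((n : ℂ) - 1 - t))) ∈ polySubring (RatFun m) := fun s =>
    prod_mem fun t _ => sub_mem uVar_mem_poly (C_mem_poly _)
  have hhpoly : ∀ j, h j ∈ polySubring (RatEnd m W) := by
    intro j
    have e : h j = ∑ k ∈ Finset.range (n + 1), k.choose j • (Z (F * (risingDen m n j)⁻¹) * P k) := by
      simp only [h, hG, dCoeffs_apply P j hvan, Finset.mul_sum, mul_smul_comm]
    rw [e]
    refine sum_mem fun k hk => ?_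
    have hk' : k ≤ n := by have := Finset.mem_range.mp hk; omega
    rcases lt_or_ge k j with hkj | hkj
    · rw [Nat.choose_eq_zero_of_lt hkj, zero_smul]; exact zero_mem _
    · refine nsmul_mem ?_ _
      -- For `k ≥ j`, dividing by `risingDen m n j` still leaves the factors that clear the poles of
      -- `P k`, together with the linear factors of index `j, …, k - 1`.
      have e1 : risingDen m n k = (∏ t ∈ Finset.Ico j k, (uVar - HahnSeries.C (algebraMap ℂ (RatFun m)
          ((n : ℂ) - 1 - t)))) * risingDen m n j := by
        rw [risingDen_eq, risingDen_eq, mul_comm, Finset.prod_range_mul_prod_Ico _ hkj]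
      have e2 : F * (risingDen m n j)⁻¹ = (∏ t ∈ Finset.Ico j k, (uVar - HahnSeries.C
          (algebraMap ℂ (RatFun m) ((n : ℂ) - 1 - t)))) *
          ((∏ t ∈ Finset.range (n - k), (uVar - (t : USeries (RatFun m)))) * V) := by
        rw [hF, prod_range_sub_eq m hk', e1]
        field_simp [risingDen_ne_zero m n j]
      rw [e2, map_mul, mul_assoc]
      exact mul_mem (scalarHom_mem_poly (hVpoly _)) (hpoly k hk')
  -- leading parts
  let s : ℕ → USeries (RatEnd m W) := fun j => Z (uVar ^ n * V' * (uVar ^ j)⁻¹) * Q j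
  have hsym : ∀ j, SymRel m (h j) (s j) := by
    intro j
    have h1 := SymRel.scalar_prod (m := m) (W := W) (Finset.range n)
      fun t _ => symRel_uVar_sub_C (W := W) (degLE_one_const (m := m) (t : ℂ))
        (scaleCoeff_one_const _)
    have h2 := SymRel.scalar_prod (m := m) (W := W) Finset.univ
      fun k _ => symRel_uVar_sub_C (W := W) (hw k) (hw' k)
    have h3 := SymRel.scalar_prod (m := m) (W := W) (Finset.range j)
      fun t _ => symRel_inv_uVar_sub_C (W := W) (degLE_one_const (m := m) ((n : ℂ) - 1 - t))
        (scaleCoeff_one_const _)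
    have h4 := ((h1.mul h2).mul h3).mul (opRel_iff.mp hPQ j)
    rw [← map_mul, ← map_mul, ← map_mul, ← map_mul, Finset.prod_inv_distrib, ← risingDen_eq] at h4
    simp only [map_zero, sub_zero, Finset.prod_const, Finset.card_range, Finset.card_univ,
      Fintype.card_fin, map_natCast, inv_pow] at h4
    -- The degrees are `n` from `u⋯(u-n+1)`, `m` from the factors `u - w_k`, `-j` from the divisor
    -- and `-n + j` from the coefficient of `d^j`; `n` and `j` cancel.
    rw [show (n : ℤ) * 1 + m * 1 + j * -1 + (-n + j) = m by ring] at h4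
    exact h4
  -- Coefficients in powers of `u + m` are those of `h_j(u - m)` in powers of `u`; the shift does
  -- not affect leading parts.
  have hshift : ∀ j, SymRel m (shiftSeries (-m) (h j)) (s j) := fun j => (hsym j).shift _
  have hum : shiftHom (-m : ℤ) (uVar + (m : USeries (RatEnd m W))) = uVar := by
    rw [map_add, shiftHom_uVar, map_natCast]
    push_cast
    abel
  have hum' : shiftHom (m : ℤ) (uVar : USeries (RatEnd m W)) =
      uVar + (m : USeries (RatEnd m W)) := by
    rw [shiftHom_uVar, Int.cast_natCast]
  refine ⟨⟨fun i j => (shiftSeries (-m) (h j)).coeff (-((i : ℕ) : ℤ)), ?_, ?_⟩, ?_⟩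
  · rw [hExp']
    intro j
    have hord := (hshift j).ordGE
    have hpol := shift_mem_poly (hhpoly j) (-m)
    have e1 := congrArg (shiftHom (m : ℤ)) (eq_sum_of_mem_poly hpol hord)
    -- The two opposite shifts cancel on `h j`. This is read off from its expansion in `u`, since
    -- the shifts are ring homomorphisms fixing constants.
    have e2 := congrArg (fun f => shiftHom (m : ℤ) (shiftHom (-m : ℤ) f))
      (eq_sum_of_mem_poly (hhpoly j) (hsym j).ordGE)
    have hback : shiftHom (m : ℤ) (shiftHom (-m : ℤ) (uVar : USeries (RatEnd m W))) = uVar := by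
      rw [shiftHom_uVar, map_add, hum', map_intCast]
      push_cast
      abel
    simp only [map_sum, map_mul, map_pow, shiftHom_C, hback] at e2
    rw [← eq_sum_of_mem_poly (hhpoly j) (hsym j).ordGE] at e2
    simp only [map_sum, map_mul, map_pow, shiftHom_C, hum'] at e1
    rw [← e1]
    exact e2.symm
  · intro i j
    have hP : ∀ k, P k ∈ coeffSubring S.toSubring := fun k N => hS k N
    have : h j ∈ coeffSubring S.toSubring := by
      refine mul_mem (scalarHom_mem_coeffSubring S _) ?_
      rw [hG, dCoeffs_apply P j hvan]
      exact sum_mem fun k _ => nsmul_mem (hP k) _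
    exact shift_mem_coeffSubring this _ _
  · intro C hC
    rw [hExp'] at hC
    have hCj : ∀ i j, C i j = (shiftSeries (-m) (h j)).coeff (-((i : ℕ) : ℤ)) := by
      intro i j
      have := congrArg (shiftHom (-m : ℤ)) (hC j)
      simp only [map_sum, map_mul, map_pow, shiftHom_C, hum] at this
      rw [shiftHom_apply] at this
      rw [this, coeff_sum_C_mul_uVar_pow (fun i => C i j)]
    have hgr : ∀ (i : Fin (m + 1)) (j : Fin (n + 1)),
        GrRel ((m : ℤ) - (i : ℕ)) (C i j) ((s j).coeff (-((i : ℕ) : ℤ))) := by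
      intro i j
      have := (hshift j).2 (-((i : ℕ) : ℤ))
      rwa [← hCj, neg_add_eq_sub] at this
    refine ⟨fun i j => (hgr i j).1, ?_⟩
    -- The leading part of a polynomial in `u` is one: it is taken coefficient by coefficient.
    have hspoly : ∀ j, s j ∈ polySubring (RatEnd m W) := fun j N hN => by
      rw [← ((hsym j).2 N).2, hhpoly j N hN, map_zero]
    ext1 l
    simp only [Finsupp.finsetSum_apply, partialOp_pow, mulSeries_single, mul_one,
      Finsupp.single_apply, mulSeries_apply]
    by_cases hl : l ≤ n
    · have e1 : Z (uVar ^ n * V') * Q l = s l * uVar ^ l := by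
        have hu : (uVar : USeries (RatEnd m W)) ^ l = Z (uVar ^ l) := by
          rw [map_pow, hZ, scalarHom, mapSeriesHom_uVar]
        have hu0 : (uVar : USeries (RatFun m)) ^ l ≠ 0 := by
          have := uVar_sub_C_ne_zero (K := RatFun m) 0
          rw [map_zero, sub_zero] at this
          exact pow_ne_zero _ this
        rw [hu, ← ((commute_scalarHom _ _).eq : Z (uVar ^ l) * s l = _), ← mul_assoc, ← map_mul]
        congr 2
        field_simp
      rw [e1]
      have e2 := eq_sum_of_mem_poly (hspoly l) (hsym l).ordGE_right
      rw [e2, Finset.sum_mul]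
      refine Finset.sum_congr rfl fun i _ => ?_
      rw [Finset.sum_eq_single (⟨l, by omega⟩ : Fin (n + 1))]
      · rw [if_pos rfl, (hgr i ⟨l, by omega⟩).2, pow_add, mul_assoc]
      · intro j _ hj
        rw [if_neg]
        intro h'
        exact hj (Fin.ext h')
      · exact fun h' => absurd (Finset.mem_univ _) h'
    -- Beyond order `n` the coefficient of `d^l` in `P` is zero, hence so is its leading part.
    · have hQ : Q l = 0 := by
        have h1 := opRel_iff.mp hPQ l
        rw [dCoeffs_apply P l hvan, Finset.sum_eq_zero] at h1
        · exact h1.unique (SymRel.zero _)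
        · intro k hk
          rw [Nat.choose_eq_zero_of_lt (by have := Finset.mem_range.mp hk; omega), zero_smul]
      rw [hQ, mul_zero]
      refine Finset.sum_eq_zero fun i _ => Finset.sum_eq_zero fun j _ => if_neg ?_
      have := j.2
      omega

end Expansion

end

end BetheGaudin

namespace BetheGaudin

noncomputable section

/-! ### Anticommuting variables and column determinants -/

section Grassmann

variable {U : Type*} [Ring U] {n : ℕ}

/-- For the evaluation module `ℂ[x₁, …, xₙ]` of the Yangian, multiplication by the Grassmann
combinations of the columns of `1 + x ∂ᵗ / v` is intertwined with multiplication by the Grassmann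
variables by means of `1 + X Δ / v`. -/
theorem grassmann_intertwine {ψ ι x d : Fin n → U} {y y' : U} (hy : ∀ z, Commute y z)
    (hy' : ∀ z, Commute y' z) (hyy : y' - y = y * y')
    (hψ : ∀ i j, ψ i * ψ j = -(ψ j * ψ i)) (hψ0 : ∀ i, ψ i * ψ i = 0)
    (hιψ : ∀ i j, ι i * ψ j = (if i = j then 1 else 0) - ψ j * ι i)
    (hxψ : ∀ i j, Commute (x i) (ψ j)) (hdψ : ∀ i j, Commute (d i) (ψ j))
    (hxx : ∀ i j, Commute (x i) (x j))
    (hdx : ∀ i j, d i * x j = x j * d i + if i = j then 1 else 0) (c : Fin n) :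
    (∑ i, ψ i * ((if i = c then 1 else 0) + x i * d c * y)) *
        (1 + y' * ((∑ i, ψ i * x i) * ∑ j, d j * ι j)) =
      (1 + y * ((∑ i, ψ i * x i) * ∑ j, d j * ι j)) * ψ c := by
  set X := ∑ i, ψ i * x i with hX
  set Δ := ∑ j, d j * ι j with hΔ
  -- Swapping the two indices pairs off terms of opposite sign, because the `ψ` anticommute and the
  -- `x` commute; the diagonal terms vanish by `ψ_i² = 0`.
  have hXX : X * X = 0 := by
    rw [hX, Finset.sum_mul_sum, ← Finset.sum_product']
    refine Finset.sum_involution (fun p _ => (p.2, p.1)) ?_ ?_ (fun _ _ => Finset.mem_univ _)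
      (fun _ _ => rfl)
    · rintro ⟨i, j⟩ _
      have h : ∀ i j, ψ i * x i * (ψ j * x j) = ψ i * ψ j * (x i * x j) := fun i j => by
        rw [mul_assoc, ← mul_assoc (x i), (hxψ i j).eq]
        simp only [mul_assoc]
      simp only [h]
      rw [hψ i j, (hxx i j).eq, neg_mul, neg_add_cancel]
    · rintro ⟨i, j⟩ _ h1 h2
      simp only [Prod.mk.injEq] at h2
      obtain ⟨rfl, -⟩ := h2
      apply h1
      simp only
      rw [mul_assoc, ← mul_assoc (x _), (hxψ _ _).eq, mul_assoc, ← mul_assoc (ψ _), hψ0, zero_mul]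
  have hdX : d c * X = X * d c + ψ c := by
    rw [hX, Finset.mul_sum, Finset.sum_mul]
    have : ∀ i, d c * (ψ i * x i) = ψ i * x i * d c + if c = i then ψ i else 0 := fun i => by
      rw [← mul_assoc, (hdψ c i).eq, mul_assoc, hdx, mul_add, ← mul_assoc]
      split_ifs <;> simp
    simp only [this, Finset.sum_add_distrib, Finset.sum_ite_eq, Finset.mem_univ, if_true]
  have hXψ : X * ψ c = -(ψ c * X) := by
    rw [hX, Finset.mul_sum, Finset.sum_mul, ← Finset.sum_neg_distrib]
    refine Finset.sum_congr rfl fun i _ => ?_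
    rw [mul_assoc, (hxψ i c).eq, ← mul_assoc, hψ i c, neg_mul, mul_assoc]
  have hΔψ : Δ * ψ c = d c - ψ c * Δ := by
    rw [hΔ, Finset.mul_sum, Finset.sum_mul]
    have : ∀ j, d j * ι j * ψ c = (if j = c then d j else 0) - ψ c * (d j * ι j) := fun j => by
      rw [mul_assoc, hιψ, mul_sub, ← mul_assoc, (hdψ j c).eq, mul_assoc]
      split_ifs <;> simp
    simp only [this, Finset.sum_sub_distrib, Finset.sum_ite_eq', Finset.mem_univ, if_true]
  have h1 : ∑ i, ψ i * ((if i = c then 1 else 0) + x i * d c * y) = ψ c + y * (X * d c) := by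
    have : ∀ i, ψ i * ((if i = c then 1 else 0) + x i * d c * y) =
        (if i = c then ψ i else 0) + y * (ψ i * x i * d c) := fun i => by
      rw [mul_add, ← (hy _).eq, ← mul_assoc, ← (hy _).eq]
      split_ifs <;> simp [mul_assoc]
    simp only [this, Finset.sum_add_distrib, Finset.sum_ite_eq', Finset.mem_univ, if_true,
      ← Finset.mul_sum, hX, Finset.sum_mul]
  -- Moving `d c` past `X` leaves only `ψ c`, since the other term contains `X * X = 0`.
  have h2 : y * (X * d c) * (y' * (X * Δ)) = -(y * y' * (ψ c * (X * Δ))) := by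
    rw [mul_assoc, ← mul_assoc (X * d c), ← (hy' (X * d c)).eq, mul_assoc y', mul_assoc X,
      ← mul_assoc (d c), hdX, add_mul, mul_add, mul_assoc X (d c), ← mul_assoc X X, hXX, zero_mul,
      zero_add, ← mul_assoc X, hXψ]
    simp only [neg_mul, mul_neg, mul_assoc]
  have h3 : ψ c * (y' * (X * Δ)) = y' * (ψ c * (X * Δ)) := by
    rw [← mul_assoc, ← (hy' (ψ c)).eq, mul_assoc]
  -- For `y = 1/v` and `y' = 1/(v - 1)` this is partial fractions; it absorbs the pole at the
  -- shifted point into the one at `v`.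
  have h4 : y' = y + y * y' := by rw [← hyy]; abel
  rw [h1, mul_add, mul_one, add_mul, h2, h3, add_mul, one_mul, mul_assoc y (X * Δ), mul_assoc X, hΔψ,
    mul_sub, ← mul_assoc X (ψ c), hXψ]
  have h5 : y' * (ψ c * (X * Δ)) = y * (ψ c * (X * Δ)) + y * y' * (ψ c * (X * Δ)) := by
    conv_lhs => rw [h4]
    rw [add_mul]
  rw [h5, neg_mul, sub_neg_eq_add, mul_add, mul_assoc (ψ c)]
  abel

theorem commute_prod_ofFn {l : ℕ} {A : Fin l → Matrix (Fin n) (Fin n) U} {y : U}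
    (h : ∀ k i j, Commute (A k i j) y) (i j : Fin n) : Commute ((List.ofFn A).prod i j) y := by
  induction l generalizing i j with
  | zero =>
    rw [List.ofFn_zero, List.prod_nil, Matrix.one_apply]
    split_ifs
    exacts [Commute.one_left _, Commute.zero_left _]
  | succ l ih =>
    rw [List.ofFn_succ, List.prod_cons, Matrix.mul_apply]
    exact Commute.sum_left _ _ _ fun k _ => (h 0 i k).mul_left (ih (fun k => h k.succ) k j)

/-- Each intertwiner passes the later matrices freely and meets its own, which it replaces by the
bare Grassmann variables; these then form the column combination for the next matrix. -/
theorem grassmann_intertwine_prod {m : ℕ} {ψ : Fin n → U}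
    {A : Fin m → Matrix (Fin n) (Fin n) U} {L L' : Fin m → U} {A₀ : Matrix (Fin n) (Fin n) U}
    (hA : ∀ k c, (∑ i, ψ i * A k i c) * L' k = L k * ψ c)
    (hAL : ∀ k l i j, k ≠ l → Commute (A l i j) (L' k))
    (hA₀ : ∀ k i j, Commute (A₀ i j) (L' k)) (c : Fin n) :
    (∑ i, ψ i * ((List.ofFn A).prod * A₀) i c) * (List.ofFn L').prod =
      (List.ofFn L).prod * ∑ i, ψ i * A₀ i c := by
  induction m with
  | zero => simp
  | succ m ih =>
    rw [List.ofFn_succ, List.ofFn_succ, List.ofFn_succ, List.prod_cons, List.prod_cons,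
      List.prod_cons]
    have ih' := ih (A := fun k => A k.succ) (L := fun k => L k.succ) (L' := fun k => L' k.succ)
      (fun k => hA k.succ) (fun k l i j h => hAL k.succ l.succ i j (by simpa using h))
      (fun k => hA₀ k.succ)
    set R := (List.ofFn fun k : Fin m => A k.succ).prod * A₀ with hR
    have hRL : ∀ i j, Commute (R i j) (L' 0) := fun i j => by
      rw [hR, Matrix.mul_apply]
      exact Commute.sum_left _ _ _ fun k _ => (commute_prod_ofFn (fun l i j =>
        hAL 0 l.succ i j (Fin.succ_ne_zero l).symm) i k).mul_left (hA₀ 0 k j)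
    have h1 : (∑ i, ψ i * (A 0 * (List.ofFn fun k : Fin m => A k.succ).prod * A₀) i c) * L' 0 =
        L 0 * ∑ e, ψ e * R e c := by
      rw [mul_assoc (A 0), ← hR]
      simp only [Matrix.mul_apply, Finset.mul_sum]
      rw [Finset.sum_comm, Finset.sum_mul]
      refine Finset.sum_congr rfl fun e _ => ?_
      have : ∑ i, ψ i * (A 0 i e * R e c) = (∑ i, ψ i * A 0 i e) * R e c := by
        rw [Finset.sum_mul]
        exact Finset.sum_congr rfl fun i _ => (mul_assoc _ _ _).symm
      rw [this, mul_assoc, (hRL e c).eq, ← mul_assoc, hA, mul_assoc]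
    rw [← mul_assoc, h1, mul_assoc, ih', mul_assoc]

theorem prod_ofFn_sum {ι : Type*} [Fintype ι] {l : ℕ} (f : Fin l → ι → U) :
    (List.ofFn fun j => ∑ i, f j i).prod =
      ∑ p : Fin l → ι, (List.ofFn fun j => f j (p j)).prod := by
  classical
  have := (MultilinearMap.mkPiAlgebraFin ℤ l U).map_sum f
  simpa only [MultilinearMap.mkPiAlgebraFin_apply] using this

theorem prod_ofFn_mul {l : ℕ} (f g : Fin l → U) (h : ∀ i j, Commute (f i) (g j)) :
    (List.ofFn fun j => f j * g j).prod = (List.ofFn f).prod * (List.ofFn g).prod := by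
  induction l with
  | zero => simp
  | succ l ih =>
    have hc : Commute (g 0) (List.ofFn fun j : Fin l => f j.succ).prod := by
      refine Commute.list_prod_right _ _ fun x hx => ?_
      obtain ⟨j, rfl⟩ := (List.mem_ofFn' _ _).mp hx
      exact (h _ _).symm
    simp only [List.ofFn_succ, List.prod_cons]
    rw [ih _ _ fun i j => h i.succ j.succ, mul_assoc, ← mul_assoc (g 0), hc.eq]
    simp only [mul_assoc]

/-! ### The exterior algebra: creation, contraction, vacuum and top coefficient -/

/-- The Grassmann variable `ψᵢ`. -/
def grass (n : ℕ) (i : Fin n) : ExteriorAlgebra ℂ (Fin n → ℂ) :=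
  ExteriorAlgebra.ι ℂ (Pi.single i 1)

/-- Multiplying out gives one term for each choice of rows. Repeated rows are killed by the
alternating Grassmann product, and reordering the product for a permutation gives its sign. -/
theorem grassmann_columnDet (φ : ExteriorAlgebra ℂ (Fin n → ℂ) →+* U)
    (N : Matrix (Fin n) (Fin n) U) (h : ∀ k i j, Commute (φ (grass n k)) (N i j)) :
    (List.ofFn fun j => ∑ i, φ (grass n i) * N i j).prod =
      φ (List.ofFn (grass n)).prod * columnDet N := by
  rw [prod_ofFn_sum]
  have h1 : ∀ p : Fin n → Fin n, (List.ofFn fun j => φ (grass n (p j)) * N (p j) j).prod =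
      φ (ExteriorAlgebra.ιMulti ℂ n fun j => Pi.single (p j) (1 : ℂ)) *
        (List.ofFn fun j => N (p j) j).prod := fun p => by
    rw [prod_ofFn_mul _ _ fun i j => h _ _ _, ExteriorAlgebra.ιMulti_apply, map_list_prod,
      List.map_ofFn]
    rfl
  simp only [h1]
  rw [columnDet, Finset.mul_sum]
  symm
  refine Finset.sum_of_injOn (fun σ => (σ : Fin n → Fin n)) ?_ (fun _ _ => Finset.mem_coe.mpr
    (Finset.mem_univ _)) ?_ ?_
  · intro σ _ τ _ hστ
    exact DFunLike.coe_injective hστ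
  · intro p _ hp
    rw [AlternatingMap.map_eq_zero_of_not_injective, map_zero, zero_mul]
    intro hinj
    apply hp
    refine ⟨Equiv.ofBijective p ⟨fun i j hij => hinj (by simp only [hij]),
      Finite.surjective_of_injective fun i j hij => hinj (by simp only [hij])⟩, ?_, rfl⟩
    exact Finset.mem_coe.mpr (Finset.mem_univ _)
  · intro σ _
    have := (ExteriorAlgebra.ιMulti ℂ n).map_perm (fun j => Pi.single j (1 : ℂ)) σ
    have e : (ExteriorAlgebra.ιMulti ℂ n) (fun j => Pi.single (σ j) (1 : ℂ)) =
      Equiv.Perm.sign σ • (List.ofFn (grass n)).prod := by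
      rw [ExteriorAlgebra.ιMulti_apply] at this ⊢
      exact this
    rw [e, Units.smul_def, map_zsmul, smul_mul_assoc, mul_smul_comm]

theorem grass_mul (i j : Fin n) : grass n i * grass n j = -(grass n j * grass n i) :=
  eq_neg_of_add_eq_zero_left (ExteriorAlgebra.ι_add_mul_swap _ _)

theorem grass_sq (i : Fin n) : grass n i * grass n i = 0 := ExteriorAlgebra.ι_sq_zero _

/-- Contraction with the dual of `ψᵢ`. -/
def contr (n : ℕ) (i : Fin n) : Module.End ℂ (ExteriorAlgebra ℂ (Fin n → ℂ)) :=
  CliffordAlgebra.contractLeft (LinearMap.proj i : Module.Dual ℂ (Fin n → ℂ))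

theorem contr_one (i : Fin n) : contr n i 1 = 0 := CliffordAlgebra.contractLeft_one _ _

/-- Contraction is an antiderivation on the exterior algebra. -/
theorem contr_mul_grass (i j : Fin n) :
    contr n i * LinearMap.mulLeft ℂ (grass n j) =
      (if i = j then 1 else 0) - LinearMap.mulLeft ℂ (grass n j) * contr n i := by
  refine LinearMap.ext fun x => ?_
  have := CliffordAlgebra.contractLeft_ι_mul (Q := (0 : QuadraticForm ℂ (Fin n → ℂ)))
    (LinearMap.proj i : Module.Dual ℂ (Fin n → ℂ)) (Pi.single j 1) x
  change contr n i (grass n j * x) = _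
  refine this.trans ?_
  rw [LinearMap.sub_apply]
  change _ = _ - grass n j * contr n i x
  congr 1
  rw [LinearMap.proj_apply, Pi.single_apply]
  split_ifs <;> simp

/-- The projection onto the vacuum. -/
def vacuum (n : ℕ) : Module.End ℂ (ExteriorAlgebra ℂ (Fin n → ℂ)) :=
  Algebra.linearMap ℂ _ ∘ₗ (ExteriorAlgebra.algebraMapInv (R := ℂ) (M := Fin n → ℂ)).toLinearMap

theorem vacuum_one : vacuum n 1 = 1 := by
  simp [vacuum]

theorem contr_mul_vacuum (i : Fin n) : contr n i * vacuum n = 0 := by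
  refine LinearMap.ext fun x => ?_
  change contr n i (algebraMap ℂ _ _) = 0
  rw [Algebra.algebraMap_eq_smul_one, map_smul, contr_one, smul_zero]

/-- The determinant, extended by zero to the other degrees, is a functional on the exterior algebra
taking the value 1 on the ordered top monomial. -/
theorem exists_topCoeff (n : ℕ) :
    ∃ f : ExteriorAlgebra ℂ (Fin n → ℂ) →ₗ[ℂ] ℂ, f (List.ofFn (grass n)).prod = 1 := by
  refine ⟨ExteriorAlgebra.liftAlternating (Pi.single
    (M := fun i => (Fin n → ℂ) [⋀^Fin i]→ₗ[ℂ] ℂ) n Matrix.detRowAlternating), ?_⟩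
  have h : (List.ofFn (grass n)).prod =
      ExteriorAlgebra.ιMulti ℂ n fun j => Pi.single j (1 : ℂ) := by
    rw [ExteriorAlgebra.ιMulti_apply]
    rfl
  rw [h, ExteriorAlgebra.liftAlternating_apply_ιMulti, Pi.single_eq_same]
  have : (fun j => Pi.single j (1 : ℂ) : Fin n → Fin n → ℂ) = (1 : Matrix (Fin n) (Fin n) ℂ) := by
    ext i j
    rw [Matrix.one_apply, Pi.single_apply]
    simp only [eq_comm]
  rw [this]
  exact Matrix.det_one

end Grassmann

end

end BetheGaudin

namespace BetheGaudin

noncomputable section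

/-! ### Poles of the coefficients of the difference operator -/

/-- Grassmann creation and annihilation operators with a vacuum projection, commuting with `m`
copies of the Weyl algebra and with one more family of operators. -/
structure EvalData (n m : ℕ) (K B : Type*) [Field K] [Ring B] where
  κ : K →+* B
  ψ : Fin n → B
  ι : Fin n → B
  vac : B
  x : Fin m → Fin n → B
  d : Fin m → Fin n → B
  e : Fin n → Fin n → B
  w : Fin m → K
  κ_comm : ∀ c b, Commute (κ c) b
  ψ_mul : ∀ i j, ψ i * ψ j = -(ψ j * ψ i)
  ψ_sq : ∀ i, ψ i * ψ i = 0
  ι_ψ : ∀ i j, ι i * ψ j = (if i = j then 1 else 0) - ψ j * ι i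
  ι_vac : ∀ i, ι i * vac = 0
  x_ψ : ∀ k i j, Commute (x k i) (ψ j)
  d_ψ : ∀ k i j, Commute (d k i) (ψ j)
  e_ψ : ∀ i j l, Commute (e i j) (ψ l)
  x_ι : ∀ k i j, Commute (x k i) (ι j)
  d_ι : ∀ k i j, Commute (d k i) (ι j)
  e_ι : ∀ i j l, Commute (e i j) (ι l)
  x_x : ∀ k l i j, Commute (x k i) (x l j)
  d_d : ∀ k l i j, Commute (d k i) (d l j)
  d_x_same : ∀ k i j, d k i * x k j = x k j * d k i + if i = j then 1 else 0
  d_x : ∀ k l i j, k ≠ l → Commute (d k i) (x l j)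
  e_x : ∀ i j k l, Commute (e i j) (x k l)
  e_d : ∀ i j k l, Commute (e i j) (d k l)

namespace EvalData

variable {n m : ℕ} {K B : Type*} [Field K] [Ring B] (E : EvalData n m K B)

/-- `u - t - c`. -/
def pt (t : ℕ) (c : K) : USeries K := uVar - HahnSeries.C ((t : K) + c)

theorem pt_ne_zero (t : ℕ) (c : K) : pt t c ≠ 0 := uVar_sub_C_ne_zero _

theorem shift_pt (t : ℕ) (c : K) : shiftHom 1 (pt (t + 1) c) = pt t c := by
  rw [pt, pt, map_sub, shiftHom_uVar, shiftHom_C, Nat.cast_succ, map_add, map_add, map_add, map_one,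
    Int.cast_one]
  ring

theorem shift_neg_pt (t : ℕ) (c : K) : shiftHom (-t : ℤ) (pt 0 c) = pt t c := by
  rw [pt, pt, map_sub, shiftHom_uVar, shiftHom_C, map_add, map_add, map_natCast, map_natCast]
  push_cast
  ring

/-- Scalar series. -/
def z : USeries K →+* USeries B := mapSeriesHom E.κ

theorem z_comm (f : USeries K) (g : USeries B) : Commute (E.z f) g :=
  commute_of_coeff fun _ _ => E.κ_comm _ _

theorem shift_z (c : ℤ) (f : USeries K) : shiftHom c (E.z f) = E.z (shiftHom c f) :=
  (mapSeries_shift (E.κ : K →+ B) c f).symm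

theorem z_mem_poly {f : USeries K} (hf : f ∈ polySubring K) : E.z f ∈ polySubring B :=
  mapSeriesHom_mem_poly _ hf

theorem C_comm {x y : B} (h : Commute x y) :
    Commute (HahnSeries.C x : USeries B) (HahnSeries.C y) := h.map HahnSeries.C

theorem pt_mem_poly (t : ℕ) (c : K) : pt t c ∈ polySubring K :=
  sub_mem uVar_mem_poly (C_mem_poly _)

theorem z_pt_mul_inv (t : ℕ) (c : K) : E.z (pt t c) * E.z (pt t c)⁻¹ = 1 := by
  rw [← map_mul, mul_inv_cancel₀ (pt_ne_zero t c), map_one]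

/-- `δᵢⱼ + xᵢ ∂ⱼ / (u - t - w_k)`. -/
def fac (t : ℕ) (k : Fin m) : Matrix (Fin n) (Fin n) (USeries B) :=
  Matrix.of fun i j => (if i = j then 1 else 0) +
    HahnSeries.C (E.x k i) * HahnSeries.C (E.d k j) * E.z (pt t (E.w k))⁻¹

/-- `δᵢⱼ + eᵢⱼ / (u - t)`. -/
def last (t : ℕ) : Matrix (Fin n) (Fin n) (USeries B) :=
  Matrix.of fun i j => (if i = j then 1 else 0) + HahnSeries.C (E.e i j) * E.z (pt t 0)⁻¹

/-- The monodromy matrix `T(u - t)`. -/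
def mon (t : ℕ) : Matrix (Fin n) (Fin n) (USeries B) := (List.ofFn (E.fac t)).prod * E.last t

/-- `X Δ` for the `k`-th factor. -/
def pair (k : Fin m) : USeries B :=
  (∑ i, HahnSeries.C (E.ψ i) * HahnSeries.C (E.x k i)) *
    ∑ j, HahnSeries.C (E.d k j) * HahnSeries.C (E.ι j)

/-- The intertwiner `1 + X Δ / (u - t - w_k)`. -/
def inter (t : ℕ) (k : Fin m) : USeries B := 1 + E.z (pt t (E.w k))⁻¹ * E.pair k

theorem shift_mon (t : ℕ) (i j : Fin n) : shiftHom (-t : ℤ) (E.mon 0 i j) = E.mon t i j := by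
  have hz : ∀ c, shiftHom (-t : ℤ) (E.z (pt 0 c)⁻¹) = E.z (pt t c)⁻¹ := fun c => by
    rw [shift_z, map_inv₀, shift_neg_pt]
  have hδ : ∀ i j : Fin n, shiftHom (-t : ℤ) (if i = j then (1 : USeries B) else 0) =
      if i = j then 1 else 0 := fun i j => by
    split_ifs
    exacts [map_one _, map_zero _]
  have h1 : ∀ k, (shiftHom (-t : ℤ)).mapMatrix (E.fac 0 k) = E.fac t k := fun k => by
    ext1 i j
    simp only [fac, RingHom.mapMatrix_apply, Matrix.map_apply, Matrix.of_apply, map_add, map_mul,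
      hz, hδ, shiftHom_C]
  have h2 : (shiftHom (-t : ℤ)).mapMatrix (E.last 0) = E.last t := by
    ext1 i j
    simp only [last, RingHom.mapMatrix_apply, Matrix.map_apply, Matrix.of_apply, map_add, map_mul,
      hz, hδ, shiftHom_C]
  have h3 : (shiftHom (-t : ℤ)).mapMatrix (E.mon 0) = E.mon t := by
    rw [mon, map_mul, map_list_prod, List.map_ofFn, h2, mon]
    congr 3
    funext k
    exact h1 k
  rw [← h3]
  rfl

theorem shift_inter (t : ℕ) (k : Fin m) : shiftHom 1 (E.inter (t + 1) k) = E.inter t k := by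
  simp only [inter, pair, map_add, map_mul, map_sum, map_one, shift_z, map_inv₀, shift_pt,
    shiftHom_C]

theorem commute_pair {y : USeries B} {k : Fin m}
    (hψ : ∀ i, Commute y (HahnSeries.C (E.ψ i))) (hx : ∀ i, Commute y (HahnSeries.C (E.x k i)))
    (hd : ∀ i, Commute y (HahnSeries.C (E.d k i))) (hι : ∀ i, Commute y (HahnSeries.C (E.ι i))) :
    Commute y (E.pair k) :=
  (Commute.sum_right _ _ _ fun i _ => (hψ i).mul_right (hx i)).mul_right
    (Commute.sum_right _ _ _ fun i _ => (hd i).mul_right (hι i))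

theorem commute_inter {y : USeries B} {t : ℕ} {k : Fin m} (h : Commute y (E.pair k)) :
    Commute y (E.inter t k) :=
  (Commute.one_right _).add_right ((E.z_comm _ _).symm.mul_right h)

theorem commute_delta (i j : Fin n) (y : USeries B) :
    Commute (if i = j then (1 : USeries B) else 0) y := by
  split_ifs
  exacts [Commute.one_left _, Commute.zero_left _]

/-- The Grassmann combination of the `j`-th column of a matrix. -/
def col (M : Matrix (Fin n) (Fin n) (USeries B)) (j : Fin n) : USeries B :=
  ∑ i, HahnSeries.C (E.ψ i) * M i j

/-- The poles at the `w_k` pass from `T(u - t)` into the intertwiner on the left, so the column that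
remains has a pole only from the last factor. -/
theorem col_mon (t : ℕ) (j : Fin n) :
    E.col (E.mon t) j * (List.ofFn (E.inter (t + 1))).prod =
      (List.ofFn (E.inter t)).prod * E.col (E.last t) j := by
  refine grassmann_intertwine_prod (fun k c => ?_) (fun k l i j hkl => ?_) (fun k i j => ?_) j
  -- The intertwiners on the two sides are taken at points differing by one, as the partial-fraction
  -- relation requires.
  · have hyy : E.z (pt (t + 1) (E.w k))⁻¹ - E.z (pt t (E.w k))⁻¹ =
        E.z (pt t (E.w k))⁻¹ * E.z (pt (t + 1) (E.w k))⁻¹ := by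
      rw [← map_sub, ← map_mul]
      congr 1
      have h1 := pt_ne_zero (t + 1) (E.w k)
      have h2 := pt_ne_zero t (E.w k)
      have h3 : pt t (E.w k) = pt (t + 1) (E.w k) + 1 := by
        rw [pt, pt, Nat.cast_succ, map_add, map_add, map_add, map_one]
        ring
      field_simp
      rw [h3]
      ring
    exact grassmann_intertwine (E.z_comm _) (E.z_comm _) hyy
      (fun i j => by rw [← map_mul, ← map_mul, ← map_neg, E.ψ_mul])
      (fun i => by rw [← map_mul, E.ψ_sq, map_zero])
      (fun i j => by
        rw [← map_mul, ← map_mul, E.ι_ψ, map_sub]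
        split_ifs
        exacts [by rw [map_one], by rw [map_zero]])
      (fun i j => C_comm (E.x_ψ k i j)) (fun i j => C_comm (E.d_ψ k i j))
      (fun i j => C_comm (E.x_x k k i j))
      (fun i j => by
        rw [← map_mul, ← map_mul, E.d_x_same, map_add]
        split_ifs
        exacts [by rw [map_one], by rw [map_zero]]) c
  · refine E.commute_inter ((commute_delta _ _ _).add_left
      (Commute.mul_left (Commute.mul_left ?_ ?_) (E.z_comm _ _)))
    · exact E.commute_pair (fun _ => C_comm (E.x_ψ _ _ _)) (fun _ => C_comm (E.x_x _ _ _ _))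
        (fun _ => (C_comm (E.d_x _ _ _ _ hkl)).symm) (fun _ => C_comm (E.x_ι _ _ _))
    · exact E.commute_pair (fun _ => C_comm (E.d_ψ _ _ _))
        (fun _ => C_comm (E.d_x _ _ _ _ hkl.symm))
        (fun _ => C_comm (E.d_d _ _ _ _)) (fun _ => C_comm (E.d_ι _ _ _))
  · refine E.commute_inter ((commute_delta _ _ _).add_left (Commute.mul_left ?_ (E.z_comm _ _)))
    exact E.commute_pair (fun _ => C_comm (E.e_ψ _ _ _)) (fun _ => C_comm (E.e_x _ _ _ _))
      (fun _ => C_comm (E.e_d _ _ _ _)) (fun _ => C_comm (E.e_ι _ _ _))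

theorem commute_mon_ψ (t : ℕ) (i j l : Fin n) :
    Commute (E.mon t i j) (HahnSeries.C (E.ψ l)) := by
  rw [mon, Matrix.mul_apply]
  refine Commute.sum_left _ _ _ fun k _ => Commute.mul_left (commute_prod_ofFn ?_ _ _) ?_
  · intro k i j
    exact (commute_delta _ _ _).add_left (Commute.mul_left (Commute.mul_left
      (C_comm (E.x_ψ _ _ _)) (C_comm (E.d_ψ _ _ _))) (E.z_comm _ _))
  · exact (commute_delta _ _ _).add_left (Commute.mul_left (C_comm (E.e_ψ _ _ _)) (E.z_comm _ _))

theorem col_mon_mul_ψ (t : ℕ) (j l : Fin n) :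
    E.col (E.mon t) j * HahnSeries.C (E.ψ l) = -(HahnSeries.C (E.ψ l) * E.col (E.mon t) j) := by
  rw [col, Finset.sum_mul, Finset.mul_sum, ← Finset.sum_neg_distrib]
  refine Finset.sum_congr rfl fun i _ => ?_
  rw [mul_assoc, (E.commute_mon_ψ t i j l).eq, ← mul_assoc, ← map_mul, E.ψ_mul, map_neg, map_mul,
    neg_mul, mul_assoc]

theorem col_mon_mul_list (t : ℕ) (j : Fin n) (l : List (Fin n)) :
    E.col (E.mon t) j * (l.map fun i => HahnSeries.C (E.ψ i)).prod =
      ((-1) ^ l.length : ℤ) •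
        ((l.map fun i => HahnSeries.C (E.ψ i)).prod * E.col (E.mon t) j) := by
  induction l with
  | nil => simp
  | cons i l ih =>
    rw [List.map_cons, List.prod_cons, ← mul_assoc, col_mon_mul_ψ, neg_mul, mul_assoc, ih,
      List.length_cons, pow_succ, mul_neg_one, neg_smul, mul_smul_comm, mul_assoc]

/-! ### Moving the intertwiner through the columns of the determinant -/

/-- The products `ψ_I 𝓛(u - t) Y`, where `(u - t) ⋯ (u - t - p + 1) Y` is a polynomial, and their
sums. -/
def tame (t p : ℕ) : AddSubgroup (USeries B) :=
  AddSubgroup.closure {f | ∃ (l : List (Fin n)) (Y : USeries B),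
    f = (l.map fun i => HahnSeries.C (E.ψ i)).prod * ((List.ofFn (E.inter t)).prod * Y) ∧
      E.z (∏ s ∈ Finset.range p, pt (t + s) 0) * Y ∈ polySubring B}

/-- The substitution `u ↦ u + 1` takes `𝓛(u - t - 1)` to `𝓛(u - t)` and moves the poles `t + 1, …, t
+ p` of `Y` to `t, …, t + p - 1`. -/
theorem shift_mem_tame {t p : ℕ} {f : USeries B} (hf : f ∈ E.tame (t + 1) p) (j : Fin n) :
    HahnSeries.C (E.ψ j) * shiftSeries 1 f ∈ E.tame t p := by
  induction hf using AddSubgroup.closure_induction with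
  | mem f hf =>
    obtain ⟨l, Y, rfl, hY⟩ := hf
    refine AddSubgroup.subset_closure ⟨j :: l, shiftHom 1 Y, ?_, ?_⟩
    · rw [← shiftHom_apply, map_mul, map_mul, map_list_prod, map_list_prod, List.map_ofFn,
        List.map_map, List.map_cons, List.prod_cons, mul_assoc]
      congr 3
      · refine congrArg (fun g => List.map g l) ?_
        funext i
        exact shiftHom_C 1 _
      · refine congrArg (fun g => (List.ofFn g).prod) ?_
        funext k
        exact E.shift_inter t k
    · have := shift_mem_poly hY 1
      rw [← shiftHom_apply, map_mul, shift_z, map_prod] at this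
      simpa only [add_right_comm, shift_pt] using this
  | zero => rw [map_zero, mul_zero]; exact zero_mem _
  | add f g _ _ hf hg => rw [map_add, mul_add]; exact add_mem hf hg
  | neg f _ hf => rw [map_neg, mul_neg]; exact neg_mem hf

theorem z_pt_mul_last (t : ℕ) (j : Fin n) : E.z (pt t 0) * E.col (E.last t) j ∈ polySubring B := by
  rw [col, Finset.mul_sum]
  refine sum_mem fun i _ => ?_
  rw [← mul_assoc, (E.z_comm _ _).eq, mul_assoc]
  refine mul_mem (C_mem_poly _) ?_
  rw [last, Matrix.of_apply, mul_add]
  refine add_mem (mul_mem (E.z_mem_poly (pt_mem_poly _ _)) ?_) ?_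
  · split_ifs
    exacts [one_mem _, zero_mem _]
  · rw [← mul_assoc, (E.z_comm _ _).eq, mul_assoc, z_pt_mul_inv, mul_one]
    exact C_mem_poly _

/-- After the sign from passing `ψ_I`, `col_mon` moves `𝓛` to the left of the column; what remains
contributes a single new factor `1/(u - t)`, just below the poles `t + 1, …, t + p`. -/
theorem col_mul_mem_tame {t p : ℕ} {f : USeries B} (hf : f ∈ E.tame (t + 1) p) (j : Fin n) :
    E.col (E.mon t) j * f ∈ E.tame t (p + 1) := by
  induction hf using AddSubgroup.closure_induction with
  | mem f hf =>
    obtain ⟨l, Y, rfl, hY⟩ := hf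
    rw [← mul_assoc, col_mon_mul_list, smul_mul_assoc]
    refine zsmul_mem (?_ : _ ∈ E.tame t (p + 1)) _
    refine AddSubgroup.subset_closure ⟨l, E.col (E.last t) j * Y, ?_, ?_⟩
    · rw [mul_assoc, ← mul_assoc (E.col (E.mon t) j), col_mon]
      simp only [mul_assoc]
    · rw [Finset.prod_range_succ', mul_comm, map_mul, mul_assoc, ← mul_assoc (E.z _) (E.col _ _),
        (E.z_comm _ (E.col _ _)).eq, mul_assoc (E.col _ _), ← mul_assoc, add_zero]
      refine mul_mem (E.z_pt_mul_last t j) ?_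
      simpa only [add_right_comm, ← add_assoc] using hY
  | zero => rw [mul_zero]; exact zero_mem _
  | add f g _ _ hf hg => rw [mul_add]; exact add_mem hf hg
  | neg f _ hf => rw [mul_neg]; exact neg_mem hf

/-- The columns `≥ t` of the determinant, applied to the vacuum, have this property. -/
def Tame (t : ℕ) (Φ : OpCoeffs B) : Prop :=
  (∀ k p, p + k + t = n → Φ k ∈ E.tame t p) ∧ ∀ k, n < k + t → Φ k = 0

/-- Multiplication by a Grassmann combination of a column. -/
def colOp (j : Fin n) : AddMonoid.End (OpCoeffs B) :=
  ∑ i, mulSeries (HahnSeries.C (E.ψ i)) *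
    ((if i = j then tauOp (B := B) else 0) - mulSeries (E.mon j i j))

theorem colOp_apply (j : Fin n) (Φ : OpCoeffs B) :
    E.colOp j Φ = mulSeries (HahnSeries.C (E.ψ j)) (tauOp Φ) -
      mulSeries (E.col (E.mon j) j) Φ := by
  rw [colOp, end_sum_apply, col, mulSeries_sum, end_sum_apply]
  have : ∀ i, (mulSeries (HahnSeries.C (E.ψ i)) *
      ((if i = j then tauOp (B := B) else 0) - mulSeries (E.mon j i j))) Φ =
      (if i = j then mulSeries (HahnSeries.C (E.ψ i)) (tauOp Φ) else 0) -
        mulSeries (HahnSeries.C (E.ψ i) * E.mon j i j) Φ := fun i => by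
    rw [end_mul_apply, end_sub_apply, map_sub, mulSeries_mul, end_mul_apply]
    congr 1
    split_ifs
    · rfl
    · exact map_zero _
  simp only [this, Finset.sum_sub_distrib, Finset.sum_ite_eq', Finset.mem_univ, if_true]

/-- A column contributes either `τ`, raising `k`, or an entry of `T`, raising the number `p` of
poles; both lower `t` by one, so `p + k + t` remains `n`. -/
theorem Tame.step {j : Fin n} {Φ : OpCoeffs B} (h : E.Tame (j + 1) Φ) :
    E.Tame j (E.colOp j Φ) := by
  rw [colOp_apply]
  constructor
  · intro k p hk
    rw [Finsupp.sub_apply]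
    refine sub_mem ?_ ?_
    · cases k with
      | zero => rw [mulSeries_apply, tauOp_apply_zero, mul_zero]; exact zero_mem _
      | succ k =>
        rw [mulSeries_apply, tauOp_apply_succ]
        exact E.shift_mem_tame (h.1 k p (by omega)) j
    · rw [mulSeries_apply]
      cases p with
      -- With `p = 0` every column so far must have contributed `τ`, so there is no term using an
      -- entry of `T` here.
      | zero => rw [h.2 k (by omega), mul_zero]; exact zero_mem _
      | succ p => exact E.col_mul_mem_tame (h.1 k p (by omega)) j
  · intro k hk
    rw [Finsupp.sub_apply, mulSeries_apply, mulSeries_apply, h.2 k (by omega), mul_zero, sub_zero]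
    cases k with
    | zero => rw [tauOp_apply_zero, mul_zero]
    | succ k => rw [tauOp_apply_succ, h.2 k (by omega), map_zero, mul_zero]

theorem pair_mul_vac (k : Fin m) : E.pair k * HahnSeries.C E.vac = 0 := by
  have : (∑ j, HahnSeries.C (E.d k j) * HahnSeries.C (E.ι j)) * HahnSeries.C E.vac =
      (0 : USeries B) := by
    rw [Finset.sum_mul]
    refine Finset.sum_eq_zero fun i _ => ?_
    rw [mul_assoc, ← map_mul, E.ι_vac, map_zero, mul_zero]
  rw [pair, mul_assoc, this, mul_zero]

/-- The reindexing `f` permits induction on the number of factors with `E` fixed. -/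
theorem prod_inter_mul_vac (t l : ℕ) (f : Fin l → Fin m) :
    (List.ofFn fun k => E.inter t (f k)).prod * HahnSeries.C E.vac = HahnSeries.C E.vac := by
  induction l with
  | zero => simp
  | succ l ih =>
    rw [List.ofFn_succ, List.prod_cons, mul_assoc, ih (fun k => f k.succ), inter, add_mul, one_mul,
      mul_assoc, pair_mul_vac, mul_zero, add_zero]

theorem tame_vac : E.Tame n (Finsupp.single 0 (HahnSeries.C E.vac)) := by
  constructor
  · intro k p hk
    obtain ⟨rfl, rfl⟩ : k = 0 ∧ p = 0 := by omega
    rw [Finsupp.single_eq_same]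
    -- The intertwiner enters here: it fixes the vacuum, so it can be written in front of it.
    refine AddSubgroup.subset_closure ⟨[], HahnSeries.C E.vac, ?_, ?_⟩
    · rw [List.map_nil, List.prod_nil, one_mul]
      exact (E.prod_inter_mul_vac n m id).symm
    · rw [Finset.range_zero, Finset.prod_empty, map_one, one_mul]
      exact C_mem_poly _
  · intro k hk
    rw [Finsupp.single_eq_of_ne (by omega)]

theorem prod_inter_mem_poly (t l : ℕ) (f : Fin l → Fin m) :
    E.z (∏ k, pt t (E.w (f k))) * (List.ofFn fun k => E.inter t (f k)).prod ∈ polySubring B := by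
  induction l with
  | zero => simp [one_mem]
  | succ l ih =>
    rw [List.ofFn_succ, List.prod_cons, Fin.prod_univ_succ, map_mul, mul_assoc,
      ← mul_assoc (E.z (∏ k : Fin l, _)), (E.z_comm (∏ k : Fin l, _) _).eq,
      mul_assoc (E.inter _ _), ← mul_assoc]
    refine mul_mem ?_ (ih fun k => f k.succ)
    rw [inter, mul_add, mul_one, ← mul_assoc, z_pt_mul_inv, one_mul, pair]
    refine add_mem (E.z_mem_poly (pt_mem_poly _ _)) (mul_mem ?_ ?_)
    · exact sum_mem fun i _ => mul_mem (C_mem_poly _) (C_mem_poly _)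
    · exact sum_mem fun i _ => mul_mem (C_mem_poly _) (C_mem_poly _)

/-- Once all columns are used only `𝓛(u)` remains, with one factor having a simple pole at each
`w_k`; the other poles are those of `Y`. -/
theorem mul_mem_poly_of_mem_tame {p : ℕ} {f : USeries B} (hf : f ∈ E.tame 0 p) :
    E.z ((∏ s ∈ Finset.range p, pt s 0) * ∏ k, pt 0 (E.w k)) * f ∈ polySubring B := by
  induction hf using AddSubgroup.closure_induction with
  | mem f hf =>
    obtain ⟨l, Y, rfl, hY⟩ := hf
    simp only [zero_add] at hY
    rw [map_mul, mul_assoc, (E.z_comm (∏ k, _) _).left_comm, (E.z_comm _ _).left_comm,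
      (E.z_comm _ (E.z _)).left_comm, (E.z_comm _ (List.prod _)).left_comm, ← mul_assoc (E.z _)]
    refine mul_mem (list_prod_mem ?_) (mul_mem (E.prod_inter_mem_poly 0 m id) hY)
    intro y hy
    obtain ⟨i, -, rfl⟩ := List.mem_map.mp hy
    exact C_mem_poly _
  | zero => rw [mul_zero]; exact zero_mem _
  | add f g _ _ hf hg => rw [mul_add]; exact add_mem hf hg
  | neg f _ hf => rw [mul_neg]; exact neg_mem hf

theorem tame_prod : E.Tame 0
    ((List.ofFn E.colOp).prod (Finsupp.single 0 (HahnSeries.C E.vac))) :=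
  prod_ofFn_induction n E.colOp (fun t Φ => E.Tame t Φ) (fun _ _ h => Tame.step E h) _ E.tame_vac

end EvalData

end

end BetheGaudin

namespace BetheGaudin

noncomputable section

/-! ### Realisation of the Grassmann and Weyl operators on the tensor product -/

section Poles

variable {n m : ℕ}

/-- Operators on the exterior algebra tensored with an algebra. -/
def GrassAlg (n : ℕ) (A : Type*) [Ring A] [Algebra ℂ A] : Type _ :=
  Module.End ℂ (ExteriorAlgebra ℂ (Fin n → ℂ)) ⊗[ℂ] A

instance (n : ℕ) (A : Type*) [Ring A] [Algebra ℂ A] : Ring (GrassAlg n A) :=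
  inferInstanceAs (Ring (Module.End ℂ (ExteriorAlgebra ℂ (Fin n → ℂ)) ⊗[ℂ] A))

section Incl

variable {A : Type*} [Ring A] [Algebra ℂ A]

/-- Pure tensors. -/
def GrassAlg.mk (e : Module.End ℂ (ExteriorAlgebra ℂ (Fin n → ℂ))) (a : A) : GrassAlg n A :=
  e ⊗ₜ[ℂ] a

theorem GrassAlg.mk_mul (e e' : Module.End ℂ (ExteriorAlgebra ℂ (Fin n → ℂ))) (a a' : A) :
    GrassAlg.mk e a * GrassAlg.mk e' a' = GrassAlg.mk (e * e') (a * a') :=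
  Algebra.TensorProduct.tmul_mul_tmul _ _ _ _

theorem GrassAlg.induction {p : GrassAlg n A → Prop} (y : GrassAlg n A) (zero : p 0)
    (mk : ∀ e a, p (GrassAlg.mk e a)) (add : ∀ x y, p x → p y → p (x + y)) : p y :=
  TensorProduct.induction_on y zero mk add

/-- Operators on the exterior algebra inside the tensor product. -/
def grassIncl (n : ℕ) (A : Type*) [Ring A] [Algebra ℂ A] :
    Module.End ℂ (ExteriorAlgebra ℂ (Fin n → ℂ)) →+* GrassAlg n A :=
  (Algebra.TensorProduct.includeLeftRingHom :
    _ →+* Module.End ℂ (ExteriorAlgebra ℂ (Fin n → ℂ)) ⊗[ℂ] A)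

/-- The algebra inside its tensor product with the operators on the exterior algebra. -/
def algIncl (n : ℕ) (A : Type*) [Ring A] [Algebra ℂ A] : A →+* GrassAlg n A :=
  ((Algebra.TensorProduct.includeRight :
    A →ₐ[ℂ] Module.End ℂ (ExteriorAlgebra ℂ (Fin n → ℂ)) ⊗[ℂ] A).toRingHom : _)

theorem grassIncl_apply (e : Module.End ℂ (ExteriorAlgebra ℂ (Fin n → ℂ))) :
    grassIncl n A e = GrassAlg.mk e 1 := rfl

theorem algIncl_apply (a : A) : algIncl n A a = GrassAlg.mk 1 a := rfl

theorem commute_incl (a : A) (e : Module.End ℂ (ExteriorAlgebra ℂ (Fin n → ℂ))) :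
    Commute (algIncl n A a) (grassIncl n A e) := by
  change _ * _ = _ * _
  rw [algIncl_apply, grassIncl_apply, GrassAlg.mk_mul, GrassAlg.mk_mul, one_mul, one_mul, mul_one,
    mul_one]

theorem commute_algIncl {a : A} (h : ∀ a', Commute a a') (y : GrassAlg n A) :
    Commute (algIncl n A a) y := by
  induction y using GrassAlg.induction with
  | zero => exact Commute.zero_right _
  | mk e a' =>
    change _ * _ = _ * _
    rw [algIncl_apply, GrassAlg.mk_mul, GrassAlg.mk_mul, (h a').eq, one_mul, mul_one]
  | add x y hx hy => exact hx.add_right hy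

/-- The coefficient of the top Grassmann monomial. -/
def topPart (f : ExteriorAlgebra ℂ (Fin n → ℂ) →ₗ[ℂ] ℂ) : GrassAlg n A →+ A :=
  ((TensorProduct.lid ℂ A).toLinearMap ∘ₗ
    LinearMap.rTensor A (f ∘ₗ LinearMap.applyₗ (1 : ExteriorAlgebra ℂ (Fin n → ℂ)))).toAddMonoidHom

theorem topPart_mk (f : ExteriorAlgebra ℂ (Fin n → ℂ) →ₗ[ℂ] ℂ)
    (e : Module.End ℂ (ExteriorAlgebra ℂ (Fin n → ℂ))) (a : A) :
    topPart f (GrassAlg.mk e a) = f (e 1) • a := rfl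

/-- Extraction of the top coefficient is linear over the algebra, so scalar factors clearing poles
pass through it. -/
theorem topPart_mul (f : ExteriorAlgebra ℂ (Fin n → ℂ) →ₗ[ℂ] ℂ) (a : A) (y : GrassAlg n A) :
    topPart f (algIncl n A a * y) = a * topPart f y := by
  induction y using GrassAlg.induction with
  | zero => rw [mul_zero, map_zero, mul_zero]
  | mk e a' =>
    rw [algIncl_apply, GrassAlg.mk_mul, one_mul, topPart_mk, topPart_mk, mul_smul_comm]
  | add x y hx hy => rw [mul_add, map_add, hx, hy, map_add, mul_add]

end Incl

/-! ### The Weyl algebra acting on the symmetric powers -/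

/-- Multiplication by `x_{ik}`. -/
def mulVar (lam : Fin n → ℂ) (k : Fin m) (i : Fin n) : Module.End ℂ (SymVerma m lam) :=
  LinearMap.rTensor (Verma lam) (LinearMap.mulLeft ℂ (MvPolynomial.X (i, k)))

/-- The derivative with respect to `x_{ik}`. -/
def derivVar (lam : Fin n → ℂ) (k : Fin m) (i : Fin n) : Module.End ℂ (SymVerma m lam) :=
  LinearMap.rTensor (Verma lam) (MvPolynomial.pderiv (i, k)).toLinearMap

theorem eFactor_eq (lam : Fin n → ℂ) (i j : Fin n) (k : Fin m) :
    eFactor lam i j k = mulVar lam k i * derivVar lam k j :=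
  LinearMap.rTensor_comp _ _ _

theorem commute_rTensor {V V' : Type*} [AddCommGroup V] [Module ℂ V] [AddCommGroup V']
    [Module ℂ V'] {f g : Module.End ℂ V} (h : Commute f g) :
    Commute (LinearMap.rTensor V' f : Module.End ℂ (V ⊗[ℂ] V')) (LinearMap.rTensor V' g) := by
  change _ * _ = _ * _
  rw [← LinearMap.rTensor_mul, ← LinearMap.rTensor_mul, h.eq]

theorem commute_lTensor_rTensor {V V' : Type*} [AddCommGroup V] [Module ℂ V] [AddCommGroup V']
    [Module ℂ V'] (f : Module.End ℂ V) (g : Module.End ℂ V') :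
    Commute (LinearMap.lTensor V g : Module.End ℂ (V ⊗[ℂ] V')) (LinearMap.rTensor V' f) := by
  change LinearMap.lTensor V g ∘ₗ LinearMap.rTensor V' f =
    LinearMap.rTensor V' f ∘ₗ LinearMap.lTensor V g
  rw [LinearMap.lTensor_comp_rTensor, LinearMap.rTensor_comp_lTensor]

theorem commute_mulVar (lam : Fin n → ℂ) (k l : Fin m) (i j : Fin n) :
    Commute (mulVar lam k i) (mulVar lam l j) := by
  refine commute_rTensor (LinearMap.ext fun p => ?_)
  exact mul_left_comm (MvPolynomial.X (i, k) : SymTensor n m) (MvPolynomial.X (j, l)) p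

theorem commute_derivVar (lam : Fin n → ℂ) (k l : Fin m) (i j : Fin n) :
    Commute (derivVar lam k i) (derivVar lam l j) := by
  refine commute_rTensor (LinearMap.ext fun p => ?_)
  have h : ⁅(MvPolynomial.pderiv (i, k) : Derivation ℂ (SymTensor n m) (SymTensor n m)),
      (MvPolynomial.pderiv (j, l) : Derivation ℂ (SymTensor n m) (SymTensor n m))⁆ = 0 := by
    refine MvPolynomial.derivation_ext fun q => ?_
    rw [Derivation.commutator_apply, MvPolynomial.pderiv_X, MvPolynomial.pderiv_X]
    simp only [Pi.single_apply]
    split_ifs <;> simp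
  have := congrArg (fun D => D p) h
  exact sub_eq_zero.mp (by simpa [Derivation.commutator_apply] using this)

theorem derivVar_mul_mulVar (lam : Fin n → ℂ) (k l : Fin m) (i j : Fin n) :
    derivVar lam k i * mulVar lam l j =
      mulVar lam l j * derivVar lam k i + if i = j ∧ k = l then 1 else 0 := by
  have h : ((MvPolynomial.pderiv (i, k)).toLinearMap : Module.End ℂ (SymTensor n m)) *
      LinearMap.mulLeft ℂ (MvPolynomial.X (j, l)) =
      LinearMap.mulLeft ℂ (MvPolynomial.X (j, l)) * (MvPolynomial.pderiv (i, k)).toLinearMap +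
        if i = j ∧ k = l then 1 else 0 := by
    refine LinearMap.ext fun p => ?_
    rw [LinearMap.add_apply, Module.End.mul_apply, Module.End.mul_apply, LinearMap.mulLeft_apply,
      LinearMap.mulLeft_apply]
    refine (Derivation.leibniz _ _ _).trans (congrArg₂ _ rfl ?_)
    rw [MvPolynomial.pderiv_X, Pi.single_apply, smul_eq_mul]
    by_cases h : i = j ∧ k = l
    · rw [if_pos h, if_pos (Prod.ext h.1.symm h.2.symm), mul_one]
      rfl
    · rw [if_neg h, if_neg fun h' => h ⟨(congrArg Prod.fst h').symm, (congrArg Prod.snd h').symm⟩,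
        mul_zero]
      rfl
  rw [derivVar, mulVar, ← LinearMap.rTensor_mul, h, LinearMap.rTensor_add, LinearMap.rTensor_mul]
  congr 1
  split_ifs
  · exact LinearMap.rTensor_id _ _
  · exact LinearMap.rTensor_zero _

/-- Operators on `(S ℂⁿ)^{⊗ m} ⊗ M_λ` inside the big algebra. -/
def endIncl (n m : ℕ) (W : Type*) [AddCommGroup W] [Module ℂ W] :
    Module.End ℂ W →+* GrassAlg n (RatEnd m W) :=
  (algIncl n (RatEnd m W)).comp
    (Algebra.TensorProduct.includeRight : Module.End ℂ W →ₐ[ℂ] RatEnd m W).toRingHom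

/-- Scalars inside the big algebra. -/
def ratIncl (n m : ℕ) (W : Type*) [AddCommGroup W] [Module ℂ W] :
    RatFun m →+* GrassAlg n (RatEnd m W) :=
  (algIncl n (RatEnd m W)).comp Algebra.TensorProduct.includeLeftRingHom

theorem ratIncl_comm {W : Type*} [AddCommGroup W] [Module ℂ W] (c : RatFun m)
    (y : GrassAlg n (RatEnd m W)) : Commute (ratIncl n m W c) y := by
  refine commute_algIncl (fun a => ?_) y
  induction a using TensorProduct.induction_on with
  | zero => exact (mul_zero _).trans (zero_mul _).symm
  | tmul p X =>
    change (c ⊗ₜ[ℂ] (1 : Module.End ℂ W)) * (p ⊗ₜ[ℂ] X) =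
      (p ⊗ₜ[ℂ] X) * (c ⊗ₜ[ℂ] (1 : Module.End ℂ W))
    rw [Algebra.TensorProduct.tmul_mul_tmul, Algebra.TensorProduct.tmul_mul_tmul, mul_comm p,
      one_mul, mul_one]
  | add x y hx hy => exact Commute.add_right (R := RatEnd m W) hx hy

/-- The Grassmann and Weyl generators for `S^{b₁} ℂⁿ(w₁) ⊗ ⋯ ⊗ S^{bₘ} ℂⁿ(wₘ) ⊗ M_λ(0)`. -/
def evalData (b : Fin m → ℕ) (lam : Fin n → ℂ) :
    EvalData n m (RatFun m) (GrassAlg n (RatEnd m (SymVerma m lam))) where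
  κ := ratIncl n m (SymVerma m lam)
  ψ i := grassIncl n _ (LinearMap.mulLeft ℂ (grass n i))
  ι i := grassIncl n _ (contr n i)
  vac := grassIncl n _ (vacuum n)
  x k i := endIncl n m _ (mulVar lam k i)
  d k i := endIncl n m _ (derivVar lam k i)
  e i j := endIncl n m _ (eLast m lam i j)
  w := wParam b
  κ_comm := ratIncl_comm
  ψ_mul i j := by
    rw [← map_mul, ← map_mul, ← map_neg]
    congr 1
    refine LinearMap.ext fun x => ?_
    change grass n i * (grass n j * x) = -(grass n j * (grass n i * x))
    rw [← mul_assoc, grass_mul, neg_mul, mul_assoc]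
  ψ_sq i := by
    rw [← map_mul, ← map_zero (grassIncl n _)]
    congr 1
    refine LinearMap.ext fun x => ?_
    change grass n i * (grass n i * x) = 0
    rw [← mul_assoc, grass_sq, zero_mul]
  ι_ψ i j := by
    rw [← map_mul, contr_mul_grass, map_sub, map_mul]
    congr 1
    split_ifs
    exacts [map_one _, map_zero _]
  ι_vac i := by rw [← map_mul, contr_mul_vacuum, map_zero]
  x_ψ _ _ _ := commute_incl _ _
  d_ψ _ _ _ := commute_incl _ _
  e_ψ _ _ _ := commute_incl _ _
  x_ι _ _ _ := commute_incl _ _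
  d_ι _ _ _ := commute_incl _ _
  e_ι _ _ _ := commute_incl _ _
  x_x k l i j := (commute_mulVar lam k l i j).map _
  d_d k l i j := (commute_derivVar lam k l i j).map _
  d_x_same k i j := by
    rw [← map_mul, derivVar_mul_mulVar, map_add, map_mul]
    congr 1
    simp only [and_true]
    split_ifs
    exacts [map_one _, map_zero _]
  d_x k l i j h := by
    refine Commute.map ?_ (endIncl n m _)
    change _ * _ = _ * _
    rw [derivVar_mul_mulVar, if_neg fun h' => h h'.2, add_zero]
  e_x _ _ _ _ := (commute_lTensor_rTensor _ _).map _
  e_d _ _ _ _ := (commute_lTensor_rTensor _ _).map _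

theorem map_poleSeries {W : Type*} [AddCommGroup W] [Module ℂ W] (X : Module.End ℂ W)
    (c : RatFun m) : mapSeriesHom (B' := GrassAlg n (RatEnd m W)) (algIncl n (RatEnd m W))
      (poleSeries X c) =
      HahnSeries.C (endIncl n m W X) *
        mapSeriesHom (B' := GrassAlg n (RatEnd m W)) (ratIncl n m W)
          (uVar - HahnSeries.C c)⁻¹ := by
  rw [poleSeries_eq, map_mul, mapSeriesHom_C]
  rfl

theorem map_delta {A B : Type*} [Ring A] [Ring B] (φ : A →+* B) (i j : Fin n) :
    mapSeriesHom φ (if i = j then 1 else 0) = if i = j then (1 : USeries B) else 0 := by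
  split_ifs
  exacts [map_one _, map_zero _]

theorem map_fac (b : Fin m → ℕ) (lam : Fin n → ℂ) (k : Fin m) (i j : Fin n) :
    mapSeriesHom (algIncl n (RatEnd m (SymVerma m lam))) ((1 + Matrix.of fun i j =>
      poleSeries (eFactor lam i j k) (wParam b k) : Matrix (Fin n) (Fin n) _) i j) =
      (evalData b lam).fac 0 k i j := by
  rw [Matrix.add_apply, Matrix.one_apply, map_add, map_delta, Matrix.of_apply, map_poleSeries,
    eFactor_eq, map_mul (endIncl n m _), map_mul HahnSeries.C]
  change _ = _ + HahnSeries.C _ * HahnSeries.C _ * mapSeriesHom _ (EvalData.pt 0 (wParam b k))⁻¹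
  rw [EvalData.pt, Nat.cast_zero, zero_add]
  rfl

theorem map_last (b : Fin m → ℕ) (lam : Fin n → ℂ) (i j : Fin n) :
    mapSeriesHom (algIncl n (RatEnd m (SymVerma m lam))) ((1 + Matrix.of fun i j =>
      poleSeries (eLast m lam i j) 0 : Matrix (Fin n) (Fin n) _) i j) =
      (evalData b lam).last 0 i j := by
  rw [Matrix.add_apply, Matrix.one_apply, map_add, map_delta, Matrix.of_apply, map_poleSeries]
  change _ = _ + HahnSeries.C _ * mapSeriesHom _ (EvalData.pt 0 (0 : RatFun m))⁻¹
  rw [EvalData.pt, Nat.cast_zero, zero_add]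
  rfl

theorem map_prod_ofFn_mul {A B : Type*} [Ring A] [Ring B] (φ : A →+* B) {l : ℕ}
    (F : Fin l → Matrix (Fin n) (Fin n) A) (G : Matrix (Fin n) (Fin n) A)
    (F' : Fin l → Matrix (Fin n) (Fin n) B) (G' : Matrix (Fin n) (Fin n) B)
    (hF : ∀ k i j, φ (F k i j) = F' k i j) (hG : ∀ i j, φ (G i j) = G' i j) (i j : Fin n) :
    φ (((List.ofFn F).prod * G) i j) = ((List.ofFn F').prod * G') i j := by
  have h1 : (φ.mapMatrix ∘ F) = F' := funext fun k => Matrix.ext fun i j => hF k i j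
  have h2 : φ.mapMatrix G = G' := Matrix.ext fun i j => hG i j
  rw [← h1, ← h2, ← List.map_ofFn, ← map_list_prod, ← map_mul]
  rfl

theorem map_monodromy (b : Fin m → ℕ) (lam : Fin n → ℂ) (i j : Fin n) :
    mapSeriesHom (algIncl n _) (monodromy b lam i j) = (evalData b lam).mon 0 i j :=
  map_prod_ofFn_mul _ _ _ _ _ (map_fac b lam) (map_last b lam) i j

/-! ### From the Grassmann product back to the column determinant -/

theorem commute_mulSeries_C_tauOp {B : Type*} [Ring B] (y : B) :
    Commute (mulSeries (HahnSeries.C y)) (tauOp (B := B)) := by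
  have h : ∀ x : OpCoeffs B,
      mulSeries (HahnSeries.C y) (tauOp x) = tauOp (mulSeries (HahnSeries.C y) x) := fun x => by
    rw [tauOp_mulSeries, shiftSeries_C]
  exact AddMonoidHom.ext h

/-- Left multiplication by series as a ring homomorphism. -/
def mulSeriesHom (B : Type*) [Ring B] : USeries B →+* AddMonoid.End (OpCoeffs B) where
  toFun := mulSeries
  map_one' := mulSeries_one
  map_mul' := mulSeries_mul
  map_zero' := AddMonoidHom.ext fun x => Finsupp.ext fun k => zero_mul (x k)
  map_add' f g := AddMonoidHom.ext fun x => Finsupp.ext fun k => add_mul f g (x k)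

/-- Extension of scalars for operators, followed by the right multiplication by a constant. -/
def extendOp {A B : Type*} [Ring A] [Ring B] (φ : A →+* B) (y : B) :
    OpCoeffs A →+ OpCoeffs B :=
  Finsupp.mapRange.addMonoidHom
    ((AddMonoidHom.mulRight (HahnSeries.C y)).comp (mapSeriesHom φ : USeries A →+ USeries B))

theorem extendOp_apply {A B : Type*} [Ring A] [Ring B] (φ : A →+* B) (y : B) (x : OpCoeffs A)
    (k : ℕ) : extendOp φ y x k = mapSeriesHom φ (x k) * HahnSeries.C y := rfl

theorem extendOp_tauOp {A B : Type*} [Ring A] [Ring B] (φ : A →+* B) (y : B) (x : OpCoeffs A) :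
    tauOp (extendOp φ y x) = extendOp φ y (tauOp x) := by
  ext1 k
  cases k with
  | zero => rw [tauOp_apply_zero, extendOp_apply, tauOp_apply_zero, map_zero, zero_mul]
  | succ k =>
    rw [tauOp_apply_succ, extendOp_apply, extendOp_apply, tauOp_apply_succ, shiftSeries_mul,
      shiftSeries_C]
    congr 1
    exact (mapSeries_shift (φ : A →+ B) 1 (x k)).symm

theorem extendOp_mulSeries {A B : Type*} [Ring A] [Ring B] (φ : A →+* B) (y : B) (f : USeries A)
    (x : OpCoeffs A) :
    mulSeries (mapSeriesHom φ f) (extendOp φ y x) = extendOp φ y (mulSeries f x) := by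
  ext1 k
  rw [mulSeries_apply, extendOp_apply, extendOp_apply, mulSeries_apply, map_mul, mul_assoc]

/-- It compares the determinant over the algebra with the one over its extension by Grassmann
operators, where right multiplication by the vacuum is `J`. -/
theorem columnDet_semiconj {X Y : Type*} [AddCommGroup X] [AddCommGroup Y] (J : X →+ Y)
    {M : Matrix (Fin n) (Fin n) (AddMonoid.End X)} {N : Matrix (Fin n) (Fin n) (AddMonoid.End Y)}
    (h : ∀ i j x, N i j (J x) = J (M i j x)) (x : X) :
    columnDet N (J x) = J (columnDet M x) := by
  have hl : ∀ (l : ℕ) (f : Fin l → AddMonoid.End X) (g : Fin l → AddMonoid.End Y),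
      (∀ j x, g j (J x) = J (f j x)) →
      ∀ x, (List.ofFn g).prod (J x) = J ((List.ofFn f).prod x) := by
    intro l
    induction l with
    | zero => intro f g _ x; simp
    | succ l ih =>
      intro f g hfg x
      rw [List.ofFn_succ, List.ofFn_succ, List.prod_cons, List.prod_cons, end_mul_apply,
        end_mul_apply, ih _ _ (fun j => hfg j.succ), hfg]
  rw [columnDet, columnDet, end_sum_apply, end_sum_apply, map_sum]
  refine Finset.sum_congr rfl fun σ _ => ?_
  rw [end_zsmul_apply, end_zsmul_apply, map_zsmul, hl n _ _ fun j => h _ _]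

/-- The product of Grassmann columns applied to the vacuum equals `ψ_1 ⋯ ψ_n D vac`. It has only the
allowed poles, and taking the coefficient of the top monomial recovers `D`. -/
theorem poles_of_evalData {A K : Type*} [Ring A] [Algebra ℂ A] [Field K] (κ : K →+* A)
    (T : Matrix (Fin n) (Fin n) (USeries A)) (E : EvalData n m K (GrassAlg n A))
    (hψ : ∀ i, E.ψ i = grassIncl n A (Algebra.lmul ℂ _ (grass n i)))
    (hvac : E.vac = grassIncl n A (vacuum n)) (hκ : E.κ = (algIncl n A).comp κ)
    (hT : ∀ i j, mapSeriesHom (algIncl n A) (T i j) = E.mon 0 i j)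
    {D : OpCoeffs A} (hD : D = columnDet (Matrix.of fun i j : Fin n =>
      (if i = j then tauOp (B := A) else 0) - mulSeries (shiftSeries (-(j : ℤ)) (T i j))) opOne) :
    (∀ k > n, D k = 0) ∧
    ∀ k ≤ n, mapSeriesHom κ ((∏ t ∈ Finset.range (n - k), (uVar - (t : USeries K))) *
      ∏ k, (uVar - HahnSeries.C (E.w k))) * D k ∈ polySubring A := by
  obtain ⟨f, hf⟩ := exists_topCoeff n
  let φ : ExteriorAlgebra ℂ (Fin n → ℂ) →+* AddMonoid.End (OpCoeffs (GrassAlg n A)) :=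
    (mulSeriesHom _).comp (HahnSeries.C.comp ((grassIncl n A).comp
      (Algebra.lmul ℂ (ExteriorAlgebra ℂ (Fin n → ℂ))).toRingHom))
  have hφψ : ∀ i, φ (grass n i) = mulSeries (HahnSeries.C (E.ψ i)) := fun i => by
    rw [hψ]
    rfl
  let J := extendOp (algIncl n A) E.vac
  let M : Matrix (Fin n) (Fin n) (AddMonoid.End (OpCoeffs A)) := Matrix.of fun i j =>
    (if i = j then tauOp (B := A) else 0) - mulSeries (shiftSeries (-(j : ℤ)) (T i j))
  let N : Matrix (Fin n) (Fin n) (AddMonoid.End (OpCoeffs (GrassAlg n A))) := Matrix.of fun i j =>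
    (if i = j then tauOp (B := GrassAlg n A) else 0) - mulSeries (E.mon j i j)
  have hNM : ∀ i j x, N i j (J x) = J (M i j x) := by
    intro i j x
    have h1 : (if i = j then tauOp (B := GrassAlg n A) else 0) (J x) =
        J ((if i = j then tauOp (B := A) else 0) x) := by
      split_ifs
      · exact extendOp_tauOp _ _ x
      · exact (map_zero J).symm
    have h2 : E.mon j i j = mapSeriesHom (algIncl n A) (shiftSeries (-(j : ℤ)) (T i j)) := by
      rw [← E.shift_mon, ← hT]
      exact (mapSeries_shift (algIncl n A : A →+ GrassAlg n A) _ _).symm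
    have h3 : mulSeries (E.mon j i j) (J x) =
        J (mulSeries (shiftSeries (-(j : ℤ)) (T i j)) x) := by
      rw [h2]
      exact extendOp_mulSeries _ _ _ x
    exact (congrArg₂ (· - ·) h1 h3).trans (map_sub J _ _).symm
  have hφ : ∀ k i j, Commute (φ (grass n k)) (N i j) := by
    intro k i j
    rw [hφψ]
    have h1 : Commute (mulSeries (HahnSeries.C (E.ψ k))) (tauOp (B := GrassAlg n A)) :=
      commute_mulSeries_C_tauOp _
    have h2 : Commute (mulSeries (HahnSeries.C (E.ψ k))) (mulSeries (E.mon j i j)) :=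
      (E.commute_mon_ψ j i j k).symm.map (mulSeriesHom _)
    have h3 : ∀ x, mulSeries (HahnSeries.C (E.ψ k))
        ((if i = j then tauOp (B := GrassAlg n A) else 0) x) =
        (if i = j then tauOp (B := GrassAlg n A) else 0)
          (mulSeries (HahnSeries.C (E.ψ k)) x) := by
      split_ifs
      exacts [DFunLike.congr_fun h1.eq, fun x => map_zero _]
    exact AddMonoidHom.ext fun x => (map_sub _ _ _).trans
      (congrArg₂ (· - ·) (h3 x) (DFunLike.congr_fun h2.eq x))
  have htame := E.tame_prod
  have hcol : E.colOp = fun j => ∑ i, φ (grass n i) * N i j := by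
    funext j
    simp only [hφψ]
    rfl
  have hJ1 : (Finsupp.single 0 (HahnSeries.C E.vac) : OpCoeffs (GrassAlg n A)) = J opOne := by
    ext1 k
    rw [extendOp_apply, opOne, Finsupp.single_apply, Finsupp.single_apply]
    split_ifs
    · rw [map_one, one_mul]
    · rw [map_zero, zero_mul]
  rw [hcol, grassmann_columnDet φ N hφ, hJ1, end_mul_apply, columnDet_semiconj J hNM,
    show columnDet M opOne = D from hD.symm] at htame
  set Φ := φ (List.ofFn (grass n)).prod (J D) with hΦ
  -- Evaluated at 1, the vacuum projection gives 1 and `ψ_1 ⋯ ψ_n` gives the top monomial, on which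
  -- `f` is 1.
  have hΦk : ∀ k, mapSeries (topPart f) (Φ k) = D k := by
    intro k
    ext N
    have hc : (Φ k).coeff N = grassIncl n A (Algebra.lmul ℂ _ (List.ofFn (grass n)).prod) *
        (algIncl n A ((D k).coeff N) * E.vac) := by
      change (HahnSeries.C _ * (mapSeriesHom (algIncl n A) (D k) *
        HahnSeries.C E.vac)).coeff N = _
      rw [HahnSeries.C_apply, HahnSeries.C_apply, HahnSeries.coeff_single_zero_mul,
        HahnSeries.coeff_mul_single_zero, mapSeriesHom_coeff]
      rfl
    rw [mapSeries_coeff, hc, hvac, grassIncl_apply, grassIncl_apply, algIncl_apply,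
      GrassAlg.mk_mul, GrassAlg.mk_mul, one_mul, one_mul, mul_one, topPart_mk,
      Module.End.mul_apply, vacuum_one]
    change f (_ * 1) • _ = _
    rw [mul_one, hf, one_smul]
  refine ⟨fun k hk => ?_, fun k hk => ?_⟩
  · rw [← hΦk, htame.2 k (by omega), map_zero]
  · have h1 := E.mul_mem_poly_of_mem_tame (htame.1 k (n - k) (by omega))
    have h2 : ∀ t : ℕ, (EvalData.pt t 0 : USeries K) = uVar - (t : USeries K) :=
      fun t => by rw [EvalData.pt, add_zero, map_natCast]
    have h3 : ∀ c, (EvalData.pt 0 c : USeries K) = uVar - HahnSeries.C c :=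
      fun c => by rw [EvalData.pt, Nat.cast_zero, zero_add]
    simp only [h2, h3] at h1
    rw [← hΦk]
    have h4 := mapSeries_mul_of (φ := topPart f) (ρ := (E.κ : K →+ GrassAlg n A))
      (ρ' := (κ : K →+ A)) (fun c y => by rw [hκ]; exact topPart_mul f _ y)
      ((∏ t ∈ Finset.range (n - k), (uVar - (t : USeries K))) *
        ∏ k, (uVar - HahnSeries.C (E.w k))) (Φ k)
    intro N hN
    refine (congrArg (fun g => HahnSeries.coeff g N) h4.symm).trans ?_
    rw [mapSeries_coeff]
    exact (congrArg _ (h1 N hN)).trans (map_zero _)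

theorem bethe_poles (b : Fin m → ℕ) (lam : Fin n → ℂ) :
    (∀ k > n, betheDifference b lam k = 0) ∧
    ∀ k ≤ n, scalarHom m (SymVerma m lam) ((∏ t ∈ Finset.range (n - k),
      (uVar - (t : USeries (RatFun m)))) * ∏ k, (uVar - HahnSeries.C (wParam b k))) *
        betheDifference b lam k ∈ polySubring (RatEnd m (SymVerma m lam)) :=
  poles_of_evalData Algebra.TensorProduct.includeLeftRingHom (monodromy b lam) (evalData b lam)
    (fun _ => rfl) rfl rfl (map_monodromy b lam) rfl

end Poles

/-! ### Conjugation by `θ` and conclusion -/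

theorem thetaOp_apply {n m : ℕ} {b : Fin m → ℕ} {a : Fin n → ℕ} {lam : Fin n → ℂ}
    (h : Function.Bijective (theta b a lam)) (P : OpCoeffs (RatEnd m (SymVerma m lam))) (k : ℕ) :
    thetaOp h P k =
      mapSeries (LinearMap.lTensor (RatFun m) (thetaConj h)).toAddMonoidHom (P k) := rfl

/-- Coefficientwise conjugation is linear over the rational functions, so denominators cleared
before it are cleared after it. -/
theorem lTensor_scalar_mul {m : ℕ} {W W' : Type*} [AddCommGroup W] [Module ℂ W] [AddCommGroup W']
    [Module ℂ W'] (φ : Module.End ℂ W →ₗ[ℂ] Module.End ℂ W') (c : RatFun m) (y : RatEnd m W) :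
    LinearMap.lTensor (RatFun m) φ ((c ⊗ₜ[ℂ] (1 : Module.End ℂ W)) * y) =
      (c ⊗ₜ[ℂ] (1 : Module.End ℂ W')) * LinearMap.lTensor (RatFun m) φ y := by
  induction y using TensorProduct.induction_on with
  | zero => rw [mul_zero, map_zero, mul_zero]
  | tmul p X =>
    rw [Algebra.TensorProduct.tmul_mul_tmul, LinearMap.lTensor_tmul, LinearMap.lTensor_tmul,
      Algebra.TensorProduct.tmul_mul_tmul, one_mul, one_mul]
  | add x y hx hy => rw [mul_add, map_add, hx, hy, map_add, mul_add]

end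

end BetheGaudin

theorem proposition5p3 (n m : ℕ) (a : Fin n → ℕ) (b : Fin m → ℕ)
    (hab : ∑ k, b k = ∑ i, a i) (lam : Fin n → ℂ)
    (hθ : Function.Bijective (BetheGaudin.theta b a lam)) :
    (∃ C : Fin (m + 1) → Fin (n + 1) → BetheGaudin.RatEnd m (BetheGaudin.symWeight b a),
      BetheGaudin.IsBetheExpansion hθ C ∧ ∀ i j, C i j ∈ BetheGaudin.betheAlgebra hθ) ∧
    ∀ C : Fin (m + 1) → Fin (n + 1) → BetheGaudin.RatEnd m (BetheGaudin.symWeight b a),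
      BetheGaudin.IsBetheExpansion hθ C →
      (∀ (i : Fin (m + 1)) (j : Fin (n + 1)), C i j ∈
        BetheGaudin.filtration (m := m) (W := Module.End ℂ (BetheGaudin.symWeight b a)) ((m : ℤ) - (i : ℕ))) ∧
      ∑ i : Fin (m + 1), ∑ j : Fin (n + 1), BetheGaudin.mulSeries
          (HahnSeries.C (BetheGaudin.grade ((m : ℤ) - (i : ℕ)) (C i j)) *
            BetheGaudin.uVar ^ ((i : ℕ) + (j : ℕ)))
          (BetheGaudin.ofLeftMul (BetheGaudin.partialOp ^ (j : ℕ))) =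
        BetheGaudin.mulSeries
          (BetheGaudin.scalarSeries _ (BetheGaudin.uVar ^ n *
            ∏ k, (BetheGaudin.uVar - HahnSeries.C (BetheGaudin.ratVar k))))
          (BetheGaudin.gaudinOp hθ) := by
  open BetheGaudin in
  obtain ⟨hvan, hpoly⟩ := bethe_poles b lam
  -- Leading part and poles are established on the whole tensor product and then carried to
  -- `symWeight b a` by the linear map `thetaConj hθ`.
  refine expansion_and_leading (wParam b) (degLE_wParam b) (scaleCoeff_wParam b)
    ((opRel_bethe b lam).mapRange (thetaConj hθ) (thetaOp_apply hθ _) (thetaOp_apply hθ _))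
    (fun k hk N hN => ?_) (fun k hk => ?_) (betheAlgebra hθ)
    (fun k N => Algebra.subset_adjoin ⟨k, N, rfl⟩) (fun C => Iff.rfl)
  · have h := mapSeries_mul_of
      (φ := (LinearMap.lTensor (RatFun m) (thetaConj hθ)).toAddMonoidHom)
      (ρ := ((Algebra.TensorProduct.includeLeftRingHom :
        RatFun m →+* RatEnd m (SymVerma m lam)) : RatFun m →+ RatEnd m (SymVerma m lam)))
      (ρ' := ((Algebra.TensorProduct.includeLeftRingHom :
        RatFun m →+* RatEnd m (symWeight b a)) : RatFun m →+ RatEnd m (symWeight b a)))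
      (fun c y => lTensor_scalar_mul (thetaConj hθ) c y)
      ((∏ t ∈ Finset.range (n - k), (uVar - (t : USeries (RatFun m)))) *
        ∏ k, (uVar - HahnSeries.C (wParam b k))) (betheDifference b lam k)
    refine (congrArg (fun g => HahnSeries.coeff g N) h.symm).trans ?_
    rw [mapSeries_coeff]
    exact (congrArg _ (hpoly k hk N hN)).trans (map_zero _)
  · rw [thetaOp_apply, hvan k hk, map_zero]
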